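/- Definitions. A permutation of length $n$ is a pair $\pi=(S,P)$, where $S$ is a set of $n$ positive integers and $P:S\to\mathbb N^2$ is such that no two of the points $P(i)$, $i \in S$, share an $x$-coordinate or a $y$-coordinate; it is reduced if $S=[n]$ and $P(S)\subseteq[n]\times[n]$. A rectangle is a product $I_1\times I_2$ of two nonempty discrete intervals. A rectangle family $\mathcal R$ is a finite set of indices together with a rectangle for each of them; $\pi$ is viewed as a family of one-point rectangles. For two distinct indices $i,j$ of $\mathcal R$ and an integer $k$ that is not an index, $\mathcal R[i,j\to k]$ is the family in which the rectangles $i,j$ are replaced by their bounding box, with index $k$. A decomposition of $\pi$ is a sequence $\mathcal R_0=\pi,\mathcal R_1,\dots,\mathcal R_s$ of rectangle families such that for some $\max S<k_1<\dots<k_s$ each $\mathcal R_p$ ($1\le p\le s$) equals $\mathcal R_{p-1}[i_p,j_p\to k_p]$ for some $i_p, j_p$, and such that $\mathcal R_s$ consists of one rectangle; the list of the triples $(i_p,j_p,k_p)$ is its merge sequence. The decomposition is $d$-wide if in each $\mathcal R_p$, for each index $i$ and each $\alpha\in\{1,2\}$, fewer than $d$ other rectangles of $\mathcal R_p$ have an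 $\alpha$-th interval that meets the $\alpha$-th interval of rectangle $i$. An $r\times r$-grid in $\pi$ consists of partitions of two intervals of positive integers into consecutive intervals $I_1<\dots<I_r$ and $J_1<\dots<J_r$ such that every cell $I_x\times J_y$ contains a point of $P(S)$. Theorem. Let $f(r)=r^4\binom{r^2}{r}$ and $g(r)=4f(r)$; then $g(r)=2^{O(r\log r)}$. There is an algorithm (a program for a random access machine with words of $O(\log(n+r))$ bits, whose unit-cost operations are addition, subtraction, multiplication, division, comparison and memory access) that, given an integer $r\ge1$ and a reduced permutation $\pi$ of length $n\ge1$ as an array of $n$ points, runs in time $O(n)$, with a constant that does not depend on $r$, and either finds an $r\times r$-grid in $\pi$ (and outputs the endpoints of its intervals) or returns the merge sequence of a $g(r)$-wide decomposition of $\pi$. -/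

import Mathlib

open Filter Asymptotics

namespace PermDecomp

/-! ### Points, rectangles, permutations -/

/-- A point of `ℕ²`; coordinate `0` is `x`, coordinate `1` is `y`. -/
abbrev Point : Type := Fin 2 → ℕ

/-- An axis-parallel rectangle `I × J`, given by its two discrete intervals
`R 0 = I` and `R 1 = J`; `NonemptyInterval ℕ` is the type of pairs `p ≤ q`, read as `[p, q]`. -/
abbrev Rect : Type := Fin 2 → NonemptyInterval ℕ

/-- The rectangle consisting of a single point. -/
def Point.toRect (p : Point) : Rect := fun α => NonemptyInterval.pure (p α)

/-- The point `p` lies in the rectangle `R`. -/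
def Rect.Contains (R : Rect) (p : Point) : Prop := ∀ α, p α ∈ R α

/-- A permutation, as a finite family of points in general position indexed by a finite set `S`
of positive integers. Only the values of `P` on `S` are meaningful. -/
structure Permutation where
  S : Finset ℕ
  P : ℕ → Point
  pos : ∀ i ∈ S, 1 ≤ i
  general : ∀ i ∈ S, ∀ j ∈ S, i ≠ j → ∀ α, P i α ≠ P j α

/-- The length of a permutation. -/
def Permutation.length (π : Permutation) : ℕ := π.S.card

/-- The point set `P(S)` of a permutation. -/
def Permutation.points (π : Permutation) : Set Point := π.P '' (π.S : Set ℕ)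

/-- `π` is reduced: `S = [n]` and `P(S) ⊆ [n] × [n]`, where `n` is the length of `π`. -/
def Permutation.Reduced (π : Permutation) : Prop :=
  π.S = Finset.Icc 1 π.length ∧ ∀ i ∈ π.S, ∀ α, 1 ≤ π.P i α ∧ π.P i α ≤ π.length

/-! ### Rectangle families, decompositions, width -/

/-- A finite family of rectangles indexed by a set `S` of natural numbers.
Only the values of `R` on `S` are meaningful. -/
structure RectFamily where
  S : Finset ℕ
  R : ℕ → Rect

/-- A permutation viewed as a family of one-point rectangles. -/
def Permutation.toFamily (π : Permutation) : RectFamily where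
  S := π.S
  R := fun i => (π.P i).toRect

/-- The family obtained by replacing the rectangles `i`, `j` by their bounding box, with index `k`.
The join of two intervals is the smallest interval that contains both. -/
def RectFamily.merge (F : RectFamily) (i j k : ℕ) : RectFamily where
  S := insert k ((F.S.erase i).erase j)
  R := Function.update F.R k (F.R i ⊔ F.R j)

/-- `F'` arises from `F` by merging two distinct rectangles `i`, `j` of `F` into a new one `k`. -/
def RectFamily.IsMerge (F : RectFamily) (i j k : ℕ) (F' : RectFamily) : Prop :=
  i ∈ F.S ∧ j ∈ F.S ∧ i ≠ j ∧ k ∉ F.S ∧ F' = F.merge i j k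

/-- `D 0, …, D s` is a decomposition of `π`. -/
structure IsDecomposition (π : Permutation) {s : ℕ} (D : Fin (s + 1) → RectFamily) : Prop where
  start : D 0 = π.toFamily
  step : ∃ k : Fin s → ℕ, StrictMono k ∧ (∀ p, ∀ i ∈ π.S, i < k p) ∧
    ∀ p : Fin s, ∃ i j, (D p.castSucc).IsMerge i j (k p) (D p.succ)
  finish : (D (Fin.last s)).S.card = 1

/-- An entry `(i, j, k)` of a merge sequence. -/
structure MergeStep where
  i : ℕ
  j : ℕ
  k : ℕ

/-- `σ` is the merge sequence of `D`. -/
def IsMergeSequence {s : ℕ} (D : Fin (s + 1) → RectFamily) (σ : Fin s → MergeStep) : Prop :=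
  ∀ p : Fin s, (D p.castSucc).IsMerge (σ p).i (σ p).j (σ p).k (D p.succ)

/-- Two rectangles `α`-view each other. -/
def Rect.Views (α : Fin 2) (R R' : Rect) : Prop :=
  ((R α : Set ℕ) ∩ (R' α : Set ℕ)).Nonempty

open Classical in
/-- The set of the rectangles, other than `i`, that `i` `α`-views. -/
noncomputable def RectFamily.viewSet (F : RectFamily) (α : Fin 2) (i : ℕ) : Finset ℕ :=
  (F.S.erase i).filter fun j => Rect.Views α (F.R i) (F.R j)

/-- The view number of the rectangle `i`. -/
noncomputable def RectFamily.view (F : RectFamily) (i : ℕ) : ℕ :=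
  max (F.viewSet 0 i).card (F.viewSet 1 i).card

/-- A family is `d`-wide if all its view numbers are less than `d`. -/
def RectFamily.Wide (d : ℕ) (F : RectFamily) : Prop := ∀ i ∈ F.S, F.view i < d

/-! ### Grids -/

/-- `Q` is a partition of the interval `I` into `s` intervals, listed from left to right. -/
structure IsPartition {s : ℕ} (Q : Fin s → NonemptyInterval ℕ) (I : NonemptyInterval ℕ) :
    Prop where
  disjoint : Pairwise fun a b => Disjoint (Q a : Set ℕ) (Q b : Set ℕ)
  union : ⋃ a, (Q a : Set ℕ) = (I : Set ℕ)
  ordered : ∀ a b, a < b → (Q a).snd < (Q b).fst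

/-- An `r × s`-gridding of the rectangle `R`, which consists of points with positive
coordinates. -/
structure Gridding (R : Rect) (r s : ℕ) where
  col : Fin r → NonemptyInterval ℕ
  row : Fin s → NonemptyInterval ℕ
  pos : ∀ α, 1 ≤ (R α).fst
  col_partition : IsPartition col (R 0)
  row_partition : IsPartition row (R 1)

/-- The cell in column `x` and row `y`. -/
def Gridding.cell {R : Rect} {r s : ℕ} (G : Gridding R r s) (x : Fin r) (y : Fin s) : Rect :=
  ![G.col x, G.row y]

/-- `G` is an `r × s`-grid in the point set `M`: every cell contains a point of `M`. -/
def Gridding.IsGridIn {R : Rect} {r s : ℕ} (G : Gridding R r s) (M : Set Point) : Prop :=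
  ∀ x y, ∃ p ∈ M, (G.cell x y).Contains p

/-- `f(r) = r⁴ · binom(r², r)`. -/
def gridBound (r : ℕ) : ℕ := r ^ 4 * (r ^ 2).choose r

/-- `g(r) = 4 f(r)`. -/
def gridWidth (r : ℕ) : ℕ := 4 * gridBound r

/-! ### A random access machine

The machine has word-valued registers and word-addressed arrays of words; a program is a fixed
finite text, so it names only finitely many registers and arrays. Words are natural numbers below
a bound `W`; a program gets stuck (has no run) if any value it computes does not fit in a word.
Every arithmetic operation, comparison, memory access and command costs one unit of time. -/

/-- Contents of the registers and of the arrays. -/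
structure Store where
  var : ℕ → ℕ
  arr : ℕ → ℕ → ℕ

def Store.setVar (s : Store) (x v : ℕ) : Store :=
  { s with var := Function.update s.var x v }

def Store.setArr (s : Store) (a i v : ℕ) : Store :=
  { s with arr := Function.update s.arr a (Function.update (s.arr a) i v) }

/-- Arithmetic operations and comparisons on words. -/
inductive BinOp where
  | add
  | sub
  | mul
  | div
  | lt
  | eq

/-- Subtraction is truncated at `0`, division is rounded down (and is `0` for divisor `0`),
comparisons yield `1` for true and `0` for false. -/
def BinOp.eval : BinOp → ℕ → ℕ → ℕ
  | .add, a, b => a + b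
  | .sub, a, b => a - b
  | .mul, a, b => a * b
  | .div, a, b => a / b
  | .lt, a, b => if a < b then 1 else 0
  | .eq, a, b => if a = b then 1 else 0

/-- Expressions: constants, registers, array entries `a[e]`, binary operations. -/
inductive Expr where
  | lit (c : ℕ)
  | var (x : ℕ)
  | get (a : ℕ) (e : Expr)
  | bin (o : BinOp) (e₁ e₂ : Expr)

/-- The value of an expression. -/
def Expr.eval (s : Store) : Expr → ℕ
  | .lit c => c
  | .var x => s.var x
  | .get a e => s.arr a (e.eval s)
  | .bin o e₁ e₂ => o.eval (e₁.eval s) (e₂.eval s)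

/-- All values that occur in the evaluation of the expression are less than `W`. -/
def Expr.Fits (W : ℕ) (s : Store) : Expr → Prop
  | .lit c => c < W
  | .var x => s.var x < W
  | .get a e => e.Fits W s ∧ s.arr a (e.eval s) < W
  | .bin o e₁ e₂ => e₁.Fits W s ∧ e₂.Fits W s ∧ o.eval (e₁.eval s) (e₂.eval s) < W

/-- The time for the evaluation of an expression: the number of its nodes. -/
def Expr.cost : Expr → ℕ
  | .lit _ => 1
  | .var _ => 1
  | .get _ e => e.cost + 1
  | .bin _ e₁ e₂ => e₁.cost + e₂.cost + 1

/-- Programs: `assign x e` is `x := e`, `put a e₁ e₂` is `a[e₁] := e₂`; a condition holds if its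
value is not `0`. -/
inductive Cmd where
  | skip
  | assign (x : ℕ) (e : Expr)
  | put (a : ℕ) (e₁ e₂ : Expr)
  | seq (c₁ c₂ : Cmd)
  | ite (e : Expr) (c₁ c₂ : Cmd)
  | loop (e : Expr) (c : Cmd)

/-- `Cmd.Runs W c s t s'`: with words below `W`, the program `c`, started in the store `s`,
halts after exactly `t` units of time in the store `s'`. Here `loop e c` is "while `e` do `c`". -/
inductive Cmd.Runs (W : ℕ) : Cmd → Store → ℕ → Store → Prop
  | skip (s : Store) : Cmd.Runs W .skip s 1 s
  | assign (s : Store) (x : ℕ) (e : Expr) (h : e.Fits W s) :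
      Cmd.Runs W (.assign x e) s (e.cost + 1) (s.setVar x (e.eval s))
  | put (s : Store) (a : ℕ) (e₁ e₂ : Expr) (h₁ : e₁.Fits W s) (h₂ : e₂.Fits W s) :
      Cmd.Runs W (.put a e₁ e₂) s (e₁.cost + e₂.cost + 1) (s.setArr a (e₁.eval s) (e₂.eval s))
  | seq {s s' s'' : Store} {t₁ t₂ : ℕ} {c₁ c₂ : Cmd}
      (h₁ : Cmd.Runs W c₁ s t₁ s') (h₂ : Cmd.Runs W c₂ s' t₂ s'') :
      Cmd.Runs W (.seq c₁ c₂) s (t₁ + t₂) s''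
  | ite_true {s s' : Store} {t : ℕ} {e : Expr} {c₁ c₂ : Cmd} (h : e.Fits W s)
      (he : e.eval s ≠ 0) (h₁ : Cmd.Runs W c₁ s t s') :
      Cmd.Runs W (.ite e c₁ c₂) s (e.cost + 1 + t) s'
  | ite_false {s s' : Store} {t : ℕ} {e : Expr} {c₁ c₂ : Cmd} (h : e.Fits W s)
      (he : e.eval s = 0) (h₂ : Cmd.Runs W c₂ s t s') :
      Cmd.Runs W (.ite e c₁ c₂) s (e.cost + 1 + t) s'
  | loop_true {s s' s'' : Store} {t₁ t₂ : ℕ} {e : Expr} {c : Cmd} (h : e.Fits W s)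
      (he : e.eval s ≠ 0) (h₁ : Cmd.Runs W c s t₁ s') (h₂ : Cmd.Runs W (.loop e c) s' t₂ s'') :
      Cmd.Runs W (.loop e c) s (e.cost + 1 + t₁ + t₂) s''
  | loop_false {s : Store} {e : Expr} {c : Cmd} (h : e.Fits W s) (he : e.eval s = 0) :
      Cmd.Runs W (.loop e c) s (e.cost + 1) s

/-! ### Input and output -/

/-- The input `(π, r)`: register `0` holds `n`, register `1` holds `r`, entry `i` of arrays `0`
and `1` holds the two coordinates of the point `i ∈ [n]`; everything else is `0`. -/
def inputStore (π : Permutation) (r : ℕ) : Store where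
  var := fun x => if x = 0 then π.length else if x = 1 then r else 0
  arr := fun a i =>
    if i ∈ π.S then (if a = 0 then π.P i 0 else if a = 1 then π.P i 1 else 0) else 0

/-- The output is the gridding `G`: register `0` holds `1`; arrays `2` and `3` list the left and
right ends of the columns, arrays `4` and `5` the lower and upper ends of the rows. -/
def Store.OutputsGrid (s : Store) {R : Rect} {r : ℕ} (G : Gridding R r r) : Prop :=
  s.var 0 = 1 ∧ ∀ x : Fin r,
    s.arr 2 (x + 1) = (G.col x).fst ∧ s.arr 3 (x + 1) = (G.col x).snd ∧
    s.arr 4 (x + 1) = (G.row x).fst ∧ s.arr 5 (x + 1) = (G.row x).snd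

/-- The output is the merge sequence `σ`: register `0` holds `0`, register `1` holds the number of
entries of `σ`, and arrays `2`, `3`, `4` list the components of the entries. -/
def Store.OutputsMergeSequence (s : Store) {m : ℕ} (σ : Fin m → MergeStep) : Prop :=
  s.var 0 = 0 ∧ s.var 1 = m ∧ ∀ p : Fin m,
    s.arr 2 (p + 1) = (σ p).i ∧ s.arr 3 (p + 1) = (σ p).j ∧ s.arr 4 (p + 1) = (σ p).k

end PermDecomp

open PermDecomp

namespace PermDecomp

/-! The algorithm keeps a gridding with `m₀` columns and `m₁` rows, together with its `N` nonempty
cells, and makes it coarser round by round. At the start every row and column has width one. Write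
`m = max m₀ m₁` and `F = min (gridBound r) n`. A line is a row or a column, and a block is a cell of
the coarser gridding.

Sparse rounds, `N ≤ F * m`. Consecutive lines are grouped greedily, with at most `4 * F` cells in a
group. A group and the first line of the next one together exceed `4 * F`, so `g` groups satisfy `2
* F * (g - 1) < N ≤ F * m`, and the number of lines is about halved (`greedy_ends`,
`shrink_of_sparse`). Then all rectangles in a common new cell are merged. Rectangles that view each
other lie in a common line, a line never meets more than `4 * F` rectangles, and a merge inside a
cell does not increase this number (`Labelled.wide`, `Labelled.merge`). Hence all families are `4 *
F`-wide.

Dense rounds, `F * m < N`. As `N ≤ n`, here `F` is the true value `gridBound r`. The blocks have `r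
^ 2` columns and `r ^ 2` rows. If `r` blocks in one block column have cells in the same `r` columns,
these columns and blocks cut out an `r × r`-grid (`extract_ends`). Otherwise, by pigeonhole, a block
column has at most `(r - 1) * (r ^ 2).choose r` wide blocks, that is, blocks with cells in at least
`r` columns (`WideInv.card_wide_le`); the same holds for tall blocks and block rows. A block that is
neither has at most `(r - 1) ^ 2` cells, any block at most `r ^ 4`. By the count of Marcus and
Tardos (`card_le_of_few_wide_blocks`, `dense_blocks`) the set of nonempty blocks is then dense in
the coarser gridding, and `F * m' + 1` of them suffice to go on, where `m'` is the new `m`. Once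
dense, the gridding stays dense, and the recorded merges lose their meaning.

A gridding with a single cell is not dense. So if the loop ends without a grid, then no round was
dense, and the recorded merges lead to a single rectangle (`Cells.exists_decomposition`).

Running time. A round costs `O(N + m)`, and `min N (F * (m - 1))` and `m - 1` both halve, so the
costs form a geometric series (`round_ends`). Nothing is ever cleared: the tables are addressed by
cell and a time stamp, and each search for equal sets of lines builds a trie of fresh nodes. Sorting
is needed only at the start, where inverting the two coordinate maps achieves it.

Word length. Every assignment exceeds the largest stored value by at most one, so linear time alone
implies that all values are polynomial in `n + r` (`Cmd.Steps.runs`). This allows the analysis to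
ignore word bounds until the end. -/

/-! ### Execution without a bound on the words -/

/-- `Cmd.Steps c s t s'`: on a machine with unbounded words, `c` takes the store `s` to `s'`
in exactly `t` units of time. -/
inductive Cmd.Steps : Cmd → Store → ℕ → Store → Prop
  | skip (s : Store) : Cmd.Steps .skip s 1 s
  | assign (s : Store) (x : ℕ) (e : Expr) :
      Cmd.Steps (.assign x e) s (e.cost + 1) (s.setVar x (e.eval s))
  | put (s : Store) (a : ℕ) (e₁ e₂ : Expr) :
      Cmd.Steps (.put a e₁ e₂) s (e₁.cost + e₂.cost + 1) (s.setArr a (e₁.eval s) (e₂.eval s))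
  | seq {s s' s'' : Store} {t₁ t₂ : ℕ} {c₁ c₂ : Cmd}
      (h₁ : Cmd.Steps c₁ s t₁ s') (h₂ : Cmd.Steps c₂ s' t₂ s'') :
      Cmd.Steps (.seq c₁ c₂) s (t₁ + t₂) s''
  | ite_true {s s' : Store} {t : ℕ} {e : Expr} {c₁ c₂ : Cmd}
      (he : e.eval s ≠ 0) (h₁ : Cmd.Steps c₁ s t s') :
      Cmd.Steps (.ite e c₁ c₂) s (e.cost + 1 + t) s'
  | ite_false {s s' : Store} {t : ℕ} {e : Expr} {c₁ c₂ : Cmd}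
      (he : e.eval s = 0) (h₂ : Cmd.Steps c₂ s t s') :
      Cmd.Steps (.ite e c₁ c₂) s (e.cost + 1 + t) s'
  | loop_true {s s' s'' : Store} {t₁ t₂ : ℕ} {e : Expr} {c : Cmd}
      (he : e.eval s ≠ 0) (h₁ : Cmd.Steps c s t₁ s') (h₂ : Cmd.Steps (.loop e c) s' t₂ s'') :
      Cmd.Steps (.loop e c) s (e.cost + 1 + t₁ + t₂) s''
  | loop_false {s : Store} {e : Expr} {c : Cmd} (he : e.eval s = 0) :
      Cmd.Steps (.loop e c) s (e.cost + 1) s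

/-! ### Programs whose values grow slowly fit in logarithmic words -/

/-- All values in the store are at most `B`. -/
def Store.Le (s : Store) (B : ℕ) : Prop := (∀ x, s.var x ≤ B) ∧ ∀ a i, s.arr a i ≤ B

/-- Expressions whose value is at most the largest value in the store. -/
inductive Expr.Flat : Expr → Prop
  | zero : Expr.Flat (.lit 0)
  | one : Expr.Flat (.lit 1)
  | var (x : ℕ) : Expr.Flat (.var x)
  | get (a : ℕ) (e : Expr) : Expr.Flat (.get a e)
  | sub {e₁ : Expr} (e₂ : Expr) (h : Expr.Flat e₁) : Expr.Flat (.bin .sub e₁ e₂)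
  | div {e₁ : Expr} (e₂ : Expr) (h : Expr.Flat e₁) : Expr.Flat (.bin .div e₁ e₂)

/-- Expressions whose value exceeds the largest value in the store by at most one. A minimum is
written by means of truncated subtraction. -/
inductive Expr.Slow : Expr → Prop
  | flat {e : Expr} (h : e.Flat) : Expr.Slow e
  | inc {e : Expr} (h : e.Flat) : Expr.Slow (.bin .add e (.lit 1))
  | min (e₁ : Expr) {e₂ : Expr} (h : Expr.Slow e₂) : Expr.Slow (.bin .sub e₁ (.bin .sub e₁ e₂))

/-- Programs that assign only slowly growing values. -/
def Cmd.Tame : Cmd → Prop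
  | .skip => True
  | .assign _ e => e.Slow
  | .put _ _ e => e.Slow
  | .seq c₁ c₂ => c₁.Tame ∧ c₂.Tame
  | .ite _ c₁ c₂ => c₁.Tame ∧ c₂.Tame
  | .loop _ c => c.Tame

/-- An exponent that bounds the values occurring in the evaluation of an expression. -/
def Expr.deg : Expr → ℕ
  | .lit c => c + 1
  | .var _ => 1
  | .get _ e => e.deg
  | .bin _ e₁ e₂ => e₁.deg + e₂.deg

/-- Summing over all parts is wasteful, but then a single power bounds the values of all expressions
in the program. -/
def Cmd.deg : Cmd → ℕ
  | .skip => 1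
  | .assign _ e => e.deg
  | .put _ e₁ e₂ => e₁.deg + e₂.deg
  | .seq c₁ c₂ => c₁.deg + c₂.deg
  | .ite e c₁ c₂ => e.deg + c₁.deg + c₂.deg
  | .loop e c => e.deg + c.deg

theorem Expr.one_le_deg (e : Expr) : 1 ≤ e.deg := by
  induction e <;> simp [Expr.deg] <;> omega

theorem Expr.Flat.eval_le {e : Expr} (h : e.Flat) {s : Store} {B : ℕ} (hs : s.Le B)
    (hB : 1 ≤ B) : e.eval s ≤ B := by
  induction h with
  | zero => simp [Expr.eval]
  | one => simpa [Expr.eval] using hB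
  | var x => exact hs.1 x
  | get a e => exact hs.2 a _
  | sub e₂ h ih => exact (Nat.sub_le _ _).trans ih
  | div e₂ h ih => exact (Nat.div_le_self _ _).trans ih

/-- In the case of a minimum nothing is required of `e₁`, which may be a large product: the value is
at most that of the second argument. -/
theorem Expr.Slow.eval_le {e : Expr} (h : e.Slow) {s : Store} {B : ℕ} (hs : s.Le B)
    (hB : 1 ≤ B) : e.eval s ≤ B + 1 := by
  induction h with
  | flat h => exact (h.eval_le hs hB).trans (Nat.le_succ _)
  | inc h =>
    have := h.eval_le hs hB
    simpa [Expr.eval, BinOp.eval] using this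
  | min e₁ h ih =>
    simp only [Expr.eval, BinOp.eval] at *
    omega

/-- Both powers are at least 2, and `x + y ≤ x * y` for such numbers; a sum therefore costs no more
in the exponent than a product. -/
theorem pow_add_pow_le {B a b : ℕ} (hB : 2 ≤ B) (ha : 1 ≤ a) (hb : 1 ≤ b) :
    B ^ a + B ^ b ≤ B ^ (a + b) := by
  have h₁ : 2 ≤ B ^ a := hB.trans (Nat.le_self_pow (by omega) B)
  have h₂ : 2 ≤ B ^ b := hB.trans (Nat.le_self_pow (by omega) B)
  rw [pow_add]
  nlinarith

theorem Expr.eval_le_pow (e : Expr) {s : Store} {B : ℕ} (hs : s.Le B) (hB : 2 ≤ B) :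
    e.eval s ≤ B ^ e.deg := by
  induction e with
  | lit c =>
    simp only [Expr.eval, Expr.deg]
    calc c ≤ 2 ^ (c + 1) := (Nat.lt_two_pow_self.trans_le (Nat.pow_le_pow_right (by norm_num)
            (Nat.le_succ c))).le
      _ ≤ B ^ (c + 1) := Nat.pow_le_pow_left hB _
  | var x => simpa [Expr.eval, Expr.deg] using hs.1 x
  | get a e ih =>
    exact (hs.2 a _).trans (Nat.le_self_pow (by have := e.one_le_deg; simp [Expr.deg]; omega) B)
  | bin o e₁ e₂ ih₁ ih₂ =>
    have h := pow_add_pow_le hB e₁.one_le_deg e₂.one_le_deg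
    have hp : 1 ≤ B ^ (e₁.deg + e₂.deg) := Nat.one_le_pow _ _ (by omega)
    cases o <;> simp only [Expr.eval, BinOp.eval, Expr.deg]
    · omega
    · omega
    · rw [pow_add]; exact Nat.mul_le_mul ih₁ ih₂
    · exact (Nat.div_le_self _ _).trans (by omega)
    · split <;> omega
    · split <;> omega

theorem Expr.fits_of_pow_lt (e : Expr) {s : Store} {B W : ℕ} (hs : s.Le B) (hB : 2 ≤ B)
    (hW : B ^ e.deg < W) : e.Fits W s := by
  induction e with
  | lit c => exact ((Expr.lit c).eval_le_pow hs hB).trans_lt hW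
  | var x => exact ((Expr.var x).eval_le_pow hs hB).trans_lt hW
  | get a e ih => exact ⟨ih hW, ((Expr.get a e).eval_le_pow hs hB).trans_lt hW⟩
  | bin o e₁ e₂ ih₁ ih₂ =>
    refine ⟨ih₁ (lt_of_le_of_lt (Nat.pow_le_pow_right (by omega) ?_) hW),
      ih₂ (lt_of_le_of_lt (Nat.pow_le_pow_right (by omega) ?_) hW),
      ((Expr.bin o e₁ e₂).eval_le_pow hs hB).trans_lt hW⟩ <;> simp [Expr.deg]

theorem Store.Le.mono {s : Store} {A B : ℕ} (h : s.Le A) (hAB : A ≤ B) : s.Le B :=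
  ⟨fun x => (h.1 x).trans hAB, fun a i => (h.2 a i).trans hAB⟩

theorem Store.Le.setVar {s : Store} {B x v : ℕ} (h : s.Le B) (hv : v ≤ B) :
    (s.setVar x v).Le B := by
  refine ⟨fun y => ?_, h.2⟩
  simp only [Store.setVar, Function.update_apply]
  split
  exacts [hv, h.1 y]

theorem Store.Le.setArr {s : Store} {B a i v : ℕ} (h : s.Le B) (hv : v ≤ B) :
    (s.setArr a i v).Le B := by
  refine ⟨h.1, fun b j => ?_⟩
  simp only [Store.setArr, Function.update_apply]
  split
  · simp only [Function.update_apply]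
    split
    exacts [hv, h.2 a j]
  · exact h.2 b j

theorem Expr.one_le_cost (e : Expr) : 1 ≤ e.cost := by
  cases e <;> simp [Expr.cost]

/-- A unit of time raises the largest stored value by at most one. Hence the stored values never
exceed `B + t`, the evaluated ones never exceed `(B + t) ^ c.deg`, and a time bound is at the same
time a bound on the words. -/
theorem Cmd.Steps.runs {c : Cmd} {s s' : Store} {t : ℕ} (h : c.Steps s t s') (hc : c.Tame)
    {B W : ℕ} (hB : 2 ≤ B) (hs : s.Le B) (hW : (B + t) ^ c.deg < W) :
    c.Runs W s t s' ∧ s'.Le (B + t) := by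
  have key : ∀ {t t' d d' : ℕ}, (t' ≤ t) → d' ≤ d → ∀ {B : ℕ}, 2 ≤ B → (B + t) ^ d < W →
      (B + t') ^ d' < W := by
    intro t t' d d' ht hd B hB h
    exact lt_of_le_of_lt ((Nat.pow_le_pow_left (by omega) _).trans
      (Nat.pow_le_pow_right (by omega) hd)) h
  have fit : ∀ {t : ℕ} {e : Expr} {d : ℕ}, e.deg ≤ d → ∀ {B : ℕ} {s : Store}, 2 ≤ B → s.Le B →
      (B + t) ^ d < W → e.Fits W s := by
    intro t e d hd B s hB hs h
    exact e.fits_of_pow_lt hs hB (by simpa using key (Nat.zero_le t) hd hB h)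
  induction h generalizing B with
  | skip s => exact ⟨.skip s, hs.mono (Nat.le_add_right _ _)⟩
  | assign s x e =>
    refine ⟨.assign s x e (fit le_rfl hB hs hW), ?_⟩
    have := e.one_le_cost
    exact (hs.mono (by omega)).setVar ((hc.eval_le hs (by omega)).trans (by omega))
  | put s a e₁ e₂ =>
    refine ⟨.put s a e₁ e₂ (fit ?_ hB hs hW) (fit ?_ hB hs hW), ?_⟩
    · simp [Cmd.deg]
    · simp [Cmd.deg]
    have := e₁.one_le_cost
    exact (hs.mono (by omega)).setArr ((hc.eval_le hs (by omega)).trans (by omega))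
  | seq h₁ h₂ ih₁ ih₂ =>
    obtain ⟨r₁, l₁⟩ := ih₁ hc.1 hB hs (key (by omega) (by simp [Cmd.deg]) hB hW)
    obtain ⟨r₂, l₂⟩ := ih₂ hc.2 (by omega) l₁
      (by rw [add_assoc]; exact key (by omega) (by simp [Cmd.deg]) hB hW)
    exact ⟨.seq r₁ r₂, by rwa [← add_assoc]⟩
  | ite_true he h₁ ih =>
    obtain ⟨r₁, l₁⟩ := ih hc.1 hB hs (key (by omega) (by simp [Cmd.deg]; omega) hB hW)
    exact ⟨.ite_true (fit (by simp [Cmd.deg]; omega) hB hs hW) he r₁, l₁.mono (by omega)⟩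
  | ite_false he h₁ ih =>
    obtain ⟨r₁, l₁⟩ := ih hc.2 hB hs (key (by omega) (by simp [Cmd.deg]) hB hW)
    exact ⟨.ite_false (fit (by simp [Cmd.deg]; omega) hB hs hW) he r₁, l₁.mono (by omega)⟩
  | @loop_true s s' s'' t₁ t₂ e c he h₁ h₂ ih₁ ih₂ =>
    obtain ⟨r₁, l₁⟩ := ih₁ hc hB hs (key (by omega) (by simp [Cmd.deg]) hB hW)
    obtain ⟨r₂, l₂⟩ := ih₂ hc (by omega) l₁
      (by rw [add_assoc]; exact key (by omega) le_rfl hB hW)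
    exact ⟨.loop_true (fit (by simp [Cmd.deg]) hB hs hW) he r₁ r₂, l₂.mono (by omega)⟩
  | loop_false he =>
    exact ⟨.loop_false (fit (by simp [Cmd.deg]) hB hs hW) he, hs.mono (by omega)⟩

/-! ### Total correctness with time bounds -/

/-- Started in `s`, the program halts within time `T` in a store that satisfies `Q`. -/
def Cmd.Ends (c : Cmd) (s : Store) (T : ℕ) (Q : Store → Prop) : Prop :=
  ∃ t s₁, c.Steps s t s₁ ∧ t ≤ T ∧ Q s₁

/-- The registers that a program may write. -/
def Cmd.wv : Cmd → List ℕ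
  | .assign x _ => [x]
  | .seq c₁ c₂ => c₁.wv ++ c₂.wv
  | .ite _ c₁ c₂ => c₁.wv ++ c₂.wv
  | .loop _ c => c.wv
  | _ => []

/-- The arrays that a program may write. -/
def Cmd.wa : Cmd → List ℕ
  | .put a _ _ => [a]
  | .seq c₁ c₂ => c₁.wa ++ c₂.wa
  | .ite _ c₁ c₂ => c₁.wa ++ c₂.wa
  | .loop _ c => c.wa
  | _ => []

/-- `s'` agrees with `s` on everything that `c` does not write. -/
def Cmd.Frame (c : Cmd) (s s' : Store) : Prop :=
  (∀ y, y ∉ c.wv → s'.var y = s.var y) ∧ ∀ a, a ∉ c.wa → s'.arr a = s.arr a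

theorem Cmd.Steps.frame {c : Cmd} {s s' : Store} {t : ℕ} (h : c.Steps s t s') :
    c.Frame s s' := by
  induction h with
  | skip s => exact ⟨fun _ _ => rfl, fun _ _ => rfl⟩
  | assign s x e =>
    refine ⟨fun y hy => ?_, fun _ _ => rfl⟩
    simp only [Cmd.wv, List.mem_singleton] at hy
    simp [Store.setVar, hy]
  | put s a e₁ e₂ =>
    refine ⟨fun _ _ => rfl, fun b hb => ?_⟩
    simp only [Cmd.wa, List.mem_singleton] at hb
    simp [Store.setArr, hb]
  | seq h₁ h₂ ih₁ ih₂ =>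
    refine ⟨fun y hy => ?_, fun a ha => ?_⟩
    · simp only [Cmd.wv, List.mem_append, not_or] at hy
      rw [ih₂.1 y hy.2, ih₁.1 y hy.1]
    · simp only [Cmd.wa, List.mem_append, not_or] at ha
      rw [ih₂.2 a ha.2, ih₁.2 a ha.1]
  | ite_true he h₁ ih =>
    exact ⟨fun y hy => ih.1 y fun h => hy (List.mem_append_left _ h),
      fun a ha => ih.2 a fun h => ha (List.mem_append_left _ h)⟩
  | ite_false he h₁ ih =>
    exact ⟨fun y hy => ih.1 y fun h => hy (List.mem_append_right _ h),
      fun a ha => ih.2 a fun h => ha (List.mem_append_right _ h)⟩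
  | loop_true he h₁ h₂ ih₁ ih₂ =>
    exact ⟨fun y hy => (ih₂.1 y hy).trans (ih₁.1 y hy), fun a ha => (ih₂.2 a ha).trans (ih₁.2 a ha)⟩
  | loop_false he => exact ⟨fun _ _ => rfl, fun _ _ => rfl⟩

theorem Cmd.Ends.mono {c : Cmd} {s : Store} {T T' : ℕ} {Q Q' : Store → Prop}
    (h : c.Ends s T Q) (hT : T ≤ T') (hQ : ∀ s', c.Frame s s' → Q s' → Q' s') :
    c.Ends s T' Q' :=
  let ⟨t, s', h₁, h₂, h₃⟩ := h
  ⟨t, s', h₁, h₂.trans hT, hQ s' h₁.frame h₃⟩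

theorem Cmd.Ends.seq {c₁ c₂ : Cmd} {s : Store} {T₁ T₂ : ℕ} {Q : Store → Prop}
    (h : c₁.Ends s T₁ fun s' => c₂.Ends s' T₂ Q) : (Cmd.seq c₁ c₂).Ends s (T₁ + T₂) Q := by
  obtain ⟨t₁, s₁, h₁, ht₁, t₂, s₂, h₂, ht₂, hQ⟩ := h
  exact ⟨_, _, .seq h₁ h₂, add_le_add ht₁ ht₂, hQ⟩

theorem Cmd.Ends.then {c₁ c₂ : Cmd} {s : Store} {T₁ T₂ : ℕ} {P Q : Store → Prop}
    (h₁ : c₁.Ends s T₁ P) (h₂ : ∀ s', c₁.Frame s s' → P s' → c₂.Ends s' T₂ Q) :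
    (Cmd.seq c₁ c₂).Ends s (T₁ + T₂) Q :=
  .seq (h₁.mono le_rfl h₂)

theorem Cmd.Ends.ite {e : Expr} {c₁ c₂ : Cmd} {s : Store} {T : ℕ} {Q : Store → Prop}
    (h₁ : e.eval s ≠ 0 → c₁.Ends s T Q) (h₂ : e.eval s = 0 → c₂.Ends s T Q) :
    (Cmd.ite e c₁ c₂).Ends s (e.cost + 1 + T) Q := by
  by_cases he : e.eval s = 0
  · obtain ⟨t, s', h, ht, hQ⟩ := h₂ he
    exact ⟨_, _, .ite_false he h, by omega, hQ⟩
  · obtain ⟨t, s', h, ht, hQ⟩ := h₁ he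
    exact ⟨_, _, .ite_true he h, by omega, hQ⟩

/-- A loop whose body pays for itself with the potential `pot`. -/
theorem Cmd.Ends.loop {e : Expr} {c : Cmd} {I : Store → Prop} {pot : Store → ℕ}
    (hstep : ∀ s, I s → e.eval s ≠ 0 → ∃ T, c.Ends s T fun s' =>
      I s' ∧ pot s' + T + e.cost + 1 ≤ pot s) {s : Store} (hs : I s) :
    (Cmd.loop e c).Ends s (pot s + e.cost + 1) fun s' => I s' ∧ e.eval s' = 0 := by
  induction hp : pot s using Nat.strong_induction_on generalizing s with
  | _ p ih =>
    by_cases he : e.eval s = 0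
    · exact ⟨_, _, .loop_false he, by omega, hs, he⟩
    · obtain ⟨T, t₁, s₁, h₁, ht₁, hI, hpot⟩ := hstep s hs he
      obtain ⟨t₂, s₂, h₂, ht₂, hQ⟩ := ih (pot s₁) (by omega) hI rfl
      exact ⟨_, _, .loop_true he h₁ h₂, by omega, hQ⟩

/-! ### Straight-line programs -/

/-- The effect of a program without loops. -/
def Cmd.exec : Cmd → Store → Store
  | .skip, s => s
  | .assign x e, s => s.setVar x (e.eval s)
  | .put a e₁ e₂, s => s.setArr a (e₁.eval s) (e₂.eval s)
  | .seq c₁ c₂, s => c₂.exec (c₁.exec s)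
  | .ite e c₁ c₂, s => if e.eval s = 0 then c₂.exec s else c₁.exec s
  | .loop _ _, s => s

/-- A bound on the time of a program without loops. -/
def Cmd.time : Cmd → ℕ
  | .skip => 1
  | .assign _ e => e.cost + 1
  | .put _ e₁ e₂ => e₁.cost + e₂.cost + 1
  | .seq c₁ c₂ => c₁.time + c₂.time
  | .ite e c₁ c₂ => e.cost + 1 + (c₁.time + c₂.time)
  | .loop _ _ => 0

/-- The program contains no loop. -/
def Cmd.Straight : Cmd → Prop
  | .seq c₁ c₂ => c₁.Straight ∧ c₂.Straight
  | .ite _ c₁ c₂ => c₁.Straight ∧ c₂.Straight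
  | .loop _ _ => False
  | _ => True

theorem Cmd.Straight.steps {c : Cmd} (hc : c.Straight) (s : Store) :
    ∃ t, c.Steps s t (c.exec s) ∧ t ≤ c.time := by
  induction c generalizing s with
  | skip => exact ⟨_, .skip s, le_rfl⟩
  | assign x e => exact ⟨_, .assign s x e, le_rfl⟩
  | put a e₁ e₂ => exact ⟨_, .put s a e₁ e₂, le_rfl⟩
  | seq c₁ c₂ ih₁ ih₂ =>
    obtain ⟨t₁, h₁, l₁⟩ := ih₁ hc.1 s
    obtain ⟨t₂, h₂, l₂⟩ := ih₂ hc.2 (c₁.exec s)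
    exact ⟨_, .seq h₁ h₂, add_le_add l₁ l₂⟩
  | ite e c₁ c₂ ih₁ ih₂ =>
    by_cases he : e.eval s = 0
    · obtain ⟨t₂, h₂, l₂⟩ := ih₂ hc.2 s
      exact ⟨_, by simpa [Cmd.exec, he] using Cmd.Steps.ite_false he h₂, by
        simp only [Cmd.time]; omega⟩
    · obtain ⟨t₁, h₁, l₁⟩ := ih₁ hc.1 s
      exact ⟨_, by simpa [Cmd.exec, he] using Cmd.Steps.ite_true he h₁, by
        simp only [Cmd.time]; omega⟩
  | loop e c => exact hc.elim

theorem Cmd.Straight.ends {c : Cmd} (hc : c.Straight) {s : Store} {T : ℕ} {Q : Store → Prop}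
    (hT : c.time ≤ T) (hQ : Q (c.exec s)) : c.Ends s T Q :=
  let ⟨t, h, l⟩ := hc.steps s
  ⟨t, _, h, l.trans hT, hQ⟩

/-! ### Counting loops -/

/-- `for x = 1, …, h do c`, where `h` is a register. -/
def Cmd.forUp (x h : ℕ) (c : Cmd) : Cmd :=
  .seq (.assign x (.lit 1)) (.loop (.bin .lt (.var x) (.bin .add (.var h) (.lit 1)))
    (.seq c (.assign x (.bin .add (.var x) (.lit 1)))))

/-- The invariant is stated for the store after the counter has been increased, hence the `setVar`.
The frame condition relative to the store before the loop gives the body access to everything that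
the loop does not write. The summand 10 in `T + 10` pays for the test and the increment. -/
theorem Cmd.Ends.forUp {x h : ℕ} {c : Cmd} {s : Store} {n T : ℕ} (I : ℕ → Store → Prop)
    (hn : s.var h = n) (hxh : h ≠ x) (hx : x ∉ c.wv) (hh : h ∉ c.wv)
    (h0 : I 0 (s.setVar x 1))
    (hstep : ∀ k < n, ∀ s', (Cmd.forUp x h c).Frame s s' → s'.var x = k + 1 → I k s' →
      c.Ends s' T fun s'' => I (k + 1) (s''.setVar x (k + 2))) :
    (Cmd.forUp x h c).Ends s (n * (T + 10) + 10) (I n) := by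
  have hwv : (Cmd.forUp x h c).wv = x :: (c.wv ++ [x]) := rfl
  have hwa : (Cmd.forUp x h c).wa = c.wa := by
    simp [Cmd.forUp, Cmd.wa]
  have main : ∀ d k s', k + d = n → (Cmd.forUp x h c).Frame s s' → s'.var x = k + 1 → I k s' →
      (Cmd.loop (.bin .lt (.var x) (.bin .add (.var h) (.lit 1)))
        (.seq c (.assign x (.bin .add (.var x) (.lit 1))))).Ends s' (d * (T + 10) + 8) (I n) := by
    intro d
    induction d with
    | zero =>
      intro k s' hk hf hxk hI
      have hhn : s'.var h = n := by rw [hf.1 h (by simp [hwv, hxh, hh]), hn]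
      refine ⟨_, _, .loop_false ?_, ?_, ?_⟩
      · simp only [Expr.eval, BinOp.eval, hxk, hhn]; simp; omega
      · simp [Expr.cost]
      · rw [← hk]; exact hI
    | succ d ih =>
      intro k s' hk hf hxk hI
      have hhn : s'.var h = n := by rw [hf.1 h (by simp [hwv, hxh, hh]), hn]
      obtain ⟨t₁, s₁, hs₁, ht₁, hI₁⟩ := hstep k (by omega) s' hf hxk hI
      have hx₁ : s₁.var x = k + 1 := by rw [hs₁.frame.1 x hx, hxk]
      have hs₂ : (Cmd.assign x (.bin .add (.var x) (.lit 1))).Steps s₁ 4 (s₁.setVar x (k + 2)) := by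
        have := Cmd.Steps.assign s₁ x (.bin .add (.var x) (.lit 1))
        simpa only [Expr.eval, BinOp.eval, hx₁, Expr.cost] using this
      have hf₂ : (Cmd.forUp x h c).Frame s (s₁.setVar x (k + 2)) := by
        constructor
        · intro y hy
          simp only [hwv, List.mem_cons, List.mem_append, not_or] at hy
          rw [← hf.1 y (by simp [hwv, hy.1, hy.2.1]), ← hs₁.frame.1 y hy.2.1]
          simp [Store.setVar, hy.1]
        · intro a ha
          rw [← hf.2 a ha, ← hs₁.frame.2 a (by rwa [hwa] at ha)]
          rfl
      obtain ⟨t₂, s₂, hs₃, ht₂, hQ⟩ := ih (k + 1) _ (by omega) hf₂ (by simp [Store.setVar]) hI₁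
      refine ⟨_, _, .loop_true ?_ (.seq hs₁ hs₂) hs₃, ?_, hQ⟩
      · simp only [Expr.eval, BinOp.eval, hxk, hhn]; simp; omega
      · simp only [Expr.cost]; rw [Nat.succ_mul]; omega
  have h₁ : (Cmd.assign x (.lit 1)).Steps s 2 (s.setVar x 1) := Cmd.Steps.assign s x (.lit 1)
  obtain ⟨t, s', hs, ht, hQ⟩ := main n 0 (s.setVar x 1) (by omega)
    ⟨fun y hy => by
      simp only [hwv, List.mem_cons, List.mem_append, not_or] at hy
      simp [Store.setVar, hy.1], fun a _ => rfl⟩ (by simp [Store.setVar]) h0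
  exact ⟨_, _, .seq h₁ hs, by omega, hQ⟩

/-! ### Names of the registers and arrays -/

notation "vLen" => 0
notation "vGrid" => 1
notation "vBound" => 2
notation "vCols" => 3
notation "vRows" => 4
notation "vCells" => 5
notation "vMerges" => 6
notation "vLast" => 7
notation "vStamp" => 8
notation "vFound" => 9
notation "vNodes" => 10
notation "vLoop" => 11
notation "vNewCols" => 12
notation "vNewRows" => 13
notation "vNew" => 14
notation "vPos" => 15
notation "vX" => 16
notation "vY" => 17
notation "vStart" => 18
notation "vBinom" => 19
notation "vRoot" => 20
notation "vNode" => 21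
notation "vLeaf" => 22
notation "vLeafX" => 23
notation "vMax" => 24

notation "aPtX" => 0
notation "aPtY" => 1
notation "aX1" => 6
notation "aY1" => 7
notation "aId" => 8
notation "aX2" => 9
notation "aY2" => 10
notation "aEndX" => 11
notation "aEndY" => 12
notation "aLabX" => 13
notation "aLabY" => 14
notation "aLeftX" => 15
notation "aLeftY" => 16
notation "aIndex" => 17
notation "aMark" => 18
notation "aNode" => 19
notation "aDepth" => 20
notation "aLastU" => 21
notation "aChild" => 22
notation "aKey" => 23
notation "aParent" => 24
notation "aHits" => 25
notation "aBreakX" => 26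
notation "aBreakY" => 27
notation "aPosX" => 28
notation "aPosY" => 29

prefix:max "#ₑ" => Expr.lit
prefix:max "!ₑ" => Expr.var
infixl:65 "+ₑ" => Expr.bin BinOp.add
infixl:65 "-ₑ" => Expr.bin BinOp.sub
infixl:70 "*ₑ" => Expr.bin BinOp.mul
infixl:70 "/ₑ" => Expr.bin BinOp.div
infix:50 "<ₑ" => Expr.bin BinOp.lt
infix:50 "=ₑ" => Expr.bin BinOp.eq
infixr:30 ";;" => Cmd.seq
infix:40 ":=ₑ" => Cmd.assign

/-! ### The program -/

/-- The minimum of two expressions. -/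
abbrev Expr.min (e₁ e₂ : Expr) : Expr := e₁ -ₑ (e₁ -ₑ e₂)

/-- The address of the cell in column `X` and row `Y` in the tables of the current round. -/
abbrev Expr.addr (X Y : Expr) : Expr :=
  (!ₑvStamp *ₑ (!ₑvLen +ₑ #ₑ1) +ₑ X) *ₑ (!ₑvLen +ₑ #ₑ1) +ₑ Y

/-- Computes `min (gridBound r) n`. -/
def binomBody : Cmd :=
  .ite (!ₑvBinom <ₑ !ₑvLen +ₑ #ₑ1)
    (vBinom :=ₑ Expr.min
      (!ₑvBinom *ₑ (!ₑvGrid *ₑ !ₑvGrid -ₑ (!ₑvLoop -ₑ #ₑ1)) /ₑ !ₑvLoop) (!ₑvLen +ₑ #ₑ1))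
    .skip

/-- `gridBound r` may not fit in a word, so only its minimum with `n` is computed. If `n < r ^ 4`
this is `n`; otherwise `r ≤ n`, a loop of length `r` is affordable, and the binomial coefficients
are cut off at `n + 1`. -/
def computeBound : Cmd :=
  .ite (!ₑvLen <ₑ !ₑvGrid *ₑ !ₑvGrid *ₑ !ₑvGrid *ₑ !ₑvGrid)
    (vBound :=ₑ !ₑvLen)
    ((vBinom :=ₑ #ₑ1) ;; .forUp vLoop vGrid binomBody ;;
      vBound :=ₑ Expr.min (!ₑvGrid *ₑ !ₑvGrid *ₑ !ₑvGrid *ₑ !ₑvGrid *ₑ !ₑvBinom) !ₑvLen)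

/-- Inverts the two coordinate maps. -/
def invertBody : Cmd :=
  .put aPosX (.get aPtX !ₑvLoop) !ₑvLoop ;; .put aPosY (.get aPtY !ₑvLoop) !ₑvLoop

/-- Lists the points by `x`-coordinate and by `y`-coordinate. -/
def listBody : Cmd :=
  .put aX1 !ₑvLoop !ₑvLoop ;;
  .put aY1 !ₑvLoop (.get aPtY (.get aPosX !ₑvLoop)) ;;
  .put aId !ₑvLoop (.get aPosX !ₑvLoop) ;;
  .put aX2 !ₑvLoop (.get aPtX (.get aPosY !ₑvLoop)) ;;
  .put aY2 !ₑvLoop !ₑvLoop ;;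
  .put aLeftX !ₑvLoop !ₑvLoop ;;
  .put aLeftY !ₑvLoop !ₑvLoop

/-- The left end of a fictitious line `n + 1` serves as the right boundary of the last line. -/
def initTail : Cmd :=
  .put aLeftX (!ₑvLen +ₑ #ₑ1) (!ₑvLen +ₑ #ₑ1) ;;
  .put aLeftY (!ₑvLen +ₑ #ₑ1) (!ₑvLen +ₑ #ₑ1) ;;
  (vCols :=ₑ !ₑvLen) ;; (vRows :=ₑ !ₑvLen) ;; (vMax :=ₑ !ₑvLen) ;; (vCells :=ₑ !ₑvLen) ;;
  (vLast :=ₑ !ₑvLen)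

/-- The coordinates are permutations of `[n]`, so their inverses list the points in sorted order in
linear time. -/
def initLists : Cmd :=
  .forUp vLoop vLen invertBody ;; .forUp vLoop vLen listBody ;; initTail

/-- Records the last positions of the columns in the first list, and of the rows in the second. -/
def endsBody : Cmd :=
  .put aEndX (.get aX1 !ₑvLoop) !ₑvLoop ;; .put aEndY (.get aY2 !ₑvLoop) !ₑvLoop

/-- Greedily groups consecutive lines into groups with at most `4 F` cells. The array `E` holds the
last positions of the lines, `P` receives the labels, `g` the number of groups. -/
def greedyBody (E P g : ℕ) : Cmd :=
  .ite (#ₑ4 *ₑ !ₑvBound <ₑ .get E !ₑvLoop -ₑ !ₑvStart)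
    ((g :=ₑ !ₑg +ₑ #ₑ1) ;; vStart :=ₑ .get E (!ₑvLoop -ₑ #ₑ1)) .skip ;;
  .put P !ₑvLoop !ₑg

def greedy (E P m g : ℕ) : Cmd :=
  (g :=ₑ #ₑ1) ;; (vStart :=ₑ #ₑ0) ;; .forUp vLoop m (greedyBody E P g)

def greedyLabels : Cmd :=
  .forUp vLoop vCells endsBody ;;
  greedy aEndX aLabX vCols vNewCols ;; greedy aEndY aLabY vRows vNewRows

/-- Groups consecutive lines into blocks of `r ^ 2` lines. -/
def blockBody (P : ℕ) : Cmd :=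
  .put P !ₑvLoop ((!ₑvLoop -ₑ #ₑ1) /ₑ (!ₑvGrid *ₑ !ₑvGrid) +ₑ #ₑ1)

def blocks (P m g : ℕ) : Cmd :=
  .forUp vLoop m (blockBody P) ;;
  g :=ₑ (!ₑm -ₑ #ₑ1) /ₑ (!ₑvGrid *ₑ !ₑvGrid) +ₑ #ₑ1

/-- Extends the path of the block `(vX, vY)` in the trie by the line `u` of the current cell. -/
def descend (U : ℕ) : Cmd :=
  let A : Expr := Expr.addr !ₑvX !ₑvY
  let u : Expr := .get U !ₑvLoop
  let B : Expr := !ₑvNode *ₑ (!ₑvLen +ₑ #ₑ1) +ₑ u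
  .put aLastU A u ;;
  -- A block of depth 0 has no entry in `aNode` yet; its path is at the root of the current search.
  .ite (.get aDepth A =ₑ #ₑ0) (vNode :=ₑ !ₑvRoot) (vNode :=ₑ .get aNode A) ;;
  .ite (.get aChild B =ₑ #ₑ0)
    ((vNodes :=ₑ !ₑvNodes +ₑ #ₑ1) ;; .put aChild B !ₑvNodes ;;
      .put aKey !ₑvNodes u ;; .put aParent !ₑvNodes !ₑvNode) .skip ;;
  (vNode :=ₑ .get aChild B) ;;
  .put aNode A !ₑvNode ;;
  .put aDepth A (.get aDepth A +ₑ #ₑ1)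

/-- Counts the block `(vX, vY)` at its leaf. -/
def countLeaf : Cmd :=
  .ite (.get aDepth (Expr.addr !ₑvX !ₑvY) =ₑ !ₑvGrid)
    (.put aHits !ₑvNode (.get aHits !ₑvNode +ₑ #ₑ1) ;;
      .ite (.get aHits !ₑvNode =ₑ !ₑvGrid)
        ((vFound :=ₑ #ₑ1) ;; (vLeaf :=ₑ !ₑvNode) ;; vLeafX :=ₑ !ₑvX) .skip) .skip

/-- The list is sorted by `U`, so the last line recorded for a block is enough to recognise a line
that has been seen in it before. A path that has reached length `r` is left alone. -/
def wideBody (U V LU LV : ℕ) : Cmd :=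
  let A : Expr := Expr.addr !ₑvX !ₑvY
  (vX :=ₑ .get LU (.get U !ₑvLoop)) ;; (vY :=ₑ .get LV (.get V !ₑvLoop)) ;;
  .ite (.get aLastU A =ₑ .get U !ₑvLoop) .skip
    (.ite (.get aDepth A <ₑ !ₑvGrid) (descend U ;; countLeaf) .skip)

/-- Looks for `r` blocks in the same block column that share `r` nonempty columns. The cells are
listed in the arrays `U`, `V`, sorted by `U`. -/
def wide (U V LU LV : ℕ) : Cmd :=
  (vNodes :=ₑ !ₑvNodes +ₑ #ₑ1) ;; (vRoot :=ₑ !ₑvNodes) ;;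
  .forUp vLoop vCells (wideBody U V LU LV)

/-- The letters increase along every path from the root, so the way up from the leaf fills the
positions from `r` down to 1. -/
def extractBody (BU : ℕ) : Cmd :=
  .put BU (!ₑvGrid +ₑ #ₑ1 -ₑ !ₑvLoop) (.get aKey !ₑvNode) ;; vNode :=ₑ .get aParent !ₑvNode

def selectBody (BV LV : ℕ) : Cmd :=
  .ite (.get LV (!ₑvLoop -ₑ #ₑ1) <ₑ .get LV !ₑvLoop)
    (.ite (.get aNode (Expr.addr !ₑvLeafX (.get LV !ₑvLoop)) =ₑ !ₑvLeaf)
      (.ite (!ₑvPos <ₑ !ₑvGrid) ((vPos :=ₑ !ₑvPos +ₑ #ₑ1) ;; .put BV !ₑvPos !ₑvLoop) .skip)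
      .skip) .skip

/-- Reads off the breakpoints of the grid found by `wide`. -/
def extract (BU BV LV mu mv : ℕ) : Cmd :=
  (vNode :=ₑ !ₑvLeaf) ;; .forUp vLoop vGrid (extractBody BU) ;;
  .put BU (!ₑvGrid +ₑ #ₑ1) (!ₑmu +ₑ #ₑ1) ;;
  (vPos :=ₑ #ₑ0) ;; .forUp vLoop mv (selectBody BV LV) ;;
  .put BV (!ₑvGrid +ₑ #ₑ1) (!ₑmv +ₑ #ₑ1)

/-- The second search exchanges the two axes. A new stamp and a new root spare the clearing of the
tables left by the first one. -/
def searchGrid : Cmd :=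
  blocks aLabX vCols vNewCols ;; blocks aLabY vRows vNewRows ;;
  wide aX1 aY1 aLabX aLabY ;;
  .ite !ₑvFound (extract aBreakX aBreakY aLabY vCols vRows)
    ((vStamp :=ₑ !ₑvStamp +ₑ #ₑ1) ;; wide aY2 aX2 aLabY aLabX ;;
      .ite !ₑvFound (extract aBreakY aBreakX aLabX vRows vCols) .skip)

/-- Moves the first list to the coarser gridding; cells that coincide are merged. -/
def mergeBody : Cmd :=
  let A : Expr := Expr.addr !ₑvX !ₑvY
  (vX :=ₑ .get aLabX (.get aX1 !ₑvLoop)) ;; (vY :=ₑ .get aLabY (.get aY1 !ₑvLoop)) ;;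
  .ite (.get aIndex A =ₑ #ₑ0)
    ((vNew :=ₑ !ₑvNew +ₑ #ₑ1) ;; .put aIndex A !ₑvNew ;; .put aX1 !ₑvNew !ₑvX ;;
      .put aY1 !ₑvNew !ₑvY ;; .put aId !ₑvNew (.get aId !ₑvLoop))
    ((vMerges :=ₑ !ₑvMerges +ₑ #ₑ1) ;; (vLast :=ₑ !ₑvLast +ₑ #ₑ1) ;;
      .put 2 !ₑvMerges (.get aId (.get aIndex A)) ;; .put 3 !ₑvMerges (.get aId !ₑvLoop) ;;
      .put 4 !ₑvMerges !ₑvLast ;; .put aId (.get aIndex A) !ₑvLast)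

/-- Updates the left ends of the lines. -/
def leftBody (L P : ℕ) : Cmd :=
  .ite (.get P (!ₑvLoop -ₑ #ₑ1) <ₑ .get P !ₑvLoop)
    (.put L (.get P !ₑvLoop) (.get L !ₑvLoop)) .skip

def left (L P m g : ℕ) : Cmd :=
  .forUp vLoop m (leftBody L P) ;; .put L (!ₑg +ₑ #ₑ1) (!ₑvLen +ₑ #ₑ1)

/-- Moves the second list to the coarser gridding. -/
def moveBody : Cmd :=
  let A : Expr := Expr.addr !ₑvX !ₑvY
  (vX :=ₑ .get aLabX (.get aX2 !ₑvLoop)) ;; (vY :=ₑ .get aLabY (.get aY2 !ₑvLoop)) ;;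
  .ite (!ₑvNew <ₑ .get aIndex A) .skip
    (.ite (.get aMark A =ₑ #ₑ0)
      ((vPos :=ₑ !ₑvPos +ₑ #ₑ1) ;; .put aMark A #ₑ1 ;; .put aX2 !ₑvPos !ₑvX ;;
        .put aY2 !ₑvPos !ₑvY) .skip)

/-- Sets the new dimensions, and forgets cells if there are more than needed to find a grid. -/
def resize : Cmd :=
  (vCols :=ₑ !ₑvNewCols) ;; (vRows :=ₑ !ₑvNewRows) ;;
  .ite (!ₑvCols <ₑ !ₑvRows) (vMax :=ₑ !ₑvRows) (vMax :=ₑ !ₑvCols) ;;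
  vNew :=ₑ Expr.min !ₑvNew (!ₑvBound *ₑ !ₑvMax +ₑ #ₑ1)

/-- `resize` cuts off the first list only; `moveBody` consults `aIndex` so that the second list
loses the same cells. -/
def contract : Cmd :=
  left aLeftX aLabX vCols vNewCols ;; left aLeftY aLabY vRows vNewRows ;;
  (vNew :=ₑ #ₑ0) ;; .forUp vLoop vCells mergeBody ;;
  resize ;;
  (vPos :=ₑ #ₑ0) ;; .forUp vLoop vCells moveBody ;;
  vCells :=ₑ !ₑvNew

def round : Cmd :=
  (vStamp :=ₑ !ₑvStamp +ₑ #ₑ1) ;;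
  .ite (!ₑvBound *ₑ !ₑvMax <ₑ !ₑvCells) searchGrid greedyLabels ;;
  .ite !ₑvFound .skip contract

def roundCond : Expr := #ₑ1 <ₑ !ₑvMax *ₑ (#ₑ1 -ₑ !ₑvFound)

def outputBody (B L lo hi : ℕ) : Cmd :=
  .put lo !ₑvLoop (.get L (.get B !ₑvLoop)) ;;
  .put hi !ₑvLoop (.get L (.get B (!ₑvLoop +ₑ #ₑ1)) -ₑ #ₑ1)

/-- The registers `vLen` and `vGrid` are those from which the output format reads its flag and the
number of merges; they are overwritten last. The merges already stand in the arrays 2, 3, 4, and a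
grid overwrites them. -/
def output : Cmd :=
  .ite !ₑvFound
    (.forUp vLoop vGrid (outputBody aBreakX aLeftX 2 3) ;;
      .forUp vLoop vGrid (outputBody aBreakY aLeftY 4 5) ;; vLen :=ₑ #ₑ1)
    ((vLen :=ₑ #ₑ0) ;; vGrid :=ₑ !ₑvMerges)

/-- Finds a grid or a decomposition. -/
def gridOrDecomposition : Cmd :=
  computeBound ;; initLists ;; .loop roundCond round ;; output

-- Products occur only in addresses, in conditions, in divisors and in the first argument of a
-- minimum, where they do not affect the growth of the stored values.
set_option linter.unusedTactic false in
theorem gridOrDecomposition_tame : gridOrDecomposition.Tame := by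
  simp only [gridOrDecomposition, computeBound, binomBody, initLists, invertBody, listBody,
    initTail, round, searchGrid, blocks, blockBody, wide, wideBody, descend, countLeaf, extract,
    extractBody, selectBody, greedyLabels, endsBody, greedy, greedyBody, contract, mergeBody, left,
    leftBody, moveBody, resize, output, outputBody, Cmd.Tame, Cmd.forUp, Expr.min]
  repeat' first
    | exact trivial
    | (refine .inc ?_; (repeat' constructor); done)
    | (refine .flat ?_; (repeat' constructor); done)
    | (refine .min _ (.flat ?_); (repeat' constructor); done)
    | (refine .min _ (.inc ?_); (repeat' constructor); done)
    | apply And.intro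

/-! ### Sequences of merges -/

/-- `Reach π d F σ`: the merges `σ` lead from `π` to `F` through `d`-wide families, and they use
the new indices `n + 1, n + 2, …`. -/
inductive Reach (π : Permutation) (d : ℕ) : RectFamily → List MergeStep → Prop
  | start (h : π.toFamily.Wide d) : Reach π d π.toFamily []
  | step {F F' : RectFamily} {σ : List MergeStep} {i j k : ℕ} (h : Reach π d F σ)
      (hm : F.IsMerge i j k F') (hw : F'.Wide d) (hk : k = π.length + σ.length + 1) :
      Reach π d F' (σ ++ [⟨i, j, k⟩])

theorem Reach.exists_families {π : Permutation} {d : ℕ} {F : RectFamily} {σ : List MergeStep}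
    (h : Reach π d F σ) : ∃ D : ℕ → RectFamily, D 0 = π.toFamily ∧ D σ.length = F ∧
      (∀ p ≤ σ.length, (D p).Wide d) ∧ ∀ p (hp : p < σ.length),
        (D p).IsMerge σ[p].i σ[p].j σ[p].k (D (p + 1)) ∧ σ[p].k = π.length + p + 1 := by
  induction h with
  | start h => exact ⟨fun _ => π.toFamily, rfl, rfl, fun _ _ => h, fun p hp => by simp at hp⟩
  | @step F F' σ i j k h hm hw hk ih =>
    obtain ⟨D, h0, hl, hD, hs⟩ := ih
    have hlen : (σ ++ [(⟨i, j, k⟩ : MergeStep)]).length = σ.length + 1 := by simp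
    refine ⟨fun p => if p ≤ σ.length then D p else F', by simp [h0], by simp, ?_, ?_⟩
    · intro p hp
      by_cases h : p ≤ σ.length
      · simpa [h] using hD p h
      · simpa [h] using hw
    · intro p hp
      rw [hlen] at hp
      rcases Nat.lt_succ_iff_lt_or_eq.mp hp with h | rfl
      · have := hs p h
        simpa [h.le, Nat.succ_le_of_lt h, List.getElem_append_left h] using this
      · subst hk
        simpa [hl] using hm

theorem Reach.exists_decomposition {π : Permutation} {d : ℕ} {F : RectFamily}
    {σ : List MergeStep} (h : Reach π d F σ) (hS : ∀ i ∈ π.S, i ≤ π.length)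
    (hF : F.S.card = 1) :
    ∃ D : Fin (σ.length + 1) → RectFamily, IsDecomposition π D ∧ (∀ p, (D p).Wide d) ∧
      IsMergeSequence D fun p => σ[p] := by
  obtain ⟨D, h0, hl, hD, hs⟩ := h.exists_families
  refine ⟨fun p => D p, ⟨by simpa using h0, ⟨fun p => π.length + p + 1, fun p q hpq => ?_,
    fun p i hi => ?_, fun p => ?_⟩, ?_⟩, fun p => hD p (Nat.lt_succ_iff.mp p.2), fun p => ?_⟩
  · simpa using hpq
  · have := hS i hi
    simp only
    omega
  · have := hs p p.2
    exact ⟨_, _, by simpa [← this.2] using this.1⟩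
  · simpa [hl] using hF
  · simpa using (hs p p.2).1

/-! ### Layouts of lines and their coarsenings -/

/-- The left ends `L 1 < … < L m` of `m` consecutive intervals that partition `[1, n]`. -/
structure Layout (n m : ℕ) (L : ℕ → ℕ) : Prop where
  first : L 1 = 1
  last : L (m + 1) = n + 1
  lt : ∀ x, 1 ≤ x → x ≤ m → L x < L (x + 1)

theorem Layout.mono {n m : ℕ} {L : ℕ → ℕ} (h : Layout n m L) {x y : ℕ} (hx : 1 ≤ x) (hxy : x ≤ y)
    (hy : y ≤ m + 1) : L x ≤ L y := by
  induction y, hxy using Nat.le_induction with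
  | base => exact le_rfl
  | succ y hxy ih => exact (ih (by omega)).trans (h.lt y (by omega) (by omega)).le

theorem Layout.eq_of_mem {n m : ℕ} {L : ℕ → ℕ} (h : Layout n m L) {x y c : ℕ} (hx : 1 ≤ x)
    (hxm : x ≤ m) (hy : 1 ≤ y) (hym : y ≤ m) (h₁ : L x ≤ c) (h₂ : c < L (x + 1)) (h₃ : L y ≤ c)
    (h₄ : c < L (y + 1)) : x = y := by
  rcases lt_trichotomy x y with hlt | rfl | hlt
  · have := h.mono (x := x + 1) (y := y) (by omega) hlt (by omega); omega
  · rfl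
  · have := h.mono (x := y + 1) (y := x) (by omega) hlt (by omega); omega

/-- The map `φ` groups the lines `1, …, m` into `m'` groups of consecutive lines. -/
structure Coarsening (m m' : ℕ) (φ : ℕ → ℕ) : Prop where
  pos : 1 ≤ m
  zero : φ 0 = 0
  one : φ 1 = 1
  last : φ m = m'
  step : ∀ x, 1 ≤ x → x < m → φ x ≤ φ (x + 1) ∧ φ (x + 1) ≤ φ x + 1

namespace Coarsening

variable {m m' : ℕ} {φ : ℕ → ℕ}

theorem mono (h : Coarsening m m' φ) {x y : ℕ} (hx : 1 ≤ x) (hxy : x ≤ y) (hy : y ≤ m) :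
    φ x ≤ φ y := by
  induction y, hxy using Nat.le_induction with
  | base => exact le_rfl
  | succ y hxy ih => exact (ih (by omega)).trans (h.step y (by omega) (by omega)).1

theorem one_le (h : Coarsening m m' φ) {x : ℕ} (hx : 1 ≤ x) (hxm : x ≤ m) : 1 ≤ φ x :=
  h.one ▸ h.mono le_rfl hx hxm

theorem le (h : Coarsening m m' φ) {x : ℕ} (hx : 1 ≤ x) (hxm : x ≤ m) : φ x ≤ m' :=
  h.last ▸ h.mono hx hxm le_rfl

/-- This permits updates in place: what is written for the line `x` goes to a position that has
already been read. -/
theorem le_self (h : Coarsening m m' φ) {x : ℕ} (hx : 1 ≤ x) (hxm : x ≤ m) : φ x ≤ x := by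
  induction x, hx using Nat.le_induction with
  | base => exact h.one.le
  | succ x hx ih => have := ih (by omega); have := h.step x hx (by omega); omega

theorem pos' (h : Coarsening m m' φ) : 1 ≤ m' := h.last ▸ h.one_le h.pos le_rfl

theorem surj (h : Coarsening m m' φ) {X : ℕ} (hX : 1 ≤ X) (hXm : X ≤ m') :
    ∃ x, 1 ≤ x ∧ x ≤ m ∧ φ x = X := by
  have : ∀ y, 1 ≤ y → y ≤ m → X ≤ φ y → ∃ x, 1 ≤ x ∧ x ≤ m ∧ φ x = X := by
    intro y hy
    induction y, hy using Nat.le_induction with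
    | base => intro _ h1; exact ⟨1, le_rfl, h.pos, by have := h.one; omega⟩
    | succ y hy ih =>
      intro hym hXy
      by_cases hc : X ≤ φ y
      · exact ih (by omega) hc
      · exact ⟨y + 1, by omega, hym, by have := h.step y hy (by omega); omega⟩
  exact this m h.pos le_rfl (by rw [h.last]; exact hXm)

end Coarsening

/-- The left ends after a coarsening. -/
structure CoarseLeft (n m m' : ℕ) (φ L L' : ℕ → ℕ) : Prop where
  start : ∀ x, 1 ≤ x → x ≤ m → φ (x - 1) < φ x → L' (φ x) = L x
  last : L' (m' + 1) = n + 1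

/-- The first inequality follows by walking from `x` back to the first line of its group, the second
by walking forward to the first line of the next group, or to the end of the square. -/
theorem CoarseLeft.contains {n m m' : ℕ} {φ L L' : ℕ → ℕ} (h : CoarseLeft n m m' φ L L')
    (hφ : Coarsening m m' φ) (hL : Layout n m L) {x : ℕ} (hx : 1 ≤ x) (hxm : x ≤ m) :
    L' (φ x) ≤ L x ∧ L (x + 1) ≤ L' (φ x + 1) := by
  constructor
  · induction x, hx using Nat.le_induction with
    | base => exact (h.start 1 le_rfl hxm (by simp [hφ.zero, hφ.one])).le
    | succ x hx ih =>
      by_cases hc : φ x < φ (x + 1)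
      · exact (h.start (x + 1) (by omega) hxm hc).le
      · have := hφ.step x hx (by omega)
        rw [show φ (x + 1) = φ x by omega]
        exact (ih (by omega)).trans (hL.lt x hx (by omega)).le
  · obtain ⟨d, rfl⟩ := Nat.exists_eq_add_of_le hxm
    clear hxm
    induction d generalizing x with
    | zero =>
      have h1 := hφ.last
      have h2 := h.last
      have h3 := hL.last
      simp only [add_zero] at h1 h3 ⊢
      rw [h1, h2, h3]
    | succ d ih =>
      have hs := hφ.step x hx (by omega)
      by_cases hc : φ x < φ (x + 1)
      · have := h.start (x + 1) (by omega) (by omega) hc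
        rw [← this, show φ (x + 1) = φ x + 1 by omega]
      · have h1 := ih (x := x + 1) (by omega) (by rwa [show x + 1 + d = x + (d + 1) by omega])
          (by rwa [show x + 1 + d = x + (d + 1) by omega])
          (by rwa [show x + 1 + d = x + (d + 1) by omega])
        have h2 : φ (x + 1) = φ x := le_antisymm (not_lt.mp hc) hs.1
        rw [h2] at h1
        exact (hL.lt (x + 1) (by omega) (by omega)).le.trans h1

theorem CoarseLeft.layout {n m m' : ℕ} {φ L L' : ℕ → ℕ} (h : CoarseLeft n m m' φ L L')
    (hφ : Coarsening m m' φ) (hL : Layout n m L) : Layout n m' L' where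
  first := by
    have := h.start 1 le_rfl hφ.pos (by simp [hφ.zero, hφ.one])
    rwa [hφ.one, hL.first] at this
  last := h.last
  lt X hX hXm := by
    obtain ⟨x, hx, hxm, rfl⟩ := hφ.surj hX hXm
    have := h.contains hφ hL hx hxm
    have := hL.lt x hx hxm
    omega

/-! ### Families whose rectangles lie in the cells of a gridding -/

/-- Every rectangle of `F` lies in one cell of the gridding with left ends `L`, and each line
meets at most `d` rectangles. The cell of the rectangle `i` is given by `lab · i`. -/
structure Labelled (n d : ℕ) (F : RectFamily) (m : Fin 2 → ℕ) (L lab : Fin 2 → ℕ → ℕ) :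
    Prop where
  layout : ∀ α, Layout n (m α) (L α)
  range : ∀ i ∈ F.S, ∀ α, 1 ≤ lab α i ∧ lab α i ≤ m α
  box : ∀ i ∈ F.S, ∀ α, L α (lab α i) ≤ (F.R i α).fst ∧ (F.R i α).snd < L α (lab α i + 1)
  count : ∀ α x, (F.S.filter fun i => lab α i = x).card ≤ d

/-- The lines are disjoint and each rectangle projects into one of them, so all rectangles that `i`
views lie in the line of `i`. The inequality is strict because `i` itself counts for the line but is
not viewed. -/
theorem Labelled.wide {n d : ℕ} {F : RectFamily} {m : Fin 2 → ℕ} {L lab : Fin 2 → ℕ → ℕ}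
    (h : Labelled n d F m L lab) : F.Wide d := by
  classical
  intro i hi
  have key : ∀ α, (F.viewSet α i).card < d := by
    intro α
    refine lt_of_lt_of_le (Finset.card_lt_card ?_) (h.count α (lab α i))
    rw [Finset.ssubset_iff_of_subset]
    · exact ⟨i, by simp [hi], by simp [RectFamily.viewSet]⟩
    · intro j hj
      simp only [RectFamily.viewSet, Finset.mem_filter, Finset.mem_erase] at hj
      obtain ⟨⟨-, hj⟩, c, hc₁, hc₂⟩ := hj
      simp only [Finset.mem_filter, hj, true_and]
      rw [SetLike.mem_coe, NonemptyInterval.mem_def] at hc₁ hc₂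
      have b₁ := h.box i hi α
      have b₂ := h.box j hj α
      exact (h.layout α).eq_of_mem (h.range j hj α).1 (h.range j hj α).2 (h.range i hi α).1
        (h.range i hi α).2 (b₂.1.trans hc₂.1) (hc₂.2.trans_lt b₂.2) (b₁.1.trans hc₁.1)
        (hc₁.2.trans_lt b₁.2)
  exact max_lt (key 0) (key 1)

/-- The bounding box stays in the common cell, and in each of the two lines of this cell two
rectangles are replaced by one. -/
theorem Labelled.merge {n d : ℕ} {F : RectFamily} {m : Fin 2 → ℕ} {L lab : Fin 2 → ℕ → ℕ}
    (h : Labelled n d F m L lab) {i j k : ℕ} (hi : i ∈ F.S) (hj : j ∈ F.S) (hij : i ≠ j)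
    (hk : k ∉ F.S) (hlab : ∀ α, lab α i = lab α j) :
    Labelled n d (F.merge i j k) m L fun α => Function.update (lab α) k (lab α i) := by
  have hne : ∀ l ∈ F.S, l ≠ k := fun l hl hlk => hk (hlk ▸ hl)
  have hmem : ∀ l ∈ (F.merge i j k).S, l = k ∨ (l ≠ k ∧ l ∈ F.S) := by
    intro l hl
    simp only [RectFamily.merge, Finset.mem_insert, Finset.mem_erase] at hl
    rcases hl with rfl | hl
    · exact .inl rfl
    · exact .inr ⟨hne l hl.2.2, hl.2.2⟩
  refine ⟨h.layout, ?_, ?_, ?_⟩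
  · intro l hl α
    rcases hmem l hl with rfl | ⟨h₁, h₂⟩
    · simpa using h.range i hi α
    · simpa [h₁] using h.range l h₂ α
  · intro l hl α
    rcases hmem l hl with rfl | ⟨h₁, h₂⟩
    · have b₁ := h.box i hi α
      have b₂ := h.box j hj α
      rw [← hlab α] at b₂
      simp only [RectFamily.merge, Function.update_self, Pi.sup_apply, NonemptyInterval.fst_sup,
        NonemptyInterval.snd_sup]
      exact ⟨le_inf b₁.1 b₂.1, sup_lt_iff.mpr ⟨b₁.2, b₂.2⟩⟩
    · simpa [RectFamily.merge, h₁] using h.box l h₂ α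
  · intro α x
    refine le_trans ?_ (h.count α x)
    by_cases hx : lab α i = x
    · have : (F.merge i j k).S.filter (fun l => Function.update (lab α) k (lab α i) l = x) ⊆
          insert k (((F.S.filter fun l => lab α l = x).erase i).erase j) := by
        intro l hl
        simp only [RectFamily.merge, Finset.mem_filter, Finset.mem_insert,
          Finset.mem_erase] at hl ⊢
        rcases hl with ⟨rfl | hl, h₂⟩
        · exact .inl rfl
        · rw [Function.update_of_ne (hne l hl.2.2)] at h₂
          exact .inr ⟨hl.1, hl.2.1, hl.2.2, h₂⟩
      refine (Finset.card_le_card this).trans ((Finset.card_insert_le _ _).trans ?_)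
      have hi' : i ∈ F.S.filter fun l => lab α l = x := by simp [hi, hx]
      have hj' : j ∈ (F.S.filter fun l => lab α l = x).erase i := by
        simp [hj, hij.symm, ← hlab α, hx]
      rw [Finset.card_erase_of_mem hj', Finset.card_erase_of_mem hi']
      have := Finset.card_pos.mpr ⟨j, hj'⟩
      rw [Finset.card_erase_of_mem hi'] at this
      omega
    · refine Finset.card_le_card fun l hl => ?_
      simp only [RectFamily.merge, Finset.mem_filter, Finset.mem_insert, Finset.mem_erase] at hl ⊢
      rcases hl with ⟨rfl | hl, h₂⟩
      · rw [Function.update_self] at h₂; exact absurd h₂ hx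
      · rw [Function.update_of_ne (hne l hl.2.2)] at h₂
        exact ⟨hl.2.2, h₂⟩

/-! ### Lists of cells -/

/-- Positions `1, …, N` of the arrays `x`, `y` list the cells of `S` without repetition, sorted
by `x`. -/
structure IsList (N : ℕ) (x y : ℕ → ℕ) (S : Finset (ℕ × ℕ)) : Prop where
  inj : ∀ i j, 1 ≤ i → i ≤ N → 1 ≤ j → j ≤ N → x i = x j → y i = y j → i = j
  mem : ∀ p, p ∈ S ↔ ∃ j, 1 ≤ j ∧ j ≤ N ∧ x j = p.1 ∧ y j = p.2
  sorted : ∀ i j, 1 ≤ i → i ≤ j → j ≤ N → x i ≤ x j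

theorem IsList.card {N : ℕ} {x y : ℕ → ℕ} {S : Finset (ℕ × ℕ)} (h : IsList N x y S) :
    S.card = N := by
  have : S = (Finset.Icc 1 N).image fun j => (x j, y j) := by
    ext p
    rw [h.mem]
    simp only [Finset.mem_image, Finset.mem_Icc, Prod.ext_iff]
    exact ⟨fun ⟨j, h₁, h₂, h₃⟩ => ⟨j, ⟨h₁, h₂⟩, h₃⟩, fun ⟨j, ⟨h₁, h₂⟩, h₃⟩ => ⟨j, h₁, h₂, h₃⟩⟩
  rw [this, Finset.card_image_of_injOn, Nat.card_Icc, Nat.add_sub_cancel]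
  intro i hi j hj hij
  simp only [Finset.coe_Icc, Set.mem_Icc] at hi hj
  simp only [Prod.mk.injEq] at hij
  exact h.inj i j hi.1 hi.2 hj.1 hj.2 hij.1 hij.2

/-! ### The density of a set of cells without wide or tall blocks -/

/-- The Marcus–Tardos count. A block that is neither wide nor tall has at most `r - 1` nonempty
columns and `r - 1` nonempty rows. The other blocks have at most `r ^ 2 * r ^ 2` cells each, and
there are at most `w` wide ones in each of the `a` block columns and `w` tall ones in each of the
`b` block rows. -/
theorem card_le_of_few_wide_blocks {r w a b : ℕ} (S : Finset (ℕ × ℕ)) (φ ψ : ℕ → ℕ)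
    (hφ : ∀ p ∈ S, 1 ≤ φ p.1 ∧ φ p.1 ≤ a) (hψ : ∀ p ∈ S, 1 ≤ ψ p.2 ∧ ψ p.2 ≤ b)
    (hcol : ∀ X, ((S.image Prod.fst).filter fun x => φ x = X).card ≤ r ^ 2)
    (hrow : ∀ Y, ((S.image Prod.snd).filter fun y => ψ y = Y).card ≤ r ^ 2)
    (hwide : ∀ X, ((Finset.Icc 1 b).filter fun Y => r ≤
      ((S.filter fun p => φ p.1 = X ∧ ψ p.2 = Y).image Prod.fst).card).card ≤ w)
    (htall : ∀ Y, ((Finset.Icc 1 a).filter fun X => r ≤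
      ((S.filter fun p => φ p.1 = X ∧ ψ p.2 = Y).image Prod.snd).card).card ≤ w) :
    S.card ≤ (r - 1) ^ 2 * (S.image fun p => (φ p.1, ψ p.2)).card + (a + b) * w * r ^ 4 := by
  set B := S.image fun p => (φ p.1, ψ p.2) with hB
  let cell : ℕ × ℕ → Finset (ℕ × ℕ) := fun c => S.filter fun p => φ p.1 = c.1 ∧ ψ p.2 = c.2
  let W : ℕ × ℕ → Prop := fun c => r ≤ ((cell c).image Prod.fst).card
  let T : ℕ × ℕ → Prop := fun c => r ≤ ((cell c).image Prod.snd).card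
  have hBmem : ∀ c ∈ B, (1 ≤ c.1 ∧ c.1 ≤ a) ∧ (1 ≤ c.2 ∧ c.2 ≤ b) := by
    intro c hc
    obtain ⟨p, hp, rfl⟩ := Finset.mem_image.mp hc
    exact ⟨hφ p hp, hψ p hp⟩
  have h₁ : S.card = ∑ c ∈ B, (cell c).card := by
    rw [Finset.card_eq_sum_card_image (fun p : ℕ × ℕ => (φ p.1, ψ p.2)) S]
    refine Finset.sum_congr rfl fun c _ => ?_
    congr 1
    ext p
    simp [cell, Prod.ext_iff]
  have hprod : ∀ c, (cell c).card ≤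
      ((cell c).image Prod.fst).card * ((cell c).image Prod.snd).card := by
    intro c
    rw [← Finset.card_product]
    refine Finset.card_le_card fun p hp => ?_
    simp only [Finset.mem_product, Finset.mem_image]
    exact ⟨⟨p, hp, rfl⟩, ⟨p, hp, rfl⟩⟩
  have hc₁ : ∀ c, ((cell c).image Prod.fst).card ≤ r ^ 2 := by
    intro c
    refine (Finset.card_le_card ?_).trans (hcol c.1)
    intro x hx
    simp only [cell, Finset.mem_image, Finset.mem_filter] at hx ⊢
    obtain ⟨p, ⟨hp, h₁, -⟩, rfl⟩ := hx
    exact ⟨⟨p, hp, rfl⟩, h₁⟩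
  have hc₂ : ∀ c, ((cell c).image Prod.snd).card ≤ r ^ 2 := by
    intro c
    refine (Finset.card_le_card ?_).trans (hrow c.2)
    intro x hx
    simp only [cell, Finset.mem_image, Finset.mem_filter] at hx ⊢
    obtain ⟨p, ⟨hp, -, h₁⟩, rfl⟩ := hx
    exact ⟨⟨p, hp, rfl⟩, h₁⟩
  -- A block that is wide and tall is charged twice, so that the two kinds can be counted
  -- separately.
  have h₂ : ∀ c ∈ B, (cell c).card ≤
      (r - 1) ^ 2 + ((if W c then r ^ 4 else 0) + if T c then r ^ 4 else 0) := by
    intro c _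
    have hr4 : (cell c).card ≤ r ^ 4 := (hprod c).trans
      ((Nat.mul_le_mul (hc₁ c) (hc₂ c)).trans (by rw [← pow_add]))
    by_cases hW : W c
    · simp only [hW, if_true]; omega
    · by_cases hT : T c
      · simp only [hT, if_true]; omega
      · simp only [hW, hT, if_false, add_zero]
        simp only [W, T, not_le] at hW hT
        rw [pow_two]
        exact (hprod c).trans (Nat.mul_le_mul (by omega) (by omega))
  have hWc : (B.filter W).card ≤ a * w := by
    have := Finset.card_le_mul_card_image_of_maps_to (f := Prod.fst) (s := B.filter W)
      (t := Finset.Icc 1 a) (fun c hc => by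
        have := (hBmem c (Finset.mem_filter.mp hc).1).1
        simpa using this) w (fun X _ => by
        refine le_trans (Finset.card_le_card_of_injOn Prod.snd ?_ ?_) (hwide X)
        · intro c hc
          simp only [Finset.coe_filter, Set.mem_ofPred_eq, Finset.mem_filter] at hc
          have := (hBmem c hc.1.1).2
          simp only [Finset.coe_filter, Finset.mem_Icc, Set.mem_ofPred_eq]
          refine ⟨this, ?_⟩
          rw [← hc.2]; exact hc.1.2
        · intro c hc c' hc' h
          simp only [Finset.coe_filter, Set.mem_ofPred_eq] at hc hc'
          exact Prod.ext (hc.2.trans hc'.2.symm) h)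
    simpa [mul_comm] using this
  have hTc : (B.filter T).card ≤ b * w := by
    have := Finset.card_le_mul_card_image_of_maps_to (f := Prod.snd) (s := B.filter T)
      (t := Finset.Icc 1 b) (fun c hc => by
        have := (hBmem c (Finset.mem_filter.mp hc).1).2
        simpa using this) w (fun Y _ => by
        refine le_trans (Finset.card_le_card_of_injOn Prod.fst ?_ ?_) (htall Y)
        · intro c hc
          simp only [Finset.coe_filter, Set.mem_ofPred_eq, Finset.mem_filter] at hc
          have := (hBmem c hc.1.1).1
          simp only [Finset.coe_filter, Finset.mem_Icc, Set.mem_ofPred_eq]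
          refine ⟨this, ?_⟩
          rw [← hc.2]; exact hc.1.2
        · intro c hc c' hc' h
          simp only [Finset.coe_filter, Set.mem_ofPred_eq] at hc hc'
          exact Prod.ext h (hc.2.trans hc'.2.symm))
    simpa [mul_comm] using this
  rw [h₁]
  refine (Finset.sum_le_sum h₂).trans ?_
  rw [Finset.sum_add_distrib, Finset.sum_add_distrib, Finset.sum_const, smul_eq_mul,
    ← Finset.sum_filter, ← Finset.sum_filter, Finset.sum_const, Finset.sum_const, smul_eq_mul,
    smul_eq_mul, mul_comm B.card]
  have := Nat.mul_le_mul_right (r ^ 4) hWc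
  have := Nat.mul_le_mul_right (r ^ 4) hTc
  nlinarith

/-- If a dense set of cells has few wide and tall blocks, the set of nonempty blocks is dense. -/
theorem dense_blocks {r N N' m a b : ℕ} (hr : 1 ≤ r) (hN : gridBound r * m < N) (hm : N ≤ m * m)
    (ha : a ≤ (m - 1) / r ^ 2 + 1) (hb : b ≤ (m - 1) / r ^ 2 + 1)
    (h : N ≤ (r - 1) ^ 2 * N' + (a + b) * ((r - 1) * (r ^ 2).choose r) * r ^ 4) :
    gridBound r * ((m - 1) / r ^ 2 + 1) < N' := by
  by_contra hcon
  push Not at hcon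
  set M := (m - 1) / r ^ 2 + 1 with hM
  set F := gridBound r with hF
  have hFC : F = r ^ 4 * (r ^ 2).choose r := rfl
  have hC : 1 ≤ (r ^ 2).choose r := Nat.choose_pos (by nlinarith)
  have hF4 : r ^ 4 ≤ F := by rw [hFC]; exact Nat.le_mul_of_pos_right _ hC
  -- From `F * m < N ≤ m * m`.
  have hmF : F < m := by
    by_contra hc
    push Not at hc
    have := Nat.mul_le_mul_right m hc
    omega
  obtain ⟨u, rfl⟩ : ∃ u, r = u + 1 := ⟨r - 1, by omega⟩
  simp only [Nat.add_sub_cancel] at h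
  -- The factor `r ^ 4 * (r ^ 2).choose r` in the contribution of wide and tall blocks is exactly
  -- `F`, which explains the choice of `gridBound`. With `u = r - 1` the total factor `u ^ 2 + 2 *
  -- u` is `r ^ 2 - 1`, just below the area of contraction `r ^ 2`.
  have h₁ : N ≤ F * M * (u ^ 2 + 2 * u) := by
    calc N ≤ u ^ 2 * N' + (a + b) * (u * ((u + 1) ^ 2).choose (u + 1)) * (u + 1) ^ 4 := h
      _ = u ^ 2 * N' + (a + b) * (u * F) := by rw [hFC]; ring
      _ ≤ u ^ 2 * (F * M) + (M + M) * (u * F) :=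
        add_le_add (Nat.mul_le_mul_left _ hcon)
          (Nat.mul_le_mul_right _ (add_le_add ha hb))
      _ = _ := by ring
  have h₂ : F * m < F * (M * (u ^ 2 + 2 * u)) := by rw [← mul_assoc]; omega
  have h₃ : m < M * (u ^ 2 + 2 * u) := Nat.lt_of_mul_lt_mul_left h₂
  have hdiv := Nat.div_add_mod (m - 1) ((u + 1) ^ 2)
  have hmod := Nat.mod_lt (m - 1) (show 0 < (u + 1) ^ 2 by positivity)
  obtain ⟨Q, hQ⟩ : ∃ Q, Q = (m - 1) / (u + 1) ^ 2 := ⟨_, rfl⟩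
  rw [← hQ] at hdiv hM
  rw [hM] at h₃
  have h₄ : (u + 1) ^ 2 * (u + 1) ^ 2 < m := by
    have : (u + 1) ^ 2 * (u + 1) ^ 2 = (u + 1) ^ 4 := by ring
    omega
  -- As `m > F ≥ r ^ 4`, the quotient `Q` is at least `r ^ 2`. This absorbs the rounding in `M = Q +
  -- 1`: `(Q + 1) * (r ^ 2 - 1) = r ^ 2 * Q + r ^ 2 - Q - 1 < r ^ 2 * Q < m`, against `h₃`.
  have h₅ : (u + 1) ^ 2 ≤ Q := by
    by_contra hc
    push Not at hc
    have : (u + 1) ^ 2 * (Q + 1) ≤ (u + 1) ^ 2 * (u + 1) ^ 2 := Nat.mul_le_mul_left _ hc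
    have : (u + 1) ^ 2 * (Q + 1) = (u + 1) ^ 2 * Q + (u + 1) ^ 2 := by ring
    omega
  have h₆ : (Q + 1) * (u ^ 2 + 2 * u) + Q + 1 = (u + 1) ^ 2 * Q + (u + 1) ^ 2 := by ring
  generalize (Q + 1) * (u ^ 2 + 2 * u) = z at h₃ h₆
  generalize (m - 1) % (u + 1) ^ 2 = w at hdiv hmod
  omega

-- Correctness and running time of the subprograms

attribute [simp] Cmd.exec Expr.eval BinOp.eval Store.setVar Store.setArr Cmd.Straight Cmd.wv Cmd.wa
  Cmd.forUp

/-! ### The bound -/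

/-- Below the cutoff the recursion for binomial coefficients is exact, including the division. Above
it the value may be kept: for `k < r` the row `r * r` is still increasing, since `r ≤ r * r / 2`
when `2 ≤ r`. -/
theorem min_choose_succ {n r k : ℕ} (hn : 1 ≤ n) (hk : k < r) :
    (if min ((r * r).choose k) (n + 1) < n + 1 then
        min (min ((r * r).choose k) (n + 1) * (r * r - k) / (k + 1)) (n + 1)
      else min ((r * r).choose k) (n + 1)) = min ((r * r).choose (k + 1)) (n + 1) := by
  have hc := Nat.choose_succ_right_eq (r * r) k
  by_cases h : (r * r).choose k < n + 1
  · have : min ((r * r).choose k) (n + 1) = (r * r).choose k := min_eq_left h.le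
    rw [this, if_pos h, ← hc, Nat.mul_div_cancel _ (Nat.succ_pos k)]
  · have h' : n + 1 ≤ (r * r).choose k := not_lt.mp h
    rw [min_eq_right h', if_neg (lt_irrefl _)]
    have : (r * r).choose k ≤ (r * r).choose (k + 1) := by
      -- For `r ≤ 1` only `k = 0` is possible, and the coefficient 1 does not reach the cutoff.
      rcases Nat.lt_or_ge r 2 with h2 | h2
      · have : k = 0 := by omega
        subst this
        simp at h'
        omega
      · refine Nat.choose_le_succ_of_lt_half_left (lt_of_lt_of_le hk ?_)
        rw [Nat.le_div_iff_mul_le (by norm_num)]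
        exact Nat.mul_le_mul_left r h2
    exact (min_eq_right (h'.trans this)).symm

theorem Nat.sub_sub_eq_min (a b : ℕ) : a - (a - b) = min a b := by omega

theorem computeBound_ends {s : Store} {n r : ℕ} (hn : s.var vLen = n) (hr : s.var vGrid = r)
    (hn1 : 1 ≤ n) (hr1 : 1 ≤ r) :
    computeBound.Ends s (100 * n + 100) fun s' => s'.var vBound = min (gridBound r) n := by
  have hC : 1 ≤ (r ^ 2).choose r := Nat.choose_pos (by nlinarith)
  have hF4 : r ^ 4 ≤ gridBound r := Nat.le_mul_of_pos_right _ hC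
  have h4 : r * r * r * r = r ^ 4 := by ring
  refine Cmd.Ends.mono (T := 10 + (90 * n + 80)) (Cmd.Ends.ite (T := 90 * n + 80) ?_ ?_)
    (by omega) (fun _ _ h => h)
  · intro h
    simp [hn, hr] at h
    refine Cmd.Straight.ends (by simp) (by simp [Cmd.time, Expr.cost]) ?_
    simp [hn]
    omega
  · intro h
    simp [hn, hr] at h
    -- Since `r ≤ r ^ 4 ≤ n`, the loop of length `r` takes time `O(n)`.
    have hrn : r ≤ n := (Nat.le_self_pow (by norm_num) r).trans (h4 ▸ h)
    refine Cmd.Ends.mono (T := 2 + ((r * (50 + 10) + 10) + 40)) ?_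
      (by have := Nat.mul_le_mul_right 60 hrn; omega) (fun _ _ h => h)
    refine Cmd.Ends.then (P := fun s' => s'.var 19 = 1)
      (Cmd.Straight.ends (by simp) (by simp [Cmd.time, Expr.cost]) (by simp)) ?_
    intro s₁ hf₁ h₁
    have hn₁ : s₁.var 0 = n := by rw [hf₁.1 0 (by simp), hn]
    have hr₁ : s₁.var 1 = r := by rw [hf₁.1 1 (by simp), hr]
    refine Cmd.Ends.then (P := fun s' => s'.var 19 = min ((r * r).choose r) (n + 1)) ?_ ?_
    · refine Cmd.Ends.forUp (fun k s' => s'.var 19 = min ((r * r).choose k) (n + 1)) hr₁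
        (by simp) (by simp [binomBody]) (by simp [binomBody]) (by simp [h₁]) ?_
      intro k hk s' hf hj hI
      have hn' : s'.var 0 = n := by rw [hf.1 0 (by simp [binomBody]), hn₁]
      have hr' : s'.var 1 = r := by rw [hf.1 1 (by simp [binomBody]), hr₁]
      refine Cmd.Straight.ends (by simp [binomBody])
        (by simp [Cmd.time, Expr.cost, binomBody]) ?_
      rw [← min_choose_succ hn1 hk]
      simp only [binomBody, Cmd.exec, Expr.eval, BinOp.eval, hI, hn', hr', hj,
        Nat.sub_sub_eq_min, Nat.add_sub_cancel]
      split_ifs <;> simp_all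
    · intro s₂ hf₂ h₂
      refine Cmd.Straight.ends (by simp) (by simp [Cmd.time, Expr.cost]) ?_
      have hn' : s₂.var 0 = n := by rw [hf₂.1 0 (by simp [binomBody]), hn₁]
      have hr' : s₂.var 1 = r := by rw [hf₂.1 1 (by simp [binomBody]), hr₁]
      simp only [Cmd.exec, Expr.eval, BinOp.eval, Nat.sub_sub_eq_min, h₂, hn', hr', Store.setVar,
        Function.update_self, h4]
      rw [gridBound, ← pow_two]
      rcases le_total ((r ^ 2).choose r) (n + 1) with h | h
      · rw [min_eq_left h]
      -- The cutoff `n + 1` still exceeds `n` after multiplication by `r ^ 4 ≥ 1`, so both sides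
      -- equal `n`.
      · rw [min_eq_right h]
        have h5 : 1 ≤ r ^ 4 := Nat.one_le_pow _ _ hr1
        rw [min_eq_right, min_eq_right]
        · nlinarith
        · nlinarith

/-! ### The initial lists -/

theorem initLists_ends {s : Store} {n : ℕ} (hn : s.var vLen = n)
    (hX : ∀ i, 1 ≤ i → i ≤ n → 1 ≤ s.arr aPtX i ∧ s.arr aPtX i ≤ n)
    (hY : ∀ i, 1 ≤ i → i ≤ n → 1 ≤ s.arr aPtY i ∧ s.arr aPtY i ≤ n)
    (iX : Set.InjOn (s.arr aPtX) (Finset.Icc 1 n)) (iY : Set.InjOn (s.arr aPtY) (Finset.Icc 1 n)) :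
    initLists.Ends s (200 * n + 200) fun s' =>
      (s'.var vCols = n ∧ s'.var vRows = n ∧ s'.var vMax = n ∧ s'.var vCells = n ∧
        s'.var vLast = n) ∧
      (∀ x, 1 ≤ x → x ≤ n → s'.arr aX1 x = x ∧ s'.arr aY1 x = s.arr aPtY (s'.arr aId x) ∧
        s.arr aPtX (s'.arr aId x) = x ∧ 1 ≤ s'.arr aId x ∧ s'.arr aId x ≤ n) ∧
      (∀ y, 1 ≤ y → y ≤ n → s'.arr aY2 y = y ∧ ∃ i, 1 ≤ i ∧ i ≤ n ∧ s.arr aPtY i = y ∧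
        s'.arr aX2 y = s.arr aPtX i) ∧
      (∀ x, 1 ≤ x → x ≤ n + 1 → s'.arr aLeftX x = x ∧ s'.arr aLeftY x = x) := by
  have surj : ∀ f : ℕ → ℕ, (∀ i, 1 ≤ i → i ≤ n → 1 ≤ f i ∧ f i ≤ n) →
      Set.InjOn f (Finset.Icc 1 n) → ∀ x, 1 ≤ x → x ≤ n → ∃ i, 1 ≤ i ∧ i ≤ n ∧ f i = x := by
    intro f hf hi x hx hxn
    obtain ⟨i, hi, h⟩ := Finset.surj_on_of_inj_on_of_card_le (s := Finset.Icc 1 n)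
      (t := Finset.Icc 1 n) (fun i _ => f i)
      (fun i hi => by simp only [Finset.mem_Icc] at hi ⊢; exact hf i hi.1 hi.2)
      (fun i j hi' hj' h => hi hi' hj' h) le_rfl x (by simp [hx, hxn])
    simp only [Finset.mem_Icc] at hi
    exact ⟨i, hi.1, hi.2, h.symm⟩
  refine Cmd.Ends.mono (T := (n * (20 + 10) + 10) + ((n * (50 + 10) + 10) + 50)) ?_ (by omega)
    (fun _ _ h => h)
  refine Cmd.Ends.then (P := fun s' => ∀ i, 1 ≤ i → i ≤ n →
    s'.arr 28 (s.arr 0 i) = i ∧ s'.arr 29 (s.arr 1 i) = i) ?_ ?_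
  · refine Cmd.Ends.forUp (fun k s' => ∀ i, 1 ≤ i → i ≤ k →
      s'.arr 28 (s.arr 0 i) = i ∧ s'.arr 29 (s.arr 1 i) = i) hn (by simp) (by simp [invertBody])
      (by simp [invertBody]) (by intros; omega) ?_
    intro k hk s' hf hj hI
    have e0 : s'.arr 0 = s.arr 0 := hf.2 0 (by simp [invertBody])
    have e1 : s'.arr 1 = s.arr 1 := hf.2 1 (by simp [invertBody])
    refine Cmd.Straight.ends (by simp [invertBody])
      (by simp [Cmd.time, Expr.cost, invertBody]) ?_
    intro i hi hik
    simp only [invertBody, Cmd.exec, Expr.eval, Store.setVar, Store.setArr, hj]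
    rcases Nat.le_or_eq_of_le_succ hik with h | rfl
    · have h0 : s.arr 0 i ≠ s.arr 0 (k + 1) := fun h' => by
        have := iX (by simp; omega) (by simp; omega) h'; omega
      have h1 : s.arr 1 i ≠ s.arr 1 (k + 1) := fun h' => by
        have := iY (by simp; omega) (by simp; omega) h'; omega
      simpa [e0, e1, h0, h1] using hI i hi h
    · simp [e0, e1]
  · intro s₁ hf₁ h₁
    have hn₁ : s₁.var 0 = n := by rw [hf₁.1 0 (by simp [invertBody]), hn]
    have e0 : s₁.arr 0 = s.arr 0 := hf₁.2 0 (by simp [invertBody])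
    have e1 : s₁.arr 1 = s.arr 1 := hf₁.2 1 (by simp [invertBody])
    refine Cmd.Ends.then (P := fun s' => ∀ x, 1 ≤ x → x ≤ n → s'.arr 6 x = x ∧
        s'.arr 7 x = s.arr 1 (s₁.arr 28 x) ∧ s'.arr 8 x = s₁.arr 28 x ∧
        s'.arr 9 x = s.arr 0 (s₁.arr 29 x) ∧ s'.arr 10 x = x ∧ s'.arr 15 x = x ∧
        s'.arr 16 x = x) ?_ ?_
    · refine Cmd.Ends.forUp (fun k s' => ∀ x, 1 ≤ x → x ≤ k → s'.arr 6 x = x ∧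
        s'.arr 7 x = s.arr 1 (s₁.arr 28 x) ∧ s'.arr 8 x = s₁.arr 28 x ∧
        s'.arr 9 x = s.arr 0 (s₁.arr 29 x) ∧ s'.arr 10 x = x ∧ s'.arr 15 x = x ∧
        s'.arr 16 x = x) hn₁ (by simp) (by simp [listBody]) (by simp [listBody])
        (by intros; omega) ?_
      intro k hk s' hf hj hI
      have e0' : s'.arr 0 = s.arr 0 := by rw [hf.2 0 (by simp [listBody]), e0]
      have e1' : s'.arr 1 = s.arr 1 := by rw [hf.2 1 (by simp [listBody]), e1]
      have e28 : s'.arr 28 = s₁.arr 28 := hf.2 28 (by simp [listBody])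
      have e29 : s'.arr 29 = s₁.arr 29 := hf.2 29 (by simp [listBody])
      refine Cmd.Straight.ends (by simp [listBody])
        (by simp [Cmd.time, Expr.cost, listBody]) ?_
      intro x hx hxk
      rcases Nat.le_or_eq_of_le_succ hxk with h | rfl
      · have hne : x ≠ k + 1 := by omega
        simpa [listBody, hj, hne] using hI x hx h
      · simp [listBody, hj, e0', e1', e28, e29]
    · intro s₂ hf₂ h₂
      have hn₂ : s₂.var 0 = n := by rw [hf₂.1 0 (by simp [listBody]), hn₁]
      refine Cmd.Straight.ends (by simp [initTail])
        (by simp [Cmd.time, Expr.cost, initTail]) ?_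
      refine ⟨by simp [initTail, hn₂], ?_, ?_, ?_⟩
      · intro x hx hxn
        obtain ⟨i, hi, hin, rfl⟩ := surj _ hX iX x hx hxn
        have h := h₂ _ hx hxn
        simp only [(h₁ i hi hin).1] at h
        simp [initTail, h, hi, hin]
      · intro y hy hyn
        obtain ⟨i, hi, hin, rfl⟩ := surj _ hY iY y hy hyn
        have h := h₂ _ hy hyn
        simp only [(h₁ i hi hin).2] at h
        refine ⟨by simp [initTail, h], i, hi, hin, rfl, by simp [initTail, h]⟩
      · intro x hx hxn
        by_cases hc : x = n + 1
        · simp [initTail, hn₂, hc]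
        · have h := h₂ x hx (by omega)
          simp [initTail, hn₂, hc, h]

/-! ### Block labels and left ends -/

theorem coarsening_div {m K : ℕ} {φ : ℕ → ℕ} (hm : 1 ≤ m) (h0 : φ 0 = 0)
    (hφ : ∀ x, 1 ≤ x → x ≤ m → φ x = (x - 1) / K + 1) : Coarsening m ((m - 1) / K + 1) φ where
  pos := hm
  zero := h0
  one := by simp [hφ 1 le_rfl hm]
  last := hφ m hm le_rfl
  step x hx hxm := by
    rw [hφ x hx hxm.le, hφ (x + 1) (by omega) hxm, Nat.add_sub_cancel]
    refine ⟨Nat.succ_le_succ (Nat.div_le_div_right (Nat.sub_le _ _)), ?_⟩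
    obtain ⟨z, rfl⟩ : ∃ z, x = z + 1 := ⟨x - 1, by omega⟩
    rw [Nat.add_sub_cancel, Nat.succ_div]
    split <;> omega

theorem blocks_ends {s : Store} {P m g M r : ℕ} (hM : s.var m = M) (hr : s.var vGrid = r)
    (hm : m ≠ vLoop) (hM1 : 1 ≤ M) (hP : s.arr P 0 = 0) :
    (blocks P m g).Ends s (50 * M + 50) fun s' =>
      s'.var g = (M - 1) / (r * r) + 1 ∧ Coarsening M ((M - 1) / (r * r) + 1) (s'.arr P) ∧
        ∀ x, 1 ≤ x → x ≤ M → s'.arr P x = (x - 1) / (r * r) + 1 := by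
  refine Cmd.Ends.mono (T := (M * (20 + 10) + 10) + 20) ?_ (by omega) (fun _ _ h => h)
  refine Cmd.Ends.then (P := fun s' => s'.arr P 0 = 0 ∧
    ∀ x, 1 ≤ x → x ≤ M → s'.arr P x = (x - 1) / (r * r) + 1) ?_ ?_
  · refine Cmd.Ends.forUp (fun k s' => s'.arr P 0 = 0 ∧ ∀ x, 1 ≤ x → x ≤ k →
      s'.arr P x = (x - 1) / (r * r) + 1) hM hm (by simp [blockBody]) (by simp [blockBody])
      ⟨by simpa using hP, by intros; omega⟩ ?_
    intro k hk s' hf hj hI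
    have hr' : s'.var 1 = r := by rw [hf.1 1 (by simp [blockBody]), hr]
    refine Cmd.Straight.ends (by simp [blockBody])
      (by simp [Cmd.time, Expr.cost, blockBody]) ⟨by simp [blockBody, hj, hI.1], ?_⟩
    intro x hx hxk
    rcases Nat.le_or_eq_of_le_succ hxk with h | rfl
    · have hne : x ≠ k + 1 := by omega
      simpa [blockBody, hj, hne] using hI.2 x hx h
    · simp [blockBody, hj, hr']
  · intro s₁ hf₁ h₁
    have hr' : s₁.var 1 = r := by rw [hf₁.1 1 (by simp [blockBody]), hr]
    have hM' : s₁.var m = M := by rw [hf₁.1 m (by simp [blockBody, hm]), hM]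
    refine Cmd.Straight.ends (by simp) (by simp [Cmd.time, Expr.cost]) ⟨?_, ?_, ?_⟩
    · simp [hr', hM']
    · simpa using coarsening_div hM1 h₁.1 h₁.2
    · simpa using h₁.2

/-- The update is in place. By `Coarsening.le_self` the write position is never ahead of the reading
position, which the second half of the invariant records: beyond `k` the old left ends are intact.
-/
theorem left_ends {s : Store} {L P m g n M M' : ℕ} (hM : s.var m = M) (hM' : s.var g = M')
    (hn : s.var vLen = n) (hm : m ≠ vLoop) (hg : g ≠ vLoop) (hLP : P ≠ L)
    (hφ : Coarsening M M' (s.arr P)) :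
    (left L P m g).Ends s (50 * M + 50) fun s' =>
      CoarseLeft n M M' (s.arr P) (s.arr L) (s'.arr L) := by
  refine Cmd.Ends.mono (T := (M * (20 + 10) + 10) + 20) ?_ (by omega) (fun _ _ h => h)
  refine Cmd.Ends.then (P := fun s' => ∀ x, 1 ≤ x → x ≤ M → s.arr P (x - 1) < s.arr P x →
    s'.arr L (s.arr P x) = s.arr L x) ?_ ?_
  · refine Cmd.Ends.mono (T := (M * (20 + 10) + 10)) (Cmd.Ends.forUp (fun k s' =>
      (∀ x, 1 ≤ x → x ≤ k → s.arr P (x - 1) < s.arr P x →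
      s'.arr L (s.arr P x) = s.arr L x) ∧ ∀ x, k < x → s'.arr L x = s.arr L x) hM hm
      (by simp [leftBody]) (by simp [leftBody]) ⟨by intros; omega, by simp⟩ ?_) le_rfl
      (fun s' _ h => h.1)
    intro k hk s' hf hj hI
    have hP' : s'.arr P = s.arr P := hf.2 P (by simp [leftBody, hLP])
    refine Cmd.Straight.ends (by simp [leftBody]) (by simp [Cmd.time, Expr.cost, leftBody]) ?_
    by_cases hc : s.arr P k < s.arr P (k + 1)
    · have hle := hφ.le_self (x := k + 1) (by omega) hk
      refine ⟨fun x hx hxk hlt => ?_, fun x hx => ?_⟩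
      · rcases Nat.le_or_eq_of_le_succ hxk with h | rfl
        · have hne : s.arr P x ≠ s.arr P (k + 1) := by
            have := hφ.mono hx h (by omega); omega
          simpa [leftBody, hj, hP', hc, hne] using hI.1 x hx h hlt
        · simpa [leftBody, hj, hP', hc] using hI.2 (k + 1) (by omega)
      · have hne : x ≠ s.arr P (k + 1) := by omega
        simpa [leftBody, hj, hP', hc, hne] using hI.2 x (by omega)
    · refine ⟨fun x hx hxk hlt => ?_, fun x hx => ?_⟩
      · rcases Nat.le_or_eq_of_le_succ hxk with h | rfl
        · simpa [leftBody, hj, hP', hc] using hI.1 x hx h hlt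
        · exact absurd hlt hc
      · simpa [leftBody, hj, hP', hc] using hI.2 x (by omega)
  · intro s₁ hf₁ h₁
    have hn' : s₁.var 0 = n := by rw [hf₁.1 0 (by simp [leftBody]), hn]
    have hg' : s₁.var g = M' := by rw [hf₁.1 g (by simp [leftBody, hg]), hM']
    refine Cmd.Straight.ends (by simp) (by simp [Cmd.time, Expr.cost]) ⟨?_, ?_⟩
    · intro x hx hxm hlt
      have := hφ.le hx hxm
      have hne : s.arr P x ≠ M' + 1 := by omega
      simpa [hg', hne] using h₁ x hx hxm hlt
    · simp [hg', hn']

/-! ### Greedy labels -/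

/-- In the sorted list `x`, the last entry with value at most `l` is at position `E l`. -/
def LastPos (N m : ℕ) (x E : ℕ → ℕ) : Prop :=
  E 0 = 0 ∧ E m = N ∧ (∀ l, l < m → E l < E (l + 1)) ∧
    ∀ l, l ≤ m → ∀ j, 1 ≤ j → j ≤ N → (j ≤ E l ↔ x j ≤ l)

/-- That every line is nonempty is essential: the entry of an empty line would be a leftover of an
earlier round, and `E` would not be strictly increasing. -/
theorem lastPos_of_loop {N m : ℕ} {x E : ℕ → ℕ} (hN : 1 ≤ N) (h0 : E 0 = 0)
    (hx : ∀ j, 1 ≤ j → j ≤ N → 1 ≤ x j ∧ x j ≤ m)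
    (hs : ∀ i j, 1 ≤ i → i ≤ j → j ≤ N → x i ≤ x j)
    (hne : ∀ l, 1 ≤ l → l ≤ m → ∃ j, 1 ≤ j ∧ j ≤ N ∧ x j = l)
    (hE : ∀ j, 1 ≤ j → j ≤ N → j ≤ E (x j) ∧ E (x j) ≤ N ∧ x (E (x j)) = x j) :
    LastPos N m x E := by
  have hE' : ∀ l, 1 ≤ l → l ≤ m → 1 ≤ E l ∧ E l ≤ N ∧ x (E l) = l := by
    intro l h1 h2
    obtain ⟨j, hj, hjN, rfl⟩ := hne l h1 h2
    have := hE j hj hjN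
    exact ⟨by omega, this.2⟩
  have key : ∀ l, l ≤ m → ∀ j, 1 ≤ j → j ≤ N → (j ≤ E l ↔ x j ≤ l) := by
    intro l hl j hj hjN
    rcases Nat.eq_zero_or_pos l with rfl | hl0
    · have := hx j hj hjN
      omega
    · have h := hE' l hl0 hl
      constructor
      · intro hjl
        have := hs j (E l) hj hjl h.2.1
        omega
      · intro hxl
        by_contra hc
        have h1 := hs (E l) j h.1 (by omega) hjN
        have h2 : x j = l := by omega
        have := hE j hj hjN
        rw [h2] at this
        omega
  refine ⟨h0, ?_, ?_, key⟩
  · have hm : 1 ≤ m := by have := hx 1 le_rfl hN; omega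
    have h1 := (key m le_rfl N hN le_rfl).mpr (hx N hN le_rfl).2
    have := hE' m hm le_rfl
    omega
  · intro l hl
    have h := hE' (l + 1) (by omega) hl
    by_contra hc
    have := (key l (by omega) (E (l + 1)) h.1 h.2.1).mp (by omega)
    omega

theorem LastPos.card_filter {N m : ℕ} {x E : ℕ → ℕ} (h : LastPos N m x E) {a b : ℕ} (ha : 1 ≤ a)
    (hab : a ≤ b) (hb : b ≤ m) :
    ((Finset.Icc 1 N).filter fun j => a ≤ x j ∧ x j ≤ b).card = E b - E (a - 1) := by
  have hmono : ∀ l k, l ≤ k → k ≤ m → E l ≤ E k := by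
    intro l k hlk
    induction k, hlk using Nat.le_induction with
    | base => intro _; exact le_rfl
    | succ k hlk ih => intro hk; exact (ih (by omega)).trans (h.2.2.1 k hk).le
  have hEb : E b ≤ N := h.2.1 ▸ hmono b m hb le_rfl
  have : ((Finset.Icc 1 N).filter fun j => a ≤ x j ∧ x j ≤ b) = Finset.Ioc (E (a - 1)) (E b) := by
    ext j
    simp only [Finset.mem_filter, Finset.mem_Icc, Finset.mem_Ioc]
    constructor
    · rintro ⟨⟨h1, h2⟩, h3, h4⟩
      have := h.2.2.2 (a - 1) (by omega) j h1 h2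
      have := h.2.2.2 b hb j h1 h2
      omega
    · rintro ⟨h1, h2⟩
      have := h.2.2.2 (a - 1) (by omega) j (by omega) (by omega)
      have := h.2.2.2 b hb j (by omega) (by omega)
      omega
  rw [this, Nat.card_Ioc]

theorem endLoop_ends {s : Store} {N m₀ m₁ : ℕ} (hN : s.var vCells = N) (hN1 : 1 ≤ N)
    (h0 : s.arr aEndX 0 = 0) (h1 : s.arr aEndY 0 = 0)
    (hx : ∀ j, 1 ≤ j → j ≤ N → 1 ≤ s.arr aX1 j ∧ s.arr aX1 j ≤ m₀)
    (hy : ∀ j, 1 ≤ j → j ≤ N → 1 ≤ s.arr aY2 j ∧ s.arr aY2 j ≤ m₁)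
    (sx : ∀ i j, 1 ≤ i → i ≤ j → j ≤ N → s.arr aX1 i ≤ s.arr aX1 j)
    (sy : ∀ i j, 1 ≤ i → i ≤ j → j ≤ N → s.arr aY2 i ≤ s.arr aY2 j)
    (nx : ∀ l, 1 ≤ l → l ≤ m₀ → ∃ j, 1 ≤ j ∧ j ≤ N ∧ s.arr aX1 j = l)
    (ny : ∀ l, 1 ≤ l → l ≤ m₁ → ∃ j, 1 ≤ j ∧ j ≤ N ∧ s.arr aY2 j = l) :
    (Cmd.forUp vLoop vCells endsBody).Ends s (N * (20 + 10) + 10) fun s' =>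
      LastPos N m₀ (s.arr aX1) (s'.arr aEndX) ∧ LastPos N m₁ (s.arr aY2) (s'.arr aEndY) := by
  refine Cmd.Ends.mono (T := (N * (20 + 10) + 10)) (Cmd.Ends.forUp (fun k s' =>
    (s'.arr 11 0 = 0 ∧ ∀ j, 1 ≤ j → j ≤ k → j ≤ s'.arr 11 (s.arr 6 j) ∧
      s'.arr 11 (s.arr 6 j) ≤ k ∧ s.arr 6 (s'.arr 11 (s.arr 6 j)) = s.arr 6 j) ∧
    (s'.arr 12 0 = 0 ∧ ∀ j, 1 ≤ j → j ≤ k → j ≤ s'.arr 12 (s.arr 10 j) ∧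
      s'.arr 12 (s.arr 10 j) ≤ k ∧ s.arr 10 (s'.arr 12 (s.arr 10 j)) = s.arr 10 j)) hN
    (by simp) (by simp [endsBody]) (by simp [endsBody])
    ⟨⟨by simpa using h0, by intros; omega⟩, ⟨by simpa using h1, by intros; omega⟩⟩ ?_) le_rfl
    (fun s' _ h => ⟨lastPos_of_loop hN1 h.1.1 hx sx nx h.1.2,
      lastPos_of_loop hN1 h.2.1 hy sy ny h.2.2⟩)
  intro k hk s' hf hj hI
  have e6 : s'.arr 6 = s.arr 6 := hf.2 6 (by simp [endsBody])
  have e10 : s'.arr 10 = s.arr 10 := hf.2 10 (by simp [endsBody])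
  have key : ∀ (x E : ℕ → ℕ), 1 ≤ x (k + 1) → (E 0 = 0 ∧ ∀ j, 1 ≤ j → j ≤ k → j ≤ E (x j) ∧
      E (x j) ≤ k ∧ x (E (x j)) = x j) →
      (Function.update E (x (k + 1)) (k + 1) 0 = 0 ∧ ∀ j, 1 ≤ j → j ≤ k + 1 →
        j ≤ Function.update E (x (k + 1)) (k + 1) (x j) ∧
        Function.update E (x (k + 1)) (k + 1) (x j) ≤ k + 1 ∧
        x (Function.update E (x (k + 1)) (k + 1) (x j)) = x j) := by
    intro x E hx h
    refine ⟨by rw [Function.update_of_ne (by omega), h.1], fun j hj hjk => ?_⟩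
    by_cases hc : x j = x (k + 1)
    · rw [hc, Function.update_self]; exact ⟨hjk, le_rfl, rfl⟩
    · rw [Function.update_of_ne hc]
      have hjk' : j ≤ k := by
        rcases Nat.le_or_eq_of_le_succ hjk with h | rfl
        exacts [h, absurd rfl hc]
      have := h.2 j hj hjk'
      exact ⟨this.1, by omega, this.2.2⟩
  refine Cmd.Straight.ends (by simp [endsBody]) (by simp [Cmd.time, Expr.cost, endsBody]) ⟨?_, ?_⟩
  · simpa [endsBody, hj, e6, e10] using key _ _ (hx (k + 1) (by omega) hk).1 hI.1
  · simpa [endsBody, hj, e6, e10] using key _ _ (hy (k + 1) (by omega) hk).1 hI.2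

/-- A new group is opened at line `k + 1` only if the previous group together with this line has
more than `4 * F` cells. This maintains `4 * F * (g - 1) ≤ start + E k`, where `start` is the last
position before the current group. At the end `start < E M`, so the right side is below `2 * E M`;
this is where `4 * F` turns into `2 * F`. -/
theorem greedy_ends {s : Store} {E P m g M F : ℕ} (hM : s.var m = M) (hF : s.var vBound = F)
    (hM1 : 1 ≤ M) (hm : m ∉ [g, 11, 18]) (hg : g ∉ [2, 11, 18]) (hEP : E ≠ P)
    (hP : s.arr P 0 = 0) (h0 : s.arr E 0 = 0)
    (hlt : ∀ l, l < M → s.arr E l < s.arr E (l + 1))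
    (h4 : ∀ l, l < M → s.arr E (l + 1) ≤ s.arr E l + 4 * F) :
    (greedy E P m g).Ends s (50 * M + 50) fun s' =>
      Coarsening M (s'.var g) (s'.arr P) ∧ 2 * F * (s'.var g - 1) < s.arr E M ∧
        ∀ x y, 1 ≤ x → x ≤ y → y ≤ M → s'.arr P x = s'.arr P y →
          s.arr E y ≤ s.arr E (x - 1) + 4 * F := by
  simp only [List.mem_cons, List.not_mem_nil, or_false, not_or] at hm hg
  obtain ⟨hm₁, hm₂, hm₃⟩ := hm
  obtain ⟨hg₁, hg₂, hg₃⟩ := hg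
  refine Cmd.Ends.mono (T := 2 + (2 + (M * (30 + 10) + 10))) ?_ (by omega) (fun _ _ h => h)
  refine Cmd.Ends.then (P := fun s' => s' = s.setVar g 1)
    (Cmd.Straight.ends (by simp) (by simp [Cmd.time, Expr.cost]) (by simp)) ?_
  rintro s₁ - rfl
  refine Cmd.Ends.then (P := fun s' => s' = (s.setVar g 1).setVar 18 0)
    (Cmd.Straight.ends (by simp) (by simp [Cmd.time, Expr.cost]) (by simp)) ?_
  rintro s₂ - rfl
  refine Cmd.Ends.mono (T := M * (30 + 10) + 10) (Cmd.Ends.forUp (fun k s' =>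
    s'.arr P 0 = 0 ∧ 1 ≤ s'.var g ∧ (1 ≤ k → s'.arr P 1 = 1 ∧ s'.arr P k = s'.var g) ∧
    (k = 0 → s'.var g = 1 ∧ s'.var 18 = 0) ∧
    (∀ x, 1 ≤ x → x < k → s'.arr P x ≤ s'.arr P (x + 1) ∧ s'.arr P (x + 1) ≤ s'.arr P x + 1) ∧
    (∀ x, 1 ≤ x → x ≤ k → s'.arr P x ≤ s'.var g) ∧
    s'.var 18 ≤ s.arr E k ∧ (1 ≤ k → s'.var 18 < s.arr E k) ∧
    (∀ x, 1 ≤ x → x ≤ k → s'.arr P x = s'.var g → s'.var 18 ≤ s.arr E (x - 1)) ∧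
    (∀ x y, 1 ≤ x → x ≤ y → y ≤ k → s'.arr P x = s'.arr P y →
          s.arr E y ≤ s.arr E (x - 1) + 4 * F) ∧
    4 * F * (s'.var g - 1) ≤ s'.var 18 + s.arr E k)
    (n := M) (by simp [hm₁, hm₃, hM]) hm₂ (by simp [greedyBody, Ne.symm hg₂])
    (by simp [greedyBody, hm₁, hm₃]) ?_ ?_) (by omega) ?_
  · simp [hg₂, hg₃, hP, h0]
    constructor <;> intros <;> omega
  · intro k hk s' hf hj hI
    obtain ⟨i1, i2, i3, i4, i5, i6, i7, i8, i9, i10, i11⟩ := hI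
    have hF' : s'.var 2 = F := by
      rw [hf.1 2 (by simp [greedyBody, Ne.symm hg₁])]
      simp [Ne.symm hg₁, hF]
    have hE' : s'.arr E = s.arr E := by
      rw [hf.2 E (by simp [greedyBody, hEP])]; simp
    have hl := hlt k hk
    have hl4 := h4 k hk
    refine Cmd.Straight.ends (by simp [greedyBody]) (by simp [Cmd.time, Expr.cost, greedyBody]) ?_
    by_cases hc : 4 * F < s.arr E (k + 1) - s'.var 18
    · have hk1 : 1 ≤ k := by
        rcases Nat.eq_zero_or_pos k with rfl | h
        · rw [h0] at hl4; omega
        · exact h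
      have e : ((greedyBody E P g).exec s').setVar 11 (k + 2) =
          { var := Function.update (Function.update (Function.update s'.var g (s'.var g + 1)) 18
              (s.arr E k)) 11 (k + 2),
            arr := Function.update s'.arr P (Function.update (s'.arr P) (k + 1)
              (s'.var g + 1)) } := by
        simp [greedyBody, hj, hF', hE', hc, hg₃, Ne.symm hg₂]
      rw [e]
      simp only [Function.update_self, Function.update_of_ne hg₂, Function.update_of_ne hg₃,
        Function.update_of_ne (show (18 : ℕ) ≠ 11 by norm_num)]
      have up : ∀ x, x ≤ k → Function.update (s'.arr P) (k + 1) (s'.var g + 1) x = s'.arr P x :=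
        fun x hx => Function.update_of_ne (by omega) _ _
      refine ⟨by rw [up 0 (by omega)]; exact i1, by omega, fun _ => ⟨?_, trivial⟩,
        by omega, ?_, ?_, by omega, fun _ => hl, ?_, ?_, ?_⟩
      · rw [up 1 hk1]; exact (i3 hk1).1
      · intro x hx hxk
        rcases Nat.lt_succ_iff_lt_or_eq.mp hxk with h | rfl
        · rw [up x (by omega), up (x + 1) (by omega)]; exact i5 x hx h
        · rw [up x le_rfl, Function.update_self, (i3 hk1).2]; omega
      · intro x hx hxk
        rcases Nat.le_or_eq_of_le_succ hxk with h | rfl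
        · rw [up x h]; have := i6 x hx h; omega
        · simp
      · intro x hx hxk hxg
        rcases Nat.le_or_eq_of_le_succ hxk with h | rfl
        · rw [up x h] at hxg; have := i6 x hx h; omega
        · simp
      · intro x y hx hxy hyk hxg
        rcases Nat.le_or_eq_of_le_succ hyk with h | rfl
        · rw [up x (by omega), up y h] at hxg; exact i10 x y hx hxy h hxg
        · rcases Nat.le_or_eq_of_le_succ hxy with h | rfl
          · rw [up x h, Function.update_self] at hxg; have := i6 x hx h; omega
          · simpa using hl4
      · obtain ⟨u, hu⟩ : ∃ u, s'.var g = u + 1 := ⟨s'.var g - 1, by omega⟩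
        rw [hu] at i11 ⊢
        simp only [Nat.add_sub_cancel] at i11 ⊢
        rw [Nat.mul_succ]
        omega
    · have e : ((greedyBody E P g).exec s').setVar 11 (k + 2) =
          { var := Function.update s'.var 11 (k + 2),
            arr := Function.update s'.arr P (Function.update (s'.arr P) (k + 1)
              (s'.var g)) } := by
        simp [greedyBody, hj, hF', hE', hc]
      rw [e]
      simp only [Function.update_self, Function.update_of_ne hg₂,
        Function.update_of_ne (show (18 : ℕ) ≠ 11 by norm_num)]
      have up : ∀ x, x ≤ k → Function.update (s'.arr P) (k + 1) (s'.var g) x = s'.arr P x :=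
        fun x hx => Function.update_of_ne (by omega) _ _
      refine ⟨by rw [up 0 (by omega)]; exact i1, by omega, fun _ => ⟨?_, trivial⟩,
        by omega, ?_, ?_, by omega, fun _ => by omega, ?_, ?_, by omega⟩
      · rcases Nat.eq_zero_or_pos k with rfl | hk1
        · simp [(i4 rfl).1]
        · rw [up 1 hk1]; exact (i3 hk1).1
      · intro x hx hxk
        rcases Nat.lt_succ_iff_lt_or_eq.mp hxk with h | rfl
        · rw [up x (by omega), up (x + 1) (by omega)]; exact i5 x hx h
        · rw [up x le_rfl, Function.update_self, (i3 hx).2]; omega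
      · intro x hx hxk
        rcases Nat.le_or_eq_of_le_succ hxk with h | rfl
        · rw [up x h]; have := i6 x hx h; omega
        · simp
      · intro x hx hxk hxg
        rcases Nat.le_or_eq_of_le_succ hxk with h | rfl
        · rw [up x h] at hxg; exact i9 x hx h hxg
        · simpa using i7
      · intro x y hx hxy hyk hxg
        rcases Nat.le_or_eq_of_le_succ hyk with h | rfl
        · rw [up x (by omega), up y h] at hxg; exact i10 x y hx hxy h hxg
        · rcases Nat.le_or_eq_of_le_succ hxy with h | rfl
          · rw [up x h, Function.update_self] at hxg
            have := i9 x hx h hxg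
            simp only [Nat.succ_eq_add_one]
            omega
          · simpa using hl4
  · intro s' _ hI
    obtain ⟨i1, i2, i3, i4, i5, i6, i7, i8, i9, i10, i11⟩ := hI
    refine ⟨⟨hM1, i1, (i3 hM1).1, (i3 hM1).2, i5⟩, ?_, i10⟩
    have := i8 hM1
    have h2 : 4 * F * (s'.var g - 1) = 2 * (2 * F * (s'.var g - 1)) := by ring
    omega

/-! ### Output of a grid -/

theorem output_loop_ends {s : Store} {B L lo hi r : ℕ} (hr : s.var vGrid = r) (hB : B ∉ [lo, hi])
    (hL : L ∉ [lo, hi]) (hne : lo ≠ hi) :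
    (Cmd.forUp vLoop vGrid (outputBody B L lo hi)).Ends s (r * (20 + 10) + 10) fun s' =>
      ∀ i, 1 ≤ i → i ≤ r → s'.arr lo i = s.arr L (s.arr B i) ∧
        s'.arr hi i = s.arr L (s.arr B (i + 1)) - 1 := by
  simp only [List.mem_cons, List.not_mem_nil, or_false, not_or] at hB hL
  refine Cmd.Ends.forUp (fun k s' => ∀ i, 1 ≤ i → i ≤ k →
      s'.arr lo i = s.arr L (s.arr B i) ∧ s'.arr hi i = s.arr L (s.arr B (i + 1)) - 1) hr
      (by simp) (by simp [outputBody]) (by simp [outputBody]) (by intros; omega) ?_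
  intro k hk s' hf hj hI
  have eB : s'.arr B = s.arr B := hf.2 B (by simp [outputBody, hB])
  have eL : s'.arr L = s.arr L := hf.2 L (by simp [outputBody, hL])
  refine Cmd.Straight.ends (by simp [outputBody]) (by simp [Cmd.time, Expr.cost, outputBody]) ?_
  intro i hi' hik
  rcases Nat.le_or_eq_of_le_succ hik with h | rfl
  · have : i ≠ k + 1 := by omega
    simpa [outputBody, hj, hne, hne.symm, this] using hI i hi' h
  · simp [outputBody, hj, hne, hne.symm, eB, eL, hB, hL]

/-! ### Tables addressed by cells -/

/-- The address of the cell `(X, Y)` in the tables of round `t`. -/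
def cellAddr (n t X Y : ℕ) : ℕ := (t * (n + 1) + X) * (n + 1) + Y

theorem cellAddr_fold (n t X Y : ℕ) : (t * (n + 1) + X) * (n + 1) + Y = cellAddr n t X Y := rfl

theorem pair_inj {n a b c d : ℕ} (hb : b ≤ n) (hd : d ≤ n)
    (h : a * (n + 1) + b = c * (n + 1) + d) : a = c ∧ b = d := by
  have h₁ : (b + (n + 1) * a) / (n + 1) = (d + (n + 1) * c) / (n + 1) := by
    congr 1; linarith [mul_comm (n + 1) a, mul_comm (n + 1) c]
  rw [Nat.add_mul_div_left _ _ (Nat.succ_pos n), Nat.add_mul_div_left _ _ (Nat.succ_pos n),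
    Nat.div_eq_of_lt (by omega), Nat.div_eq_of_lt (by omega)] at h₁
  have : a = c := by omega
  subst this
  exact ⟨rfl, by omega⟩

theorem cellAddr_inj {n t t' X X' Y Y' : ℕ} (hX : X ≤ n) (hX' : X' ≤ n) (hY : Y ≤ n)
    (hY' : Y' ≤ n) (h : cellAddr n t X Y = cellAddr n t' X' Y') : t = t' ∧ X = X' ∧ Y = Y' := by
  obtain ⟨h₁, h₂⟩ := pair_inj hY hY' h
  obtain ⟨h₃, h₄⟩ := pair_inj hX hX' h₁
  exact ⟨h₃, h₄, h₂⟩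

/-- The table `a` is zero in all rounds after `t`. -/
def Clean (n t : ℕ) (a : ℕ → ℕ) : Prop :=
  ∀ t' X Y, t < t' → X ≤ n → Y ≤ n → a (cellAddr n t' X Y) = 0

theorem Clean.mono {n t t' : ℕ} {a : ℕ → ℕ} (h : Clean n t a) (ht : t ≤ t') : Clean n t' a :=
  fun u X Y hu => h u X Y (by omega)

theorem Clean.update {n t X Y : ℕ} {a : ℕ → ℕ} (h : Clean n t a) (hX : X ≤ n) (hY : Y ≤ n)
    (v : ℕ) : Clean n t (Function.update a (cellAddr n t X Y) v) := by
  intro t' X' Y' ht hX' hY'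
  rw [Function.update_of_ne]
  · exact h t' X' Y' ht hX' hY'
  · intro he
    have := (cellAddr_inj hX' hX hY' hY he).1
    omega

/-! ### Keeping track of a decomposition -/

/-- The arrays `o₂`, `o₃`, `o₄` hold the `cnt` merges performed so far; the current family is
indexed by `id p` for the active positions `p`, and the rectangle `id p` lies in the cell
`(gx p, gy p)`. -/
def Tracks (π : Permutation) (d : ℕ) (m : Fin 2 → ℕ) (L : Fin 2 → ℕ → ℕ) (o₂ o₃ o₄ : ℕ → ℕ)
    (cnt last : ℕ) (A : ℕ → Prop) (id gx gy : ℕ → ℕ) : Prop :=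
  ∃ F σ lab, Reach π d F σ ∧ Labelled π.length d F m L lab ∧ σ.length = cnt ∧
    last = π.length + cnt ∧
    (∀ p (hp : p < σ.length), o₂ (p + 1) = σ[p].i ∧ o₃ (p + 1) = σ[p].j ∧ o₄ (p + 1) = σ[p].k) ∧
    (∀ i ∈ F.S, i ≤ last) ∧ (∀ i, i ∈ F.S ↔ ∃ p, A p ∧ id p = i) ∧
    (∀ p q, A p → A q → id p = id q → p = q) ∧
    ∀ p, A p → lab 0 (id p) = gx p ∧ lab 1 (id p) = gy p

/-- Serves to move entries within a list: `f` maps the new active positions bijectively to the old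
ones, while the family and the merges stay the same. -/
theorem Tracks.reindex {π : Permutation} {d : ℕ} {m : Fin 2 → ℕ} {L : Fin 2 → ℕ → ℕ}
    {o₂ o₃ o₄ : ℕ → ℕ} {cnt last : ℕ} {A A' : ℕ → Prop} {id gx gy id' gx' gy' : ℕ → ℕ}
    (h : Tracks π d m L o₂ o₃ o₄ cnt last A id gx gy) (f : ℕ → ℕ)
    (hf : ∀ p, A' p → A (f p) ∧ id (f p) = id' p ∧ gx (f p) = gx' p ∧ gy (f p) = gy' p)
    (hi : ∀ p p', A' p → A' p' → f p = f p' → p = p')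
    (hs : ∀ q, A q → ∃ p, A' p ∧ f p = q) :
    Tracks π d m L o₂ o₃ o₄ cnt last A' id' gx' gy' := by
  obtain ⟨F, σ, lab, h₁, h₂, h₃, h₄, h₅, h₆, h₇, h₈, h₉⟩ := h
  refine ⟨F, σ, lab, h₁, h₂, h₃, h₄, h₅, h₆, fun i => ?_, fun p q hp hq hpq => ?_, fun p hp => ?_⟩
  · rw [h₇]
    constructor
    · rintro ⟨q, hq, rfl⟩
      obtain ⟨p, hp, rfl⟩ := hs q hq
      exact ⟨p, hp, (hf p hp).2.1.symm⟩
    · rintro ⟨p, hp, rfl⟩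
      exact ⟨f p, (hf p hp).1, (hf p hp).2.1⟩
  · refine hi p q hp hq (h₈ _ _ (hf p hp).1 (hf q hq).1 ?_)
    rw [(hf p hp).2.1, (hf q hq).2.1, hpq]
  · have := hf p hp
    rw [← this.2.1, ← this.2.2.1, ← this.2.2.2]
    exact h₉ _ this.1

/-- The new rectangle takes over the position `p`, and `q` becomes inactive. Its index `last + 1` is
new because all indices in use are at most `last`. -/
theorem Tracks.merge {π : Permutation} {d : ℕ} {m : Fin 2 → ℕ} {L : Fin 2 → ℕ → ℕ}
    {o₂ o₃ o₄ : ℕ → ℕ} {cnt last : ℕ} {A A' : ℕ → Prop} {id gx gy : ℕ → ℕ}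
    (h : Tracks π d m L o₂ o₃ o₄ cnt last A id gx gy) {p q : ℕ} (hp : A p) (hq : A q)
    (hpq : p ≠ q) (hx : gx p = gx q) (hy : gy p = gy q) (hA : ∀ l, A' l ↔ A l ∧ l ≠ q) :
    Tracks π d m L (Function.update o₂ (cnt + 1) (id p)) (Function.update o₃ (cnt + 1) (id q))
      (Function.update o₄ (cnt + 1) (last + 1)) (cnt + 1) (last + 1) A'
      (Function.update id p (last + 1)) gx gy := by
  obtain ⟨F, σ, lab, h₁, h₂, h₃, h₄, h₅, h₆, h₇, h₈, h₉⟩ := h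
  have hpF : id p ∈ F.S := (h₇ _).mpr ⟨p, hp, rfl⟩
  have hqF : id q ∈ F.S := (h₇ _).mpr ⟨q, hq, rfl⟩
  have hne : id p ≠ id q := fun h => hpq (h₈ p q hp hq h)
  have hk : last + 1 ∉ F.S := fun h => by have := h₆ _ h; omega
  have hidk : ∀ l, A l → id l ≠ last + 1 := fun l hl h => hk (h ▸ (h₇ _).mpr ⟨l, hl, rfl⟩)
  have hL := h₂.merge hpF hqF hne hk (fun α => by
    have e₁ := h₉ p hp
    have e₂ := h₉ q hq
    fin_cases α
    · simp only [Fin.zero_eta]; rw [e₁.1, e₂.1, hx]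
    · simp only [Fin.mk_one]; rw [e₁.2, e₂.2, hy])
  refine ⟨F.merge (id p) (id q) (last + 1), σ ++ [⟨id p, id q, last + 1⟩], _,
    .step h₁ ⟨hpF, hqF, hne, hk, rfl⟩ hL.wide (by omega), hL, by simp [h₃], by omega,
    ?_, ?_, ?_, ?_, ?_⟩
  · intro l hl
    simp only [List.length_append, List.length_singleton] at hl
    rcases Nat.lt_succ_iff_lt_or_eq.mp hl with h | rfl
    · have : l ≠ cnt := by omega
      simpa [this, List.getElem_append_left h] using h₅ l h
    · simp [h₃]
  · intro i hi
    simp only [RectFamily.merge, Finset.mem_insert, Finset.mem_erase] at hi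
    rcases hi with rfl | hi
    · exact le_rfl
    · have := h₆ i hi.2.2; omega
  · intro i
    simp only [RectFamily.merge, Finset.mem_insert, Finset.mem_erase]
    constructor
    · rintro (rfl | ⟨hi₁, hi₂, hi₃⟩)
      · exact ⟨p, (hA p).mpr ⟨hp, hpq⟩, by simp⟩
      · obtain ⟨l, hl, rfl⟩ := (h₇ i).mp hi₃
        exact ⟨l, (hA l).mpr ⟨hl, fun h => hi₁ (by rw [h])⟩,
          Function.update_of_ne (fun h => hi₂ (by rw [h])) _ _⟩
    · rintro ⟨l, hl, rfl⟩
      rw [hA] at hl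
      by_cases hlp : l = p
      · subst hlp; simp
      · rw [Function.update_of_ne hlp]
        exact .inr ⟨fun h => hl.2 (h₈ l q hl.1 hq h), fun h => hlp (h₈ l p hl.1 hp h),
          (h₇ _).mpr ⟨l, hl.1, rfl⟩⟩
  · intro l l' hl hl' h
    rw [hA] at hl hl'
    by_cases h₁ : l = p <;> by_cases h₂ : l' = p
    · rw [h₁, h₂]
    · subst h₁
      rw [Function.update_self, Function.update_of_ne h₂] at h
      exact absurd h.symm (hidk l' hl'.1)
    · subst h₂
      rw [Function.update_self, Function.update_of_ne h₁] at h
      exact absurd h (hidk l hl.1)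
    · rw [Function.update_of_ne h₁, Function.update_of_ne h₂] at h
      exact h₈ l l' hl.1 hl'.1 h
  · intro l hl
    rw [hA] at hl
    by_cases h₁ : l = p
    · subst h₁; simpa using h₉ l hp
    · simpa [h₁, hidk l hl.1] using h₉ l hl.1

/-! ### Moving the first list to a coarser gridding -/

/-- The state of the first list after its first `k` cells have been moved. -/
structure MergeInv (s₀ : Store) (n t N : ℕ) (k : ℕ) (s : Store) : Prop where
  le : s.var vNew ≤ k
  rest : ∀ j, k < j → s.arr aX1 j = s₀.arr aX1 j ∧ s.arr aY1 j = s₀.arr aY1 j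
  index_le : ∀ X Y, X ≤ n → Y ≤ n → s.arr aIndex (cellAddr n t X Y) ≤ s.var vNew
  index : ∀ X Y, X ≤ n → Y ≤ n → s.arr aIndex (cellAddr n t X Y) ≠ 0 →
    s.arr aX1 (s.arr aIndex (cellAddr n t X Y)) = X ∧
    s.arr aY1 (s.arr aIndex (cellAddr n t X Y)) = Y
  new : ∀ i, 1 ≤ i → i ≤ s.var vNew →
    s.arr aIndex (cellAddr n t (s.arr aX1 i) (s.arr aY1 i)) = i ∧
    ∃ j, 1 ≤ j ∧ j ≤ k ∧ s₀.arr aLabX (s₀.arr aX1 j) = s.arr aX1 i ∧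
      s₀.arr aLabY (s₀.arr aY1 j) = s.arr aY1 i
  old : ∀ j, 1 ≤ j → j ≤ k → s.arr aIndex (cellAddr n t (s₀.arr aLabX (s₀.arr aX1 j))
    (s₀.arr aLabY (s₀.arr aY1 j))) ≠ 0
  sorted : ∀ i j, 1 ≤ i → i ≤ j → j ≤ s.var vNew → s.arr aX1 i ≤ s.arr aX1 j
  before : ∀ i j, 1 ≤ i → i ≤ s.var vNew → k < j → j ≤ N →
    s.arr aX1 i ≤ s₀.arr aLabX (s₀.arr aX1 j)
  clean : Clean n t (s.arr aIndex)

/-- The decomposition after the first `k` cells of the first list have been moved. -/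
def MergeTracks (π : Permutation) (d : ℕ) (m : Fin 2 → ℕ) (s₀ : Store) (N k : ℕ) (s : Store) :
    Prop :=
  Tracks π d m ![s₀.arr aLeftX, s₀.arr aLeftY] (s.arr 2) (s.arr 3) (s.arr 4) (s.var vMerges)
    (s.var vLast) (fun p => 1 ≤ p ∧ p ≤ N ∧ (p ≤ s.var vNew ∨ k < p)) (s.arr aId)
    (fun p => if p ≤ s.var vNew then s.arr aX1 p else s₀.arr aLabX (s₀.arr aX1 p))
    (fun p => if p ≤ s.var vNew then s.arr aY1 p else s₀.arr aLabY (s₀.arr aY1 p))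

/-- At most `k` cells have been written when cell `k + 1` is read, so the unread part of the list is
intact. The labels are monotone along the list, so an appended cell keeps it sorted. The proposition
`T` says that the record of merges is meaningful; in dense rounds the same code runs, but its merges
describe nothing. -/
theorem mergeBody_ends {s₀ s : Store} {n t N k : ℕ} (hk : k < N) (hn : s.var vLen = n)
    (ht : s.var vStamp = t) (eLX : s.arr aLabX = s₀.arr aLabX) (eLY : s.arr aLabY = s₀.arr aLabY)
    (hX : ∀ j, 1 ≤ j → j ≤ N → s₀.arr aLabX (s₀.arr aX1 j) ≤ n)
    (hY : ∀ j, 1 ≤ j → j ≤ N → s₀.arr aLabY (s₀.arr aY1 j) ≤ n)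
    (hs : ∀ i j, 1 ≤ i → i ≤ j → j ≤ N →
      s₀.arr aLabX (s₀.arr aX1 i) ≤ s₀.arr aLabX (s₀.arr aX1 j))
    (hj : s.var vLoop = k + 1) (hI : MergeInv s₀ n t N k s)
    {T : Prop} {π : Permutation} {d : ℕ} {m : Fin 2 → ℕ}
    (hT : T → MergeTracks π d m s₀ N k s) :
    mergeBody.Ends s 200 fun s' => MergeInv s₀ n t N (k + 1) (s'.setVar vLoop (k + 2)) ∧
      (T → MergeTracks π d m s₀ N (k + 1) (s'.setVar vLoop (k + 2))) := by
  obtain ⟨b1, b2, b3, b4, b5, b6, b7, b8, b9⟩ := hI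
  have hr := b2 (k + 1) (by omega)
  obtain ⟨X, hXd⟩ : ∃ X, X = s₀.arr aLabX (s₀.arr aX1 (k + 1)) := ⟨_, rfl⟩
  obtain ⟨Y, hYd⟩ : ∃ Y, Y = s₀.arr aLabY (s₀.arr aY1 (k + 1)) := ⟨_, rfl⟩
  have hXn : X ≤ n := hXd ▸ hX (k + 1) (by omega) hk
  have hYn : Y ≤ n := hYd ▸ hY (k + 1) (by omega) hk
  obtain ⟨c, hc⟩ : ∃ c, c = s.var vNew := ⟨_, rfl⟩
  have hrange : ∀ i, 1 ≤ i → i ≤ c → s.arr aX1 i ≤ n ∧ s.arr aY1 i ≤ n := by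
    intro i h₁ h₂
    obtain ⟨-, j, hj₁, hj₂, e₁, e₂⟩ := b5 i h₁ (hc ▸ h₂)
    rw [← e₁, ← e₂]
    exact ⟨hX j hj₁ (by omega), hY j hj₁ (by omega)⟩
  refine Cmd.Straight.ends (by simp [mergeBody]) (by simp [Cmd.time, Expr.cost, mergeBody]) ?_
  obtain ⟨s', hs'⟩ : ∃ s', s' = (mergeBody.exec s).setVar vLoop (k + 2) := ⟨_, rfl⟩
  rw [← hs']
  -- The default value 0 means that no earlier cell of this round has moved to `(X, Y)`.
  by_cases hA : s.arr aIndex (cellAddr n t X Y) = 0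
  · obtain ⟨v14, v6, v7, a2, a3, a4, a6, a7, a8, a17⟩ : s'.var 14 = c + 1 ∧
      s'.var 6 = s.var 6 ∧
      s'.var 7 = s.var 7 ∧
      s'.arr 2 = s.arr 2 ∧
      s'.arr 3 = s.arr 3 ∧
      s'.arr 4 = s.arr 4 ∧
      s'.arr 6 = Function.update (s.arr 6) (c + 1) X ∧
      s'.arr 7 = Function.update (s.arr 7) (c + 1) Y ∧
      s'.arr 8 = Function.update (s.arr 8) (c + 1) (s.arr 8 (k + 1)) ∧
      s'.arr 17 = Function.update (s.arr 17) (cellAddr n t X Y) (c + 1) := by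
      simp [hs', mergeBody, hn, ht, hj, eLX, eLY, hr.1, hr.2, ← hXd, ← hYd, cellAddr_fold, hA, hc]
    clear hs'
    rw [← hc] at b1 b3 b5 b7 b8
    have ux : ∀ i, i ≠ c + 1 → s'.arr 6 i = s.arr 6 i := fun i hi => by
      rw [a6, Function.update_of_ne hi]
    have uy : ∀ i, i ≠ c + 1 → s'.arr 7 i = s.arr 7 i := fun i hi => by
      rw [a7, Function.update_of_ne hi]
    have sx : s'.arr 6 (c + 1) = X := by rw [a6, Function.update_self]
    have sy : s'.arr 7 (c + 1) = Y := by rw [a7, Function.update_self]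
    have un : ∀ X' Y', X' ≤ n → Y' ≤ n → ¬(X' = X ∧ Y' = Y) →
        s'.arr 17 (cellAddr n t X' Y') = s.arr 17 (cellAddr n t X' Y') := by
      intro X' Y' h₁ h₂ h₃
      rw [a17, Function.update_of_ne]
      intro he
      exact h₃ (cellAddr_inj h₁ hXn h₂ hYn he).2
    have us : s'.arr 17 (cellAddr n t X Y) = c + 1 := by rw [a17, Function.update_self]
    refine ⟨⟨by omega, ?_, ?_, ?_, ?_, ?_, ?_, ?_, ?_⟩, ?_⟩
    · intro j hj'
      rw [ux j (by omega), uy j (by omega)]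
      exact b2 j (by omega)
    · intro X' Y' h₁ h₂
      by_cases h : X' = X ∧ Y' = Y
      · rw [h.1, h.2, us, v14]
      · rw [un X' Y' h₁ h₂ h, v14]
        exact (b3 X' Y' h₁ h₂).trans (Nat.le_succ _)
    · intro X' Y' h₁ h₂ h₃
      by_cases h : X' = X ∧ Y' = Y
      · rw [h.1, h.2, us, sx, sy]; exact ⟨rfl, rfl⟩
      · rw [un X' Y' h₁ h₂ h] at h₃ ⊢
        have := b3 X' Y' h₁ h₂
        rw [ux _ (by omega), uy _ (by omega)]
        exact b4 X' Y' h₁ h₂ h₃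
    · intro i h₁ h₂
      rw [v14] at h₂
      rcases Nat.le_or_eq_of_le_succ h₂ with h | rfl
      · rw [ux i (by omega), uy i (by omega)]
        have h₃ := b5 i h₁ h
        refine ⟨?_, ?_⟩
        · rw [un _ _ (hrange i h₁ h).1 (hrange i h₁ h).2, h₃.1]
          rintro ⟨e₁, e₂⟩
          rw [e₁, e₂, hA] at h₃
          have := h₃.1
          omega
        · obtain ⟨j, hj₁, hj₂, hj₃⟩ := h₃.2
          exact ⟨j, hj₁, by omega, hj₃⟩
      · rw [sx, sy, us]
        exact ⟨rfl, k + 1, by omega, le_rfl, hXd.symm, hYd.symm⟩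
    · intro j h₁ h₂
      rcases Nat.le_or_eq_of_le_succ h₂ with h | rfl
      · have h₃ := b6 j h₁ h
        rw [un _ _ (hX j h₁ (by omega)) (hY j h₁ (by omega))]
        · exact h₃
        · rintro ⟨e₁, e₂⟩
          rw [e₁, e₂, hA] at h₃
          exact h₃ rfl
      · simp only [Nat.succ_eq_add_one]
        rw [← hXd, ← hYd, us]; omega
    · intro i j h₁ h₂ h₃
      rw [v14] at h₃
      rcases Nat.le_or_eq_of_le_succ h₃ with h | rfl
      · rw [ux i (by omega), ux j (by omega)]; exact b7 i j h₁ h₂ h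
      · rcases Nat.le_or_eq_of_le_succ h₂ with h | rfl
        · simp only [Nat.succ_eq_add_one]
          rw [ux i (by omega), sx, hXd]; exact b8 i (k + 1) h₁ h (by omega) hk
        · exact le_rfl
    · intro i j h₁ h₂ h₃ h₄
      rw [v14] at h₂
      rcases Nat.le_or_eq_of_le_succ h₂ with h | rfl
      · rw [ux i (by omega)]; exact b8 i j h₁ h (by omega) h₄
      · simp only [Nat.succ_eq_add_one]
        rw [sx, hXd]; exact hs (k + 1) j (by omega) (by omega) h₄
    · rw [a17]; exact b9.update hXn hYn _
    · intro h
      have h := hT h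
      unfold MergeTracks at h ⊢
      rw [a2, a3, a4, v6, v7, v14]
      rw [← hc] at h
      -- The entry read at `k + 1` now stands at `c + 1`; the two positions may coincide.
      refine h.reindex (fun p => if p = c + 1 then k + 1 else p) ?_ ?_ ?_
      · rintro p ⟨hp₁, hp₂, hp₃⟩
        by_cases hpc : p = c + 1
        · subst hpc
          have e : ¬ k + 1 ≤ c := by omega
          simp only [if_true, e, if_false, le_refl]
          refine ⟨⟨by omega, hk, by omega⟩, by rw [a8, Function.update_self], ?_, ?_⟩
          · rw [sx, hXd]
          · rw [sy, hYd]
        · simp only [hpc, if_false]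
          refine ⟨⟨hp₁, hp₂, by omega⟩, by rw [a8, Function.update_of_ne hpc], ?_, ?_⟩
          · rw [ux p hpc]; by_cases hpc' : p ≤ c
            · simp [hpc', show p ≤ c + 1 by omega]
            · simp [hpc', show ¬ p ≤ c + 1 by omega]
          · rw [uy p hpc]; by_cases hpc' : p ≤ c
            · simp [hpc', show p ≤ c + 1 by omega]
            · simp [hpc', show ¬ p ≤ c + 1 by omega]
      · rintro p p' ⟨hp₁, hp₂, hp₃⟩ ⟨hp₁', hp₂', hp₃'⟩ he
        split_ifs at he <;> omega
      · rintro q ⟨hq₁, hq₂, hq₃⟩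
        by_cases hqk : q = k + 1
        · exact ⟨c + 1, ⟨by omega, by omega, by omega⟩, by simp [hqk]⟩
        · by_cases hqc : q = c + 1
          · exact absurd hq₃ (by omega)
          · exact ⟨q, ⟨hq₁, hq₂, by omega⟩, by simp [hqc]⟩
  · obtain ⟨p, hp⟩ : ∃ p, p = s.arr aIndex (cellAddr n t X Y) := ⟨_, rfl⟩
    rw [← hp] at hA
    have hpc : p ≤ c := by rw [hp, hc]; exact b3 X Y hXn hYn
    have hpx : s.arr aX1 p = X ∧ s.arr aY1 p = Y := by
      rw [hp]; exact b4 X Y hXn hYn (by rwa [← hp])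
    obtain ⟨v14, v6, v7, a2, a3, a4, a6, a7, a8, a17⟩ : s'.var 14 = c ∧
      s'.var 6 = s.var 6 + 1 ∧
      s'.var 7 = s.var 7 + 1 ∧
      s'.arr 2 = Function.update (s.arr 2) (s.var 6 + 1) (s.arr 8 p) ∧
      s'.arr 3 = Function.update (s.arr 3) (s.var 6 + 1) (s.arr 8 (k + 1)) ∧
      s'.arr 4 = Function.update (s.arr 4) (s.var 6 + 1) (s.var 7 + 1) ∧
      s'.arr 6 = s.arr 6 ∧
      s'.arr 7 = s.arr 7 ∧
      s'.arr 8 = Function.update (s.arr 8) p (s.var 7 + 1) ∧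
      s'.arr 17 = s.arr 17 := by
      simp [hs', mergeBody, hn, ht, hj, eLX, eLY, hr.1, hr.2, ← hXd, ← hYd, cellAddr_fold, ← hp,
        hA, hc]
    clear hs'
    refine ⟨⟨by omega, ?_, ?_, ?_, ?_, ?_, ?_, ?_, ?_⟩, ?_⟩
    · intro j hj'
      rw [a6, a7]; exact b2 j (by omega)
    · rw [a17, v14, hc]; exact b3
    · rw [a17, a6, a7]; exact b4
    · rw [a17, a6, a7, v14, hc]
      intro i h₁ h₂
      obtain ⟨h₃, j, hj₁, hj₂, hj₃⟩ := b5 i h₁ h₂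
      exact ⟨h₃, j, hj₁, by omega, hj₃⟩
    · intro j h₁ h₂
      rcases Nat.le_or_eq_of_le_succ h₂ with h | rfl
      · rw [a17]; exact b6 j h₁ h
      · simp only [Nat.succ_eq_add_one]
        rw [a17, ← hXd, ← hYd, ← hp]; exact hA
    · rw [a6, v14, hc]; exact b7
    · rw [a6, v14, hc]
      intro i j h₁ h₂ h₃ h₄
      exact b8 i j h₁ h₂ (by omega) h₄
    · rw [a17]; exact b9
    · intro h
      have h := hT h
      unfold MergeTracks at h ⊢
      rw [a2, a3, a4, v6, v7, v14, a6, a7, a8]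
      rw [← hc] at h
      have e : ¬ k + 1 ≤ c := by omega
      refine h.merge (p := p) (q := k + 1) ⟨by omega, by omega, .inl hpc⟩ ⟨by omega, hk, by omega⟩
        (by omega) ?_ ?_ ?_
      · simp only [hpc, if_true, e, if_false]; rw [hpx.1, hXd]
      · simp only [hpc, if_true, e, if_false]; rw [hpx.2, hYd]
      · intro l; omega

/-- At the end `aIndex` inverts the new list. This makes it possible to cut off the list at a
position and to recognise the lost cells afterwards. -/
theorem mergeLoop_ends {s : Store} {n t N m₀ m₁ m₀' m₁' : ℕ} {S : Finset (ℕ × ℕ)}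
    (hN : s.var vCells = N) (hn : s.var vLen = n) (ht : s.var vStamp = t) (h0 : s.var vNew = 0)
    (hl : IsList N (s.arr aX1) (s.arr aY1) S)
    (hS : ∀ p ∈ S, (1 ≤ p.1 ∧ p.1 ≤ m₀) ∧ 1 ≤ p.2 ∧ p.2 ≤ m₁) (hm₀ : m₀ ≤ n) (hm₁ : m₁ ≤ n)
    (hφ : Coarsening m₀ m₀' (s.arr aLabX)) (hψ : Coarsening m₁ m₁' (s.arr aLabY))
    (hc : Clean n t (s.arr aIndex))
    (hz : ∀ X Y, X ≤ n → Y ≤ n → s.arr aIndex (cellAddr n t X Y) = 0)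
    {T : Prop} {π : Permutation} {d : ℕ} {m : Fin 2 → ℕ}
    (hT : T → Tracks π d m ![s.arr aLeftX, s.arr aLeftY] (s.arr 2) (s.arr 3) (s.arr 4)
      (s.var vMerges) (s.var vLast) (fun p => 1 ≤ p ∧ p ≤ N) (s.arr aId)
      (fun p => s.arr aLabX (s.arr aX1 p)) (fun p => s.arr aLabY (s.arr aY1 p))) :
    (Cmd.forUp vLoop vCells mergeBody).Ends s (N * (200 + 10) + 10) fun s' =>
      s'.var vNew ≤ N ∧
      IsList (s'.var vNew) (s'.arr aX1) (s'.arr aY1)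
        (S.image fun p => (s.arr aLabX p.1, s.arr aLabY p.2)) ∧
      Clean n t (s'.arr aIndex) ∧
      (∀ p ∈ S.image fun p => (s.arr aLabX p.1, s.arr aLabY p.2),
        1 ≤ s'.arr aIndex (cellAddr n t p.1 p.2) ∧
        s'.arr aIndex (cellAddr n t p.1 p.2) ≤ s'.var vNew ∧
        s'.arr aX1 (s'.arr aIndex (cellAddr n t p.1 p.2)) = p.1 ∧
        s'.arr aY1 (s'.arr aIndex (cellAddr n t p.1 p.2)) = p.2) ∧
      (∀ i, 1 ≤ i → i ≤ s'.var vNew →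
        s'.arr aIndex (cellAddr n t (s'.arr aX1 i) (s'.arr aY1 i)) = i) ∧
      (T → Tracks π d m ![s.arr aLeftX, s.arr aLeftY] (s'.arr 2) (s'.arr 3) (s'.arr 4)
        (s'.var vMerges) (s'.var vLast) (fun p => 1 ≤ p ∧ p ≤ s'.var vNew) (s'.arr aId)
        (s'.arr aX1) (s'.arr aY1)) := by
  have hr : ∀ j, 1 ≤ j → j ≤ N → (1 ≤ s.arr 6 j ∧ s.arr 6 j ≤ m₀) ∧ 1 ≤ s.arr 7 j ∧
      s.arr 7 j ≤ m₁ := fun j h₁ h₂ => hS (s.arr 6 j, s.arr 7 j)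
        ((hl.mem _).mpr ⟨j, h₁, h₂, rfl, rfl⟩)
  have hX : ∀ j, 1 ≤ j → j ≤ N → s.arr 13 (s.arr 6 j) ≤ n := fun j h₁ h₂ =>
    (hφ.le_self (hr j h₁ h₂).1.1 (hr j h₁ h₂).1.2).trans ((hr j h₁ h₂).1.2.trans hm₀)
  have hY : ∀ j, 1 ≤ j → j ≤ N → s.arr 14 (s.arr 7 j) ≤ n := fun j h₁ h₂ =>
    (hψ.le_self (hr j h₁ h₂).2.1 (hr j h₁ h₂).2.2).trans ((hr j h₁ h₂).2.2.trans hm₁)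
  have hs : ∀ i j, 1 ≤ i → i ≤ j → j ≤ N → s.arr 13 (s.arr 6 i) ≤ s.arr 13 (s.arr 6 j) :=
    fun i j h₁ h₂ h₃ => hφ.mono (hr i h₁ (by omega)).1.1 (hl.sorted i j h₁ h₂ h₃)
      (hr j (by omega) h₃).1.2
  have himg : ∀ p, p ∈ S.image (fun p => (s.arr 13 p.1, s.arr 14 p.2)) ↔ ∃ j, 1 ≤ j ∧ j ≤ N ∧
      s.arr 13 (s.arr 6 j) = p.1 ∧ s.arr 14 (s.arr 7 j) = p.2 := by
    intro p
    simp only [Finset.mem_image]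
    constructor
    · rintro ⟨q, hq, rfl⟩
      obtain ⟨j, h₁, h₂, h₃, h₄⟩ := (hl.mem q).mp hq
      exact ⟨j, h₁, h₂, by rw [h₃], by rw [h₄]⟩
    · rintro ⟨j, h₁, h₂, h₃, h₄⟩
      exact ⟨(s.arr 6 j, s.arr 7 j), (hl.mem _).mpr ⟨j, h₁, h₂, rfl, rfl⟩, Prod.ext h₃ h₄⟩
  refine Cmd.Ends.mono (Cmd.Ends.forUp (n := N) (T := 200) (fun k s' => MergeInv s n t N k s' ∧
    (T → MergeTracks π d m s N k s')) hN (by simp) (by simp [mergeBody]) (by simp [mergeBody])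
    ?_ ?_) le_rfl ?_
  · refine ⟨⟨by simp [h0], by simp, ?_, ?_, ?_, by intros; omega, ?_, ?_, hc⟩, fun h => ?_⟩
    · intro X Y h₁ h₂
      simp [hz X Y h₁ h₂]
    · intro X Y h₁ h₂ h₃
      exact absurd (hz X Y h₁ h₂) h₃
    · intro i h₁ h₂; simp [h0] at h₂; omega
    · intro i j h₁ h₂ h₃; simp [h0] at h₃; omega
    · intro i j h₁ h₂; simp [h0] at h₂; omega
    · refine (hT h).reindex (fun p => p) ?_ ?_ ?_
      · rintro p ⟨h₁, h₂, h₃⟩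
        have : p ≠ 0 := by omega
        simp [h0, this, h₁, h₂]
      · simp
      · rintro q ⟨h₁, h₂⟩
        exact ⟨q, ⟨h₁, h₂, .inr (by omega)⟩, rfl⟩
  · intro k hk s' hf hj hI
    exact mergeBody_ends hk (by rw [hf.1 0 (by simp [mergeBody]), hn])
      (by rw [hf.1 8 (by simp [mergeBody]), ht]) (hf.2 13 (by simp [mergeBody]))
      (hf.2 14 (by simp [mergeBody])) hX hY hs hj hI.1 hI.2
  · rintro s' - ⟨⟨b1, b2, b3, b4, b5, b6, b7, b8, b9⟩, hT'⟩
    have key : ∀ p ∈ S.image fun p => (s.arr aLabX p.1, s.arr aLabY p.2),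
        1 ≤ s'.arr aIndex (cellAddr n t p.1 p.2) ∧
        s'.arr aIndex (cellAddr n t p.1 p.2) ≤ s'.var vNew ∧
        s'.arr aX1 (s'.arr aIndex (cellAddr n t p.1 p.2)) = p.1 ∧
        s'.arr aY1 (s'.arr aIndex (cellAddr n t p.1 p.2)) = p.2 := by
      intro p hp
      obtain ⟨j, h₁, h₂, h₃, h₄⟩ := (himg p).mp hp
      rw [← h₃, ← h₄]
      have h₅ := b6 j h₁ h₂
      exact ⟨by omega, b3 _ _ (hX j h₁ h₂) (hY j h₁ h₂), b4 _ _ (hX j h₁ h₂) (hY j h₁ h₂) h₅⟩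
    refine ⟨b1, ⟨?_, ?_, b7⟩, b9, key, fun i h₁ h₂ => (b5 i h₁ h₂).1, ?_⟩
    · intro i j h₁ h₂ h₃ h₄ h₅ h₆
      rw [← (b5 i h₁ h₂).1, ← (b5 j h₃ h₄).1, h₅, h₆]
    · intro p
      constructor
      · intro hp
        exact ⟨_, (key p hp).1, (key p hp).2.1, (key p hp).2.2⟩
      · rintro ⟨i, h₁, h₂, h₃, h₄⟩
        obtain ⟨-, j, hj₁, hj₂, e₁, e₂⟩ := b5 i h₁ h₂
        exact (himg p).mpr ⟨j, hj₁, hj₂, by rw [e₁, h₃], by rw [e₂, h₄]⟩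
    · intro h
      refine (hT' h).reindex (fun p => p) ?_ ?_ ?_
      · rintro p ⟨h₁, h₂⟩
        simp only [h₂, if_true, true_or, and_true, h₁, true_and]
        omega
      · intro p p' _ _ h; exact h
      · rintro q ⟨h₁, h₂, h₃⟩
        exact ⟨q, ⟨h₁, by omega⟩, rfl⟩

/-- Cutting off a list. -/
theorem IsList.take {N c : ℕ} {x y : ℕ → ℕ} {S : Finset (ℕ × ℕ)} (h : IsList N x y S) (hc : c ≤ N)
    (idx : ℕ × ℕ → ℕ) (hidx : ∀ i, 1 ≤ i → i ≤ N → idx (x i, y i) = i) :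
    IsList c x y (S.filter fun p => idx p ≤ c) where
  inj i j h₁ h₂ h₃ h₄ := h.inj i j h₁ (h₂.trans hc) h₃ (h₄.trans hc)
  mem p := by
    rw [Finset.mem_filter, h.mem]
    constructor
    · rintro ⟨⟨j, h₁, h₂, h₃, h₄⟩, h₅⟩
      have : idx p = j := by rw [← hidx j h₁ h₂, h₃, h₄]
      exact ⟨j, h₁, by omega, h₃, h₄⟩
    · rintro ⟨j, h₁, h₂, h₃, h₄⟩
      have : idx p = j := by rw [← hidx j h₁ (by omega), h₃, h₄]
      exact ⟨⟨j, h₁, by omega, h₃, h₄⟩, by omega⟩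
  sorted i j h₁ h₂ h₃ := h.sorted i j h₁ h₂ (h₃.trans hc)

/-! ### Moving the second list to a coarser gridding -/

/-- The state of the second list after its first `k` cells have been moved. -/
structure MoveInv (s₀ : Store) (n t N : ℕ) (k : ℕ) (s : Store) : Prop where
  le : s.var vPos ≤ k
  rest : ∀ j, k < j → s.arr aX2 j = s₀.arr aX2 j ∧ s.arr aY2 j = s₀.arr aY2 j
  mark : ∀ X Y, X ≤ n → Y ≤ n → s.arr aMark (cellAddr n t X Y) ≠ 0 →
    ∃ i, 1 ≤ i ∧ i ≤ s.var vPos ∧ s.arr aX2 i = X ∧ s.arr aY2 i = Y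
  new : ∀ i, 1 ≤ i → i ≤ s.var vPos →
    s.arr aMark (cellAddr n t (s.arr aX2 i) (s.arr aY2 i)) ≠ 0 ∧
    s₀.arr aIndex (cellAddr n t (s.arr aX2 i) (s.arr aY2 i)) ≤ s₀.var vNew ∧
    ∃ j, 1 ≤ j ∧ j ≤ k ∧ s₀.arr aLabX (s₀.arr aX2 j) = s.arr aX2 i ∧
      s₀.arr aLabY (s₀.arr aY2 j) = s.arr aY2 i
  inj : ∀ i j, 1 ≤ i → i ≤ s.var vPos → 1 ≤ j → j ≤ s.var vPos → s.arr aX2 i = s.arr aX2 j →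
    s.arr aY2 i = s.arr aY2 j → i = j
  old : ∀ j, 1 ≤ j → j ≤ k → s₀.arr aIndex (cellAddr n t (s₀.arr aLabX (s₀.arr aX2 j))
    (s₀.arr aLabY (s₀.arr aY2 j))) ≤ s₀.var vNew → s.arr aMark (cellAddr n t
      (s₀.arr aLabX (s₀.arr aX2 j)) (s₀.arr aLabY (s₀.arr aY2 j))) ≠ 0
  sorted : ∀ i j, 1 ≤ i → i ≤ j → j ≤ s.var vPos → s.arr aY2 i ≤ s.arr aY2 j
  before : ∀ i j, 1 ≤ i → i ≤ s.var vPos → k < j → j ≤ N →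
    s.arr aY2 i ≤ s₀.arr aLabY (s₀.arr aY2 j)
  clean : Clean n t (s.arr aMark)

/-- The counterpart of `mergeBody_ends` with the axes exchanged and without identities of
rectangles: a repeated cell, or one that has been cut off, is dropped. -/
theorem moveBody_ends {s₀ s : Store} {n t N k : ℕ} (hk : k < N) (hn : s.var vLen = n)
    (ht : s.var vStamp = t) (eLX : s.arr aLabX = s₀.arr aLabX) (eLY : s.arr aLabY = s₀.arr aLabY)
    (eI : s.arr aIndex = s₀.arr aIndex) (eN : s.var vNew = s₀.var vNew)
    (hX : ∀ j, 1 ≤ j → j ≤ N → s₀.arr aLabX (s₀.arr aX2 j) ≤ n)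
    (hY : ∀ j, 1 ≤ j → j ≤ N → s₀.arr aLabY (s₀.arr aY2 j) ≤ n)
    (hs : ∀ i j, 1 ≤ i → i ≤ j → j ≤ N →
      s₀.arr aLabY (s₀.arr aY2 i) ≤ s₀.arr aLabY (s₀.arr aY2 j))
    (hj : s.var vLoop = k + 1) (hI : MoveInv s₀ n t N k s) :
    moveBody.Ends s 200 fun s' => MoveInv s₀ n t N (k + 1) (s'.setVar vLoop (k + 2)) := by
  obtain ⟨b1, b2, b3, b4, b5, b6, b7, b8, b9⟩ := hI
  have hr := b2 (k + 1) (by omega)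
  obtain ⟨X, hXd⟩ : ∃ X, X = s₀.arr aLabX (s₀.arr aX2 (k + 1)) := ⟨_, rfl⟩
  obtain ⟨Y, hYd⟩ : ∃ Y, Y = s₀.arr aLabY (s₀.arr aY2 (k + 1)) := ⟨_, rfl⟩
  have hXn : X ≤ n := hXd ▸ hX (k + 1) (by omega) hk
  have hYn : Y ≤ n := hYd ▸ hY (k + 1) (by omega) hk
  obtain ⟨c, hc⟩ : ∃ c, c = s.var vPos := ⟨_, rfl⟩
  have hrange : ∀ i, 1 ≤ i → i ≤ c → s.arr aX2 i ≤ n ∧ s.arr aY2 i ≤ n := by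
    intro i h₁ h₂
    obtain ⟨-, -, j, hj₁, hj₂, e₁, e₂⟩ := b4 i h₁ (hc ▸ h₂)
    rw [← e₁, ← e₂]
    exact ⟨hX j hj₁ (by omega), hY j hj₁ (by omega)⟩
  refine Cmd.Straight.ends (by simp [moveBody]) (by simp [Cmd.time, Expr.cost, moveBody]) ?_
  obtain ⟨s', hs'⟩ : ∃ s', s' = (moveBody.exec s).setVar vLoop (k + 2) := ⟨_, rfl⟩
  rw [← hs']
  by_cases hA : s₀.arr aIndex (cellAddr n t X Y) ≤ s₀.var vNew ∧ s.arr aMark (cellAddr n t X Y) = 0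
  · have hA' : ¬ s₀.var vNew < s₀.arr aIndex (cellAddr n t X Y) := not_lt.mpr hA.1
    obtain ⟨v15, a9, a10, a18⟩ : s'.var 15 = c + 1 ∧
        s'.arr 9 = Function.update (s.arr 9) (c + 1) X ∧
        s'.arr 10 = Function.update (s.arr 10) (c + 1) Y ∧
        s'.arr 18 = Function.update (s.arr 18) (cellAddr n t X Y) 1 := by
      simp [hs', moveBody, hn, ht, hj, eLX, eLY, eI, eN, hr.1, hr.2, ← hXd, ← hYd, cellAddr_fold,
        hA', hA.2, hc]
    clear hs'
    rw [← hc] at b1 b3 b4 b5 b7 b8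
    have ux : ∀ i, i ≠ c + 1 → s'.arr 9 i = s.arr 9 i := fun i hi => by
      rw [a9, Function.update_of_ne hi]
    have uy : ∀ i, i ≠ c + 1 → s'.arr 10 i = s.arr 10 i := fun i hi => by
      rw [a10, Function.update_of_ne hi]
    have sx : s'.arr 9 (c + 1) = X := by rw [a9, Function.update_self]
    have sy : s'.arr 10 (c + 1) = Y := by rw [a10, Function.update_self]
    have un : ∀ X' Y', X' ≤ n → Y' ≤ n → ¬(X' = X ∧ Y' = Y) →
        s'.arr 18 (cellAddr n t X' Y') = s.arr 18 (cellAddr n t X' Y') := by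
      intro X' Y' h₁ h₂ h₃
      rw [a18, Function.update_of_ne]
      intro he
      exact h₃ (cellAddr_inj h₁ hXn h₂ hYn he).2
    have us : s'.arr 18 (cellAddr n t X Y) ≠ 0 := by rw [a18, Function.update_self]; norm_num
    have keep : ∀ X' Y', X' ≤ n → Y' ≤ n → s.arr 18 (cellAddr n t X' Y') ≠ 0 →
        s'.arr 18 (cellAddr n t X' Y') ≠ 0 := by
      intro X' Y' h₁ h₂ h₃
      by_cases h : X' = X ∧ Y' = Y
      · rw [h.1, h.2]; exact us
      · rwa [un X' Y' h₁ h₂ h]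
    have fresh : ∀ i, 1 ≤ i → i ≤ c → ¬ (s.arr 9 i = X ∧ s.arr 10 i = Y) := by
      rintro i h₁ h₂ ⟨e₁, e₂⟩
      have := (b4 i h₁ h₂).1
      rw [e₁, e₂] at this
      exact this hA.2
    refine ⟨by omega, ?_, ?_, ?_, ?_, ?_, ?_, ?_, ?_⟩
    · intro j hj'
      rw [ux j (by omega), uy j (by omega)]
      exact b2 j (by omega)
    · intro X' Y' h₁ h₂ h₃
      rw [v15]
      by_cases h : X' = X ∧ Y' = Y
      · exact ⟨c + 1, by omega, le_rfl, by rw [sx, h.1], by rw [sy, h.2]⟩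
      · rw [un X' Y' h₁ h₂ h] at h₃
        obtain ⟨i, hi₁, hi₂, hi₃⟩ := b3 X' Y' h₁ h₂ h₃
        exact ⟨i, hi₁, by omega, by rw [ux i (by omega), uy i (by omega)]; exact hi₃⟩
    · intro i h₁ h₂
      rw [v15] at h₂
      rcases Nat.le_or_eq_of_le_succ h₂ with h | rfl
      · rw [ux i (by omega), uy i (by omega)]
        obtain ⟨h₃, h₄, j, hj₁, hj₂, hj₃⟩ := b4 i h₁ h
        exact ⟨keep _ _ (hrange i h₁ h).1 (hrange i h₁ h).2 h₃, h₄, j, hj₁, by omega, hj₃⟩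
      · simp only [Nat.succ_eq_add_one]
        rw [sx, sy]
        exact ⟨us, hA.1, k + 1, by omega, le_rfl, hXd.symm, hYd.symm⟩
    · intro i j h₁ h₂ h₃ h₄ h₅ h₆
      rw [v15] at h₂ h₄
      rcases Nat.le_or_eq_of_le_succ h₂ with h | h <;>
        rcases Nat.le_or_eq_of_le_succ h₄ with h' | h'
      · rw [ux i (by omega), ux j (by omega)] at h₅
        rw [uy i (by omega), uy j (by omega)] at h₆
        exact b5 i j h₁ h h₃ h' h₅ h₆
      · rw [ux i (by omega), h', Nat.succ_eq_add_one, sx] at h₅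
        rw [uy i (by omega), h', Nat.succ_eq_add_one, sy] at h₆
        exact absurd ⟨h₅, h₆⟩ (fresh i h₁ h)
      · rw [ux j (by omega), h, Nat.succ_eq_add_one, sx] at h₅
        rw [uy j (by omega), h, Nat.succ_eq_add_one, sy] at h₆
        exact absurd ⟨h₅.symm, h₆.symm⟩ (fresh j h₃ h')
      · omega
    · intro j h₁ h₂ h₃
      rcases Nat.le_or_eq_of_le_succ h₂ with h | rfl
      · exact keep _ _ (hX j h₁ (by omega)) (hY j h₁ (by omega)) (b6 j h₁ h h₃)
      · simp only [Nat.succ_eq_add_one]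
        rw [← hXd, ← hYd]; exact us
    · intro i j h₁ h₂ h₃
      rw [v15] at h₃
      rcases Nat.le_or_eq_of_le_succ h₃ with h | rfl
      · rw [uy i (by omega), uy j (by omega)]; exact b7 i j h₁ h₂ h
      · rcases Nat.le_or_eq_of_le_succ h₂ with h | rfl
        · simp only [Nat.succ_eq_add_one]
          rw [uy i (by omega), sy, hYd]; exact b8 i (k + 1) h₁ h (by omega) hk
        · exact le_rfl
    · intro i j h₁ h₂ h₃ h₄
      rw [v15] at h₂
      rcases Nat.le_or_eq_of_le_succ h₂ with h | rfl
      · rw [uy i (by omega)]; exact b8 i j h₁ h (by omega) h₄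
      · simp only [Nat.succ_eq_add_one]
        rw [sy, hYd]; exact hs (k + 1) j (by omega) (by omega) h₄
    · rw [a18]; exact b9.update hXn hYn _
  · obtain ⟨v15, a9, a10, a18⟩ : s'.var 15 = c ∧ s'.arr 9 = s.arr 9 ∧ s'.arr 10 = s.arr 10 ∧
        s'.arr 18 = s.arr 18 := by
      rcases not_and_or.mp hA with h | h
      · have h := not_le.mp h
        simp [hs', moveBody, hn, ht, hj, eLX, eLY, eI, eN, hr.1, hr.2, ← hXd, ← hYd,
          cellAddr_fold, h, hc]
      · by_cases h' : s₀.var vNew < s₀.arr aIndex (cellAddr n t X Y) <;>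
        simp [hs', moveBody, hn, ht, hj, eLX, eLY, eI, eN, hr.1, hr.2, ← hXd, ← hYd,
          cellAddr_fold, h, h', hc]
    clear hs'
    refine ⟨by omega, ?_, ?_, ?_, ?_, ?_, ?_, ?_, ?_⟩
    · intro j hj'
      rw [a9, a10]; exact b2 j (by omega)
    · rw [a18, v15, a9, a10, hc]; exact b3
    · rw [a18, a9, a10, v15, hc]
      intro i h₁ h₂
      obtain ⟨h₃, h₄, j, hj₁, hj₂, hj₃⟩ := b4 i h₁ h₂
      exact ⟨h₃, h₄, j, hj₁, by omega, hj₃⟩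
    · rw [a9, a10, v15, hc]; exact b5
    · intro j h₁ h₂ h₃
      rw [a18]
      rcases Nat.le_or_eq_of_le_succ h₂ with h | rfl
      · exact b6 j h₁ h h₃
      · simp only [Nat.succ_eq_add_one] at h₃ ⊢
        rw [← hXd, ← hYd] at h₃ ⊢
        exact fun h => hA ⟨h₃, h⟩
    · rw [a10, v15, hc]; exact b7
    · rw [a10, v15, hc]
      intro i j h₁ h₂ h₃ h₄
      exact b8 i j h₁ h₂ (by omega) h₄
    · rw [a18]; exact b9

theorem moveLoop_ends {s : Store} {n t N m₀ m₁ m₀' m₁' : ℕ} {S : Finset (ℕ × ℕ)} {φ ψ : ℕ → ℕ}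
    (hN : s.var vCells = N) (hn : s.var vLen = n) (ht : s.var vStamp = t) (h0 : s.var vPos = 0)
    (hl : IsList N (s.arr aY2) (s.arr aX2) (S.image Prod.swap))
    (hS : ∀ p ∈ S, (1 ≤ p.1 ∧ p.1 ≤ m₀) ∧ 1 ≤ p.2 ∧ p.2 ≤ m₁) (hm₀ : m₀ ≤ n) (hm₁ : m₁ ≤ n)
    (eφ : s.arr aLabX = φ) (eψ : s.arr aLabY = ψ)
    (hφ : Coarsening m₀ m₀' φ) (hψ : Coarsening m₁ m₁' ψ)
    (hc : Clean n t (s.arr aMark))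
    (hz : ∀ X Y, X ≤ n → Y ≤ n → s.arr aMark (cellAddr n t X Y) = 0) :
    (Cmd.forUp vLoop vCells moveBody).Ends s (N * (200 + 10) + 10) fun s' =>
      IsList (s'.var vPos) (s'.arr aY2) (s'.arr aX2)
        (((S.image fun p => (φ p.1, ψ p.2)).filter fun p =>
          s.arr aIndex (cellAddr n t p.1 p.2) ≤ s.var vNew).image Prod.swap) ∧
      Clean n t (s'.arr aMark) := by
  subst eφ eψ
  have hr : ∀ j, 1 ≤ j → j ≤ N → (1 ≤ s.arr 9 j ∧ s.arr 9 j ≤ m₀) ∧ 1 ≤ s.arr 10 j ∧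
      s.arr 10 j ≤ m₁ := by
    intro j h₁ h₂
    obtain ⟨p, hp, he⟩ := Finset.mem_image.mp ((hl.mem (s.arr 10 j, s.arr 9 j)).mpr
      ⟨j, h₁, h₂, rfl, rfl⟩)
    have := hS p hp
    rw [Prod.ext_iff] at he
    simp only [Prod.fst_swap, Prod.snd_swap] at he
    rwa [he.1, he.2] at this
  have hX : ∀ j, 1 ≤ j → j ≤ N → s.arr 13 (s.arr 9 j) ≤ n := fun j h₁ h₂ =>
    (hφ.le_self (hr j h₁ h₂).1.1 (hr j h₁ h₂).1.2).trans ((hr j h₁ h₂).1.2.trans hm₀)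
  have hY : ∀ j, 1 ≤ j → j ≤ N → s.arr 14 (s.arr 10 j) ≤ n := fun j h₁ h₂ =>
    (hψ.le_self (hr j h₁ h₂).2.1 (hr j h₁ h₂).2.2).trans ((hr j h₁ h₂).2.2.trans hm₁)
  have hs : ∀ i j, 1 ≤ i → i ≤ j → j ≤ N → s.arr 14 (s.arr 10 i) ≤ s.arr 14 (s.arr 10 j) :=
    fun i j h₁ h₂ h₃ => hψ.mono (hr i h₁ (by omega)).2.1 (hl.sorted i j h₁ h₂ h₃)
      (hr j (by omega) h₃).2.2
  have himg : ∀ X Y, (X, Y) ∈ S.image (fun p => (s.arr 13 p.1, s.arr 14 p.2)) ↔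
      ∃ j, 1 ≤ j ∧ j ≤ N ∧ s.arr 13 (s.arr 9 j) = X ∧ s.arr 14 (s.arr 10 j) = Y := by
    intro X Y
    simp only [Finset.mem_image]
    constructor
    · rintro ⟨q, hq, he⟩
      obtain ⟨j, h₁, h₂, h₃, h₄⟩ := (hl.mem q.swap).mp (Finset.mem_image_of_mem _ hq)
      simp only [Prod.fst_swap, Prod.snd_swap] at h₃ h₄
      rw [Prod.ext_iff] at he
      exact ⟨j, h₁, h₂, by rw [h₄]; exact he.1, by rw [h₃]; exact he.2⟩
    · rintro ⟨j, h₁, h₂, h₃, h₄⟩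
      obtain ⟨p, hp, he⟩ := Finset.mem_image.mp ((hl.mem (s.arr 10 j, s.arr 9 j)).mpr
        ⟨j, h₁, h₂, rfl, rfl⟩)
      rw [Prod.ext_iff] at he
      simp only [Prod.fst_swap, Prod.snd_swap] at he
      exact ⟨p, hp, by rw [he.1, he.2, h₃, h₄]⟩
  refine Cmd.Ends.mono (Cmd.Ends.forUp (n := N) (T := 200) (fun k s' => MoveInv s n t N k s') hN
    (by simp) (by simp [moveBody]) (by simp [moveBody]) ?_ ?_) le_rfl ?_
  · refine ⟨by simp [h0], by simp, ?_, ?_, ?_, by intros; omega, ?_, ?_, hc⟩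
    · intro X Y h₁ h₂ h₃
      exact absurd (hz X Y h₁ h₂) h₃
    · intro i h₁ h₂; simp [h0] at h₂; omega
    · intro i j h₁ h₂; simp [h0] at h₂; omega
    · intro i j h₁ h₂ h₃; simp [h0] at h₃; omega
    · intro i j h₁ h₂; simp [h0] at h₂; omega
  · intro k hk s' hf hj hI
    exact moveBody_ends hk (by rw [hf.1 0 (by simp [moveBody]), hn])
      (by rw [hf.1 8 (by simp [moveBody]), ht]) (hf.2 13 (by simp [moveBody]))
      (hf.2 14 (by simp [moveBody])) (hf.2 17 (by simp [moveBody]))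
      (hf.1 14 (by simp [moveBody])) hX hY hs hj hI
  · rintro s' - ⟨b1, b2, b3, b4, b5, b6, b7, b8, b9⟩
    refine ⟨⟨fun i j h₁ h₂ h₃ h₄ h₅ h₆ => b5 i j h₁ h₂ h₃ h₄ h₆ h₅, ?_, b7⟩, b9⟩
    rintro ⟨Y, X⟩
    constructor
    · intro hp
      obtain ⟨⟨X', Y'⟩, hq, he⟩ := Finset.mem_image.mp hp
      simp only [Prod.swap_prod_mk, Prod.mk.injEq] at he
      obtain ⟨rfl, rfl⟩ := he
      obtain ⟨hp₁, hp₂⟩ := Finset.mem_filter.mp hq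
      obtain ⟨j, h₁, h₂, rfl, rfl⟩ := (himg _ _).mp hp₁
      obtain ⟨i, hi₁, hi₂, hi₃, hi₄⟩ := b3 _ _ (hX j h₁ h₂) (hY j h₁ h₂) (b6 j h₁ h₂ hp₂)
      exact ⟨i, hi₁, hi₂, hi₄, hi₃⟩
    · rintro ⟨i, h₁, h₂, h₃, h₄⟩
      simp only at h₃ h₄
      obtain ⟨-, h₅, j, hj₁, hj₂, e₁, e₂⟩ := b4 i h₁ h₂
      rw [h₃, h₄] at h₅
      refine Finset.mem_image.mpr ⟨(X, Y), Finset.mem_filter.mpr ⟨?_, h₅⟩, rfl⟩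
      exact (himg _ _).mpr ⟨j, hj₁, hj₂, by rw [e₁, h₄], by rw [e₂, h₃]⟩

/-! ### Tries of finite sets -/

/-- The nodes `ρ, …, q` form a trie with root `ρ`: the child of `v` for the letter `u` is
`ch (v * (n + 1) + u)`, and the node `w` stands for the set `key w`. -/
structure Trie (n ρ q : ℕ) (ch ky pa : ℕ → ℕ) (key : ℕ → Finset ℕ) : Prop where
  root : key ρ = ∅
  le : ρ ≤ q
  child : ∀ v u, ρ ≤ v → v ≤ q → u ≤ n → ch (v * (n + 1) + u) ≠ 0 →
    ρ < ch (v * (n + 1) + u) ∧ ch (v * (n + 1) + u) ≤ q ∧ pa (ch (v * (n + 1) + u)) = v ∧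
      ky (ch (v * (n + 1) + u)) = u
  node : ∀ w, ρ < w → w ≤ q → ρ ≤ pa w ∧ pa w ≤ q ∧ 1 ≤ ky w ∧ ky w ≤ n ∧
    ch (pa w * (n + 1) + ky w) = w ∧ key w = insert (ky w) (key (pa w)) ∧
      ∀ z ∈ key (pa w), z < ky w
  inj : ∀ v w, ρ ≤ v → v ≤ q → ρ ≤ w → w ≤ q → key v = key w → v = w
  fresh : ∀ v u, q < v → u ≤ n → ch (v * (n + 1) + u) = 0

/-- The inserted element is the maximum, so the union determines it. -/
theorem insert_inj_of_lt {A B : Finset ℕ} {u v : ℕ} (hA : ∀ z ∈ A, z < u) (hB : ∀ z ∈ B, z < v)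
    (h : insert u A = insert v B) : u = v ∧ A = B := by
  have huv : u = v := by
    have h₁ : u ∈ insert v B := h ▸ Finset.mem_insert_self u A
    have h₂ : v ∈ insert u A := h ▸ Finset.mem_insert_self v B
    rw [Finset.mem_insert] at h₁ h₂
    rcases h₁ with h₁ | h₁
    · exact h₁
    · rcases h₂ with h₂ | h₂
      · exact h₂.symm
      · have := hA v h₂; have := hB u h₁; omega
  subst huv
  refine ⟨rfl, ?_⟩
  have hA' : u ∉ A := fun h => lt_irrefl _ (hA u h)
  have hB' : u ∉ B := fun h => lt_irrefl _ (hB u h)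
  rw [← Finset.erase_insert hA', h, Finset.erase_insert hB']

/-- Letters are added in increasing order, so a key determines its last letter and the key of its
parent. An old node with the new key would therefore be a child of `v` for the letter `u`, and there
is none. Thus distinct nodes keep distinct keys. -/
theorem Trie.insert {n ρ q : ℕ} {ch ky pa : ℕ → ℕ} {key : ℕ → Finset ℕ}
    (h : Trie n ρ q ch ky pa key) {v u : ℕ} (hv : ρ ≤ v) (hvq : v ≤ q) (hu : 1 ≤ u) (hun : u ≤ n)
    (hlt : ∀ z ∈ key v, z < u) (h0 : ch (v * (n + 1) + u) = 0) :
    Trie n ρ (q + 1) (Function.update ch (v * (n + 1) + u) (q + 1)) (Function.update ky (q + 1) u)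
      (Function.update pa (q + 1) v) (Function.update key (q + 1) (insert u (key v))) := by
  have hkey : ∀ w, w ≤ q → Function.update key (q + 1) (Insert.insert u (key v)) w = key w :=
    fun w hw => Function.update_of_ne (by omega) _ _
  have hch : ∀ v' u', u' ≤ n → ¬(v' = v ∧ u' = u) →
      Function.update ch (v * (n + 1) + u) (q + 1) (v' * (n + 1) + u') =
        ch (v' * (n + 1) + u') := fun v' u' hu' hne =>
    Function.update_of_ne (fun he => hne (pair_inj hu' hun he)) _ _
  have hnew : ∀ w, ρ ≤ w → w ≤ q → key w ≠ Insert.insert u (key v) := by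
    intro w hw hwq he
    rcases Nat.eq_or_lt_of_le hw with rfl | hw'
    · rw [h.root] at he
      exact absurd (he ▸ Finset.mem_insert_self u (key v)) (Finset.notMem_empty u)
    · obtain ⟨n₁, n₂, -, -, n₃, n₄, n₅⟩ := h.node w hw' hwq
      rw [n₄] at he
      obtain ⟨e₁, e₂⟩ := insert_inj_of_lt n₅ hlt he
      have := h.inj _ _ n₁ n₂ hv hvq e₂
      rw [this, e₁, h0] at n₃
      omega
  refine ⟨by rw [hkey ρ h.le, h.root], h.le.trans (Nat.le_succ q), ?_, ?_, ?_, ?_⟩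
  · intro v' u' h₁ h₂ h₃ h₄
    by_cases hc : v' = v ∧ u' = u
    · obtain ⟨rfl, rfl⟩ := hc
      simp only [Function.update_self]
      exact ⟨by omega, le_rfl, trivial, trivial⟩
    · rw [hch v' u' h₃ hc] at h₄ ⊢
      rcases Nat.le_or_eq_of_le_succ h₂ with h₅ | rfl
      · obtain ⟨c₁, c₂, c₃, c₄⟩ := h.child v' u' h₁ h₅ h₃ h₄
        rw [Function.update_of_ne (by omega), Function.update_of_ne (by omega)]
        exact ⟨c₁, by omega, c₃, c₄⟩
      · exact absurd (h.fresh _ u' (by omega) h₃) h₄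
  · intro w hw hwq
    rcases Nat.le_or_eq_of_le_succ hwq with h₅ | rfl
    · obtain ⟨n₁, n₂, n₃, n₄, n₅, n₆, n₇⟩ := h.node w hw h₅
      rw [Function.update_of_ne (by omega), Function.update_of_ne (by omega), hkey w h₅,
        hkey _ n₂]
      refine ⟨n₁, by omega, n₃, n₄, ?_, n₆, n₇⟩
      rw [hch _ _ n₄, n₅]
      rintro ⟨e₁, e₂⟩
      rw [e₁, e₂, h0] at n₅
      omega
    · simp only [Nat.succ_eq_add_one, Function.update_self]
      rw [hkey v hvq]
      exact ⟨hv, by omega, hu, hun, trivial, rfl, hlt⟩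
  · intro a b ha haq hb hbq he
    rcases Nat.le_or_eq_of_le_succ haq with h₁ | rfl <;>
      rcases Nat.le_or_eq_of_le_succ hbq with h₂ | rfl
    · rw [hkey a h₁, hkey b h₂] at he
      exact h.inj a b ha h₁ hb h₂ he
    · rw [hkey a h₁, Nat.succ_eq_add_one, Function.update_self] at he
      exact absurd he (hnew a ha h₁)
    · rw [hkey b h₂, Nat.succ_eq_add_one, Function.update_self] at he
      exact absurd he.symm (hnew b hb h₂)
    · rfl
  · intro v' u' h₁ h₂
    rw [hch v' u' h₂ (by omega)]
    exact h.fresh v' u' (by omega) h₂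

/-- The record of a block whose nonempty lines so far are `C`: its path in the trie has length
`dep` and leads to `nod`, and `las` is its last nonempty line. -/
def BlockOk (r ρ q : ℕ) (key : ℕ → Finset ℕ) (C : Finset ℕ) (dep nod las : ℕ) : Prop :=
  dep ≤ r ∧ (dep = 0 → nod = 0) ∧ ρ ≤ (if dep = 0 then ρ else nod) ∧
    (if dep = 0 then ρ else nod) ≤ q ∧ key (if dep = 0 then ρ else nod) ⊆ C ∧
    (key (if dep = 0 then ρ else nod)).card = dep ∧
    (dep < r → key (if dep = 0 then ρ else nod) = C ∧
      (C = ∅ ∧ las = 0 ∨ las ∈ C ∧ ∀ z ∈ C, z ≤ las))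

theorem BlockOk.grow {r ρ q : ℕ} {key : ℕ → Finset ℕ} {C : Finset ℕ} {dep nod las u : ℕ}
    (h : BlockOk r ρ q key C dep nod las) (hu : r ≤ dep ∨ u ∈ C) :
    BlockOk r ρ q key (insert u C) dep nod las := by
  rcases hu with hu | hu
  · obtain ⟨h₁, h₂, h₃, h₄, h₅, h₆, h₇⟩ := h
    exact ⟨h₁, h₂, h₃, h₄, h₅.trans (Finset.subset_insert _ _), h₆, fun h => absurd h (by omega)⟩
  · rwa [Finset.insert_eq_self.mpr hu]

theorem BlockOk.congr {r ρ q q' : ℕ} {key key' : ℕ → Finset ℕ} {C : Finset ℕ} {dep nod las : ℕ}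
    (h : BlockOk r ρ q key C dep nod las) (hq : q ≤ q') (hk : ∀ w, w ≤ q → key' w = key w) :
    BlockOk r ρ q' key' C dep nod las := by
  obtain ⟨h₁, h₂, h₃, h₄, h₅, h₆, h₇⟩ := h
  refine ⟨h₁, h₂, h₃, h₄.trans hq, ?_⟩
  rw [hk _ h₄]
  exact ⟨h₅, h₆, h₇⟩

/-! ### The search for wide blocks -/

/-- The lines of the block `(X, Y)` that contain one of the first `k` cells of a list. -/
def blockLines (u v a b : ℕ → ℕ) (k X Y : ℕ) : Finset ℕ :=
  ((Finset.Icc 1 k).filter fun j => a (u j) = X ∧ b (v j) = Y).image u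

theorem blockLines_succ (u v a b : ℕ → ℕ) (k X Y : ℕ) : blockLines u v a b (k + 1) X Y =
    if a (u (k + 1)) = X ∧ b (v (k + 1)) = Y then insert (u (k + 1)) (blockLines u v a b k X Y)
    else blockLines u v a b k X Y := by
  unfold blockLines
  have : Finset.Icc 1 (k + 1) = insert (k + 1) (Finset.Icc 1 k) := by
    ext j; simp only [Finset.mem_Icc, Finset.mem_insert]; omega
  rw [this, Finset.filter_insert]
  split
  · rw [Finset.image_insert]
  · rfl

theorem mem_blockLines {u v a b : ℕ → ℕ} {k X Y z : ℕ} : z ∈ blockLines u v a b k X Y ↔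
    ∃ j, 1 ≤ j ∧ j ≤ k ∧ a (u j) = X ∧ b (v j) = Y ∧ u j = z := by
  simp only [blockLines, Finset.mem_image, Finset.mem_filter, Finset.mem_Icc]
  constructor
  · rintro ⟨j, ⟨⟨h₁, h₂⟩, h₃, h₄⟩, h₅⟩; exact ⟨j, h₁, h₂, h₃, h₄, h₅⟩
  · rintro ⟨j, h₁, h₂, h₃, h₄, h₅⟩; exact ⟨j, ⟨⟨h₁, h₂⟩, h₃, h₄⟩, h₅⟩

/-- The blocks whose path ends at the leaf `w`. -/
def leafBlocks (n r t : ℕ) (dep nod : ℕ → ℕ) (w : ℕ) : Finset (ℕ × ℕ) :=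
  (Finset.range (n + 1) ×ˢ Finset.range (n + 1)).filter fun p =>
    dep (cellAddr n t p.1 p.2) = r ∧ nod (cellAddr n t p.1 p.2) = w

theorem mem_leafBlocks {n r t w : ℕ} {dep nod : ℕ → ℕ} {p : ℕ × ℕ} :
    p ∈ leafBlocks n r t dep nod w ↔ (p.1 ≤ n ∧ p.2 ≤ n) ∧
      dep (cellAddr n t p.1 p.2) = r ∧ nod (cellAddr n t p.1 p.2) = w := by
  simp [leafBlocks]

/-- The state of the search for wide blocks after `k` cells. -/
structure WideInv (n r t : ℕ) (C : ℕ → ℕ → Finset ℕ) (key : ℕ → Finset ℕ) (s : Store) :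
    Prop where
  trie : Trie n (s.var vRoot) (s.var vNodes) (s.arr aChild) (s.arr aKey) (s.arr aParent) key
  block : ∀ X Y, X ≤ n → Y ≤ n → BlockOk r (s.var vRoot) (s.var vNodes) key (C X Y)
    (s.arr aDepth (cellAddr n t X Y)) (s.arr aNode (cellAddr n t X Y))
    (s.arr aLastU (cellAddr n t X Y))
  hits : ∀ w, s.var vRoot < w →
    s.arr aHits w = (leafBlocks n r t (s.arr aDepth) (s.arr aNode) w).card
  found_le : s.var vFound ≤ 1
  few : s.var vFound = 0 → ∀ w, s.var vRoot < w → s.arr aHits w < r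
  many : s.var vFound = 1 → s.var vRoot < s.var vLeaf ∧ s.var vLeaf ≤ s.var vNodes ∧
    r ≤ s.arr aHits (s.var vLeaf) ∧
    ∃ Y, (s.var vLeafX, Y) ∈ leafBlocks n r t (s.arr aDepth) (s.arr aNode) (s.var vLeaf)
  cleanNode : Clean n t (s.arr aNode)
  cleanDepth : Clean n t (s.arr aDepth)
  cleanLast : Clean n t (s.arr aLastU)

theorem descend_ends {s : Store} {U n t X Y u nod : ℕ} (hn : s.var vLen = n)
    (ht : s.var vStamp = t) (hX : s.var vX = X) (hY : s.var vY = Y)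
    (hU : U ∉ [19, 20, 21, 22, 23, 24, 25]) (hu : s.arr U (s.var vLoop) = u)
    (hnod : nod = if s.arr aDepth (cellAddr n t X Y) = 0 then s.var vRoot
      else s.arr aNode (cellAddr n t X Y)) :
    (descend U).Ends s 200 fun s' =>
      s'.arr aLastU = Function.update (s.arr aLastU) (cellAddr n t X Y) u ∧
      s'.arr aNode = Function.update (s.arr aNode) (cellAddr n t X Y) (s'.var vNode) ∧
      s'.arr aDepth = Function.update (s.arr aDepth) (cellAddr n t X Y)
        (s.arr aDepth (cellAddr n t X Y) + 1) ∧
      (s.arr aChild (nod * (n + 1) + u) ≠ 0 ∧ s'.var vNode = s.arr aChild (nod * (n + 1) + u) ∧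
          s'.var vNodes = s.var vNodes ∧ s'.arr aChild = s.arr aChild ∧
          s'.arr aKey = s.arr aKey ∧ s'.arr aParent = s.arr aParent ∨
        s.arr aChild (nod * (n + 1) + u) = 0 ∧ s'.var vNode = s.var vNodes + 1 ∧
          s'.var vNodes = s.var vNodes + 1 ∧
          s'.arr aChild = Function.update (s.arr aChild) (nod * (n + 1) + u) (s.var vNodes + 1) ∧
          s'.arr aKey = Function.update (s.arr aKey) (s.var vNodes + 1) u ∧
          s'.arr aParent = Function.update (s.arr aParent) (s.var vNodes + 1) nod) := by
  simp only [List.mem_cons, List.not_mem_nil, or_false, not_or] at hU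
  refine Cmd.Straight.ends (by simp [descend]) (by simp [Cmd.time, Expr.cost, descend]) ?_
  obtain ⟨s', hs'⟩ : ∃ s', s' = (descend U).exec s := ⟨_, rfl⟩
  rw [← hs']
  by_cases h₁ : s.arr aDepth (cellAddr n t X Y) = 0
  · rw [if_pos h₁] at hnod
    by_cases h₂ : s.arr aChild (nod * (n + 1) + u) = 0
    · simp [hs', descend, hn, ht, hX, hY, cellAddr_fold, h₁, ← hnod, h₂, hU, hu]
    · simp [hs', descend, hn, ht, hX, hY, cellAddr_fold, h₁, ← hnod, h₂, hU, hu]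
  · rw [if_neg h₁] at hnod
    by_cases h₂ : s.arr aChild (nod * (n + 1) + u) = 0
    · simp [hs', descend, hn, ht, hX, hY, cellAddr_fold, h₁, ← hnod, h₂, hU, hu]
    · simp [hs', descend, hn, ht, hX, hY, cellAddr_fold, h₁, ← hnod, h₂, hU, hu]

theorem countLeaf_ends {s : Store} {n t r X Y : ℕ} (hn : s.var vLen = n)
    (ht : s.var vStamp = t) (hX : s.var vX = X) (hY : s.var vY = Y) (hr : s.var vGrid = r) :
    countLeaf.Ends s 100 fun s' =>
      (s.arr aDepth (cellAddr n t X Y) ≠ r → s' = s) ∧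
      (s.arr aDepth (cellAddr n t X Y) = r →
        s'.arr aHits = Function.update (s.arr aHits) (s.var vNode)
          (s.arr aHits (s.var vNode) + 1) ∧
        (s.arr aHits (s.var vNode) + 1 ≠ r → s'.var vFound = s.var vFound ∧
          s'.var vLeaf = s.var vLeaf ∧ s'.var vLeafX = s.var vLeafX) ∧
        (s.arr aHits (s.var vNode) + 1 = r → s'.var vFound = 1 ∧
          s'.var vLeaf = s.var vNode ∧ s'.var vLeafX = X)) := by
  refine Cmd.Straight.ends (by simp [countLeaf]) (by simp [Cmd.time, Expr.cost, countLeaf]) ?_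
  by_cases h₁ : s.arr aDepth (cellAddr n t X Y) = r
  · by_cases h₂ : s.arr aHits (s.var vNode) + 1 = r
    · simp [countLeaf, hn, ht, hX, hY, hr, cellAddr_fold, h₁, h₂]
    · simp [countLeaf, hn, ht, hX, hY, hr, cellAddr_fold, h₁, h₂]
  · simp [countLeaf, hn, ht, hX, hY, hr, cellAddr_fold, h₁]

theorem leafBlocks_update {n r t X Y dv nv w : ℕ} {dep nod : ℕ → ℕ} (hX : X ≤ n) (hY : Y ≤ n)
    (hd : dep (cellAddr n t X Y) ≠ r) :
    (leafBlocks n r t (Function.update dep (cellAddr n t X Y) dv)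
      (Function.update nod (cellAddr n t X Y) nv) w) =
      if dv = r ∧ nv = w then insert (X, Y) (leafBlocks n r t dep nod w)
      else leafBlocks n r t dep nod w := by
  ext ⟨X', Y'⟩
  by_cases hc : X' = X ∧ Y' = Y
  · obtain ⟨rfl, rfl⟩ := hc
    rw [mem_leafBlocks]
    simp only [Function.update_self, hX, hY, and_self, true_and]
    split_ifs with h
    · simp [h]
    · rw [mem_leafBlocks]; simp [h, hd]
  · have hne : X' ≤ n → Y' ≤ n → cellAddr n t X' Y' ≠ cellAddr n t X Y :=
      fun h₁ h₂ he => hc (cellAddr_inj h₁ hX h₂ hY he).2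
    have : (X', Y') ∈ leafBlocks n r t (Function.update dep (cellAddr n t X Y) dv)
        (Function.update nod (cellAddr n t X Y) nv) w ↔ (X', Y') ∈ leafBlocks n r t dep nod w := by
      rw [mem_leafBlocks, mem_leafBlocks]
      refine and_congr_right fun h => ?_
      simp only at h ⊢
      rw [Function.update_of_ne (hne h.1 h.2), Function.update_of_ne (hne h.1 h.2)]
    rw [this]
    split_ifs
    · rw [Finset.mem_insert, Prod.mk.injEq]; simp [hc]
    · rfl

theorem WideInv.congr_loop {n r t : ℕ} {C C' : ℕ → ℕ → Finset ℕ} {key : ℕ → Finset ℕ}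
    {s s' : Store} (h : WideInv n r t C key s) (hv : ∀ y ∈ [9, 10, 20, 22, 23],
      s'.var y = s.var y) (ha : s'.arr = s.arr)
    (hb : ∀ X Y, X ≤ n → Y ≤ n → BlockOk r (s.var vRoot) (s.var vNodes) key (C' X Y)
      (s.arr aDepth (cellAddr n t X Y)) (s.arr aNode (cellAddr n t X Y))
      (s.arr aLastU (cellAddr n t X Y))) : WideInv n r t C' key s' := by
  have v9 := hv 9 (by simp)
  have v10 := hv 10 (by simp)
  have v20 := hv 20 (by simp)
  have v22 := hv 22 (by simp)
  have v23 := hv 23 (by simp)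
  obtain ⟨h₁, h₂, h₃, h₄, h₅, h₆, h₇, h₈, h₉⟩ := h
  constructor <;> simp only [ha, v9, v10, v20, v22, v23] <;> assumption

/-- Either the record of the block stays as it is, because its path is complete or the line is
known, or the path is extended. In the latter case sortedness makes the new line larger than all
letters of the path, as the trie requires. -/
theorem wideBody_ends {s : Store} {U V LU LV n r t k : ℕ} {u v a b : ℕ → ℕ}
    {key : ℕ → Finset ℕ} (hn : s.var vLen = n) (ht : s.var vStamp = t)
    (hr : s.var vGrid = r)
    (hU : U ∉ [19, 20, 21, 22, 23, 24, 25]) (eU : s.arr U = u) (eV : s.arr V = v)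
    (eLU : s.arr LU = a) (eLV : s.arr LV = b) (hj : s.var vLoop = k + 1)
    (hu1 : 1 ≤ u (k + 1)) (hun : u (k + 1) ≤ n) (han : a (u (k + 1)) ≤ n)
    (hbn : b (v (k + 1)) ≤ n) (hs : ∀ i, 1 ≤ i → i ≤ k → u i ≤ u (k + 1))
    (hI : WideInv n r t (blockLines u v a b k) key s) :
    (wideBody U V LU LV).Ends s 400 fun s' =>
      ∃ key', WideInv n r t (blockLines u v a b (k + 1)) key' (s'.setVar vLoop (k + 2)) := by
  obtain ⟨X, hXd⟩ : ∃ X, X = a (u (k + 1)) := ⟨_, rfl⟩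
  obtain ⟨Y, hYd⟩ : ∃ Y, Y = b (v (k + 1)) := ⟨_, rfl⟩
  rw [← hXd] at han
  rw [← hYd] at hbn
  have hC : ∀ X' Y', blockLines u v a b (k + 1) X' Y' = if X = X' ∧ Y = Y' then
      insert (u (k + 1)) (blockLines u v a b k X' Y') else blockLines u v a b k X' Y' := by
    intro X' Y'; rw [blockLines_succ, ← hXd, ← hYd]
  have hCle : ∀ z ∈ blockLines u v a b k X Y, z ≤ u (k + 1) := by
    intro z hz
    obtain ⟨j, h₁, h₂, -, -, rfl⟩ := mem_blockLines.mp hz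
    exact hs j h₁ h₂
  refine Cmd.Ends.mono (T := 8 + (8 + (30 + (30 + (200 + 100))))) ?_ (by omega) (fun _ _ h => h)
  refine Cmd.Ends.then (P := fun s' => s' = s.setVar 16 X)
    (Cmd.Straight.ends (by simp) (by simp [Cmd.time, Expr.cost])
      (by simp [eLU, eU, hj, ← hXd])) ?_
  rintro s₁ - rfl
  refine Cmd.Ends.then (P := fun s' => s' = (s.setVar 16 X).setVar 17 Y)
    (Cmd.Straight.ends (by simp) (by simp [Cmd.time, Expr.cost])
      (by simp [eLV, eV, hj, ← hYd])) ?_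
  rintro s₂ - hs₂
  have w11 : s₂.var 11 = k + 1 := by simp [hs₂, hj]
  have w0 : s₂.var 0 = n := by simp [hs₂, hn]
  have w1 : s₂.var 1 = r := by simp [hs₂, hr]
  have w8 : s₂.var 8 = t := by simp [hs₂, ht]
  have w16 : s₂.var 16 = X := by simp [hs₂]
  have w17 : s₂.var 17 = Y := by simp [hs₂]
  have eU₂ : s₂.arr U = u := by simp [hs₂, eU]
  have hI₂ : WideInv n r t (blockLines u v a b k) key s₂ :=
    hI.congr_loop (by simp [hs₂]) (by simp [hs₂]) hI.block
  clear hs₂ hI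
  have hB := hI₂.block X Y han hbn
  have skip : (r ≤ s₂.arr 20 (cellAddr n t X Y) ∨ u (k + 1) ∈ blockLines u v a b k X Y) →
      WideInv n r t (blockLines u v a b (k + 1)) key (s₂.setVar vLoop (k + 2)) := by
    intro h
    refine hI₂.congr_loop (by simp) (by simp) fun X' Y' hX' hY' => ?_
    rw [hC]
    split_ifs with hc
    · obtain ⟨rfl, rfl⟩ := hc
      exact hB.grow h
    · exact hI₂.block X' Y' hX' hY'
  have skipEnds : ∀ T, 1 ≤ T → (r ≤ s₂.arr 20 (cellAddr n t X Y) ∨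
      u (k + 1) ∈ blockLines u v a b k X Y) → Cmd.skip.Ends s₂ T fun s' =>
      ∃ key', WideInv n r t (blockLines u v a b (k + 1)) key' (s'.setVar vLoop (k + 2)) :=
    fun T hT h => Cmd.Straight.ends (c := .skip) trivial hT ⟨key, skip h⟩
  refine Cmd.Ends.mono (Cmd.Ends.ite (T := 30 + (200 + 100)) ?_ ?_)
    (by simp [Expr.cost]) (fun _ _ h => h)
  · intro h
    simp [w0, w8, w16, w17, w11, eU₂, cellAddr_fold] at h
    refine skipEnds _ (by omega) ?_
    by_cases hd : r ≤ s₂.arr 20 (cellAddr n t X Y)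
    · exact .inl hd
    -- On an incomplete path the entry in `aLastU` is exact, and it is not the default 0, since
    -- lines are numbered from 1.
    · right
      rcases (hB.2.2.2.2.2.2 (by omega)).2 with h' | h'
      · omega
      · rw [h] at h'; exact h'.1
  intro h
  simp [w0, w8, w16, w17, w11, eU₂, cellAddr_fold] at h
  refine Cmd.Ends.mono (Cmd.Ends.ite (T := 200 + 100) ?_ ?_) (by simp [Expr.cost])
    (fun _ _ h => h)
  swap
  · intro h'
    simp [w0, w8, w16, w17, w1, cellAddr_fold] at h'
    exact skipEnds _ (by omega) (.inl h')
  intro h'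
  simp [w0, w8, w16, w17, w1, cellAddr_fold] at h'
  obtain ⟨hkC, hlast⟩ := hB.2.2.2.2.2.2 h'
  obtain ⟨nod, hnod⟩ : ∃ nod, nod = if s₂.arr aDepth (cellAddr n t X Y) = 0 then s₂.var vRoot
      else s₂.arr aNode (cellAddr n t X Y) := ⟨_, rfl⟩
  have hnρ : s₂.var vRoot ≤ nod := by rw [hnod]; exact hB.2.2.1
  have hnq : nod ≤ s₂.var vNodes := by rw [hnod]; exact hB.2.2.2.1
  have hcard : (key nod).card = s₂.arr 20 (cellAddr n t X Y) := by
    rw [hnod]; exact hB.2.2.2.2.2.1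
  rw [← hnod] at hkC
  -- Equality would make `u (k + 1)` the last recorded line of the block, which the test has
  -- excluded.
  have hlt : ∀ z ∈ key nod, z < u (k + 1) := by
    rw [hkC]
    intro z hz
    refine lt_of_le_of_ne (hCle z hz) ?_
    rintro rfl
    rcases hlast with h₁ | h₁
    · rw [h₁.1] at hz; simp at hz
    · have h₂ := h₁.2 _ hz
      have h₃ := hCle _ h₁.1
      omega
  refine Cmd.Ends.then (descend_ends w0 w8 w16 w17 hU (u := u (k + 1)) (by rw [w11, eU₂]) hnod) ?_
  rintro s₃ hf₃ ⟨d21, d19, d20, dch⟩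
  have x0 : s₃.var 0 = n := by rw [hf₃.1 0 (by simp [descend]), w0]
  have x8 : s₃.var 8 = t := by rw [hf₃.1 8 (by simp [descend]), w8]
  have x16 : s₃.var 16 = X := by rw [hf₃.1 16 (by simp [descend]), w16]
  have x17 : s₃.var 17 = Y := by rw [hf₃.1 17 (by simp [descend]), w17]
  have x1 : s₃.var 1 = r := by rw [hf₃.1 1 (by simp [descend]), w1]
  have x20 : s₃.var 20 = s₂.var 20 := hf₃.1 20 (by simp [descend])
  have x9 : s₃.var 9 = s₂.var 9 := hf₃.1 9 (by simp [descend])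
  have x22 : s₃.var 22 = s₂.var 22 := hf₃.1 22 (by simp [descend])
  have x23 : s₃.var 23 = s₂.var 23 := hf₃.1 23 (by simp [descend])
  have x25 : s₃.arr 25 = s₂.arr 25 := hf₃.2 25 (by simp [descend])
  -- the trie after the step
  obtain ⟨key', hT', hq', hkey', hwρ, hwq, hkw⟩ : ∃ key' : ℕ → Finset ℕ,
      Trie n (s₃.var 20) (s₃.var 10) (s₃.arr 22) (s₃.arr 23) (s₃.arr 24) key' ∧
      s₂.var 10 ≤ s₃.var 10 ∧ (∀ w, w ≤ s₂.var 10 → key' w = key w) ∧ s₃.var 20 < s₃.var 21 ∧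
      s₃.var 21 ≤ s₃.var 10 ∧ key' (s₃.var 21) = insert (u (k + 1)) (key nod) := by
    rw [x20]
    rcases dch with ⟨c₁, c₂, c₃, c₄, c₅, c₆⟩ | ⟨c₁, c₂, c₃, c₄, c₅, c₆⟩
    · obtain ⟨e₁, e₂, e₃, e₄⟩ := hI₂.trie.child nod (u (k + 1)) hnρ hnq hun c₁
      rw [← c₂] at e₁ e₂ e₃ e₄
      refine ⟨key, by rw [c₃, c₄, c₅, c₆]; exact hI₂.trie, c₃.ge, fun _ _ => rfl, e₁,
        by rw [c₃]; exact e₂, ?_⟩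
      have := (hI₂.trie.node _ e₁ e₂).2.2.2.2.2.1
      rwa [e₃, e₄] at this
    · refine ⟨_, by rw [c₃, c₄, c₅, c₆]; exact hI₂.trie.insert hnρ hnq hu1 hun hlt c₁, by omega,
        fun w hw => Function.update_of_ne (show w ≠ s₂.var 10 + 1 by omega) _ _, ?_, by omega, ?_⟩
      · have := hI₂.trie.le; omega
      · rw [c₂, Function.update_self]
  have huC : u (k + 1) ∉ key nod := fun h => lt_irrefl _ (hlt _ h)
  have hblock : ∀ X' Y', X' ≤ n → Y' ≤ n → BlockOk r (s₃.var vRoot) (s₃.var vNodes) key'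
      (blockLines u v a b (k + 1) X' Y') (s₃.arr aDepth (cellAddr n t X' Y'))
      (s₃.arr aNode (cellAddr n t X' Y')) (s₃.arr aLastU (cellAddr n t X' Y')) := by
    intro X' Y' hX' hY'
    rw [hC, d19, d20, d21]
    by_cases hc : X = X' ∧ Y = Y'
    · obtain ⟨rfl, rfl⟩ := hc
      simp only [and_self, if_true, Function.update_self]
      refine ⟨by omega, by omega, ?_, ?_, ?_, ?_, ?_⟩ <;> simp only [Nat.succ_ne_zero, if_false]
      · exact hwρ.le
      · exact hwq
      · rw [hkw, hkC]
      · rw [hkw, Finset.card_insert_of_notMem huC, hcard]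
      · intro _
        refine ⟨by rw [hkw, hkC], .inr ⟨Finset.mem_insert_self _ _, fun z hz => ?_⟩⟩
        rcases Finset.mem_insert.mp hz with rfl | hz
        · exact le_rfl
        · exact hCle z hz
    · have hne : cellAddr n t X' Y' ≠ cellAddr n t X Y := by
        intro he
        have := (cellAddr_inj hX' han hY' hbn he).2
        exact hc ⟨this.1.symm, this.2.symm⟩
      rw [if_neg hc, Function.update_of_ne hne, Function.update_of_ne hne,
        Function.update_of_ne hne, x20]
      exact (hI₂.block X' Y' hX' hY').congr hq' hkey'
  have hd : s₂.arr 20 (cellAddr n t X Y) ≠ r := by omega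
  have hLB : ∀ w, leafBlocks n r t (s₃.arr 20) (s₃.arr 19) w =
      if s₂.arr 20 (cellAddr n t X Y) + 1 = r ∧ s₃.var 21 = w then
        insert (X, Y) (leafBlocks n r t (s₂.arr 20) (s₂.arr 19) w)
      else leafBlocks n r t (s₂.arr 20) (s₂.arr 19) w := by
    intro w
    rw [d19, d20]
    exact leafBlocks_update han hbn hd
  -- Before this step the path of the block had length below `r`, so the block has not been counted
  -- at any leaf.
  have hXY : ∀ w, (X, Y) ∉ leafBlocks n r t (s₂.arr 20) (s₂.arr 19) w := by
    intro w hw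
    exact hd (mem_leafBlocks.mp hw).2.1
  have hd' : s₃.arr 20 (cellAddr n t X Y) = s₂.arr 20 (cellAddr n t X Y) + 1 := by
    rw [d20, Function.update_self]
  have c19 : Clean n t (s₃.arr 19) := by rw [d19]; exact hI₂.cleanNode.update han hbn _
  have c20 : Clean n t (s₃.arr 20) := by rw [d20]; exact hI₂.cleanDepth.update han hbn _
  have c21 : Clean n t (s₃.arr 21) := by rw [d21]; exact hI₂.cleanLast.update han hbn _
  refine Cmd.Ends.mono (countLeaf_ends x0 x8 x16 x17 x1) le_rfl ?_
  rintro s₄ hf₄ ⟨k₁, k₂⟩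
  refine ⟨key', ?_⟩
  by_cases hdr : s₂.arr 20 (cellAddr n t X Y) + 1 = r
  · obtain ⟨y25, yn, yy⟩ := k₂ (by rw [hd', hdr])
    have y20 : s₄.var 20 = s₃.var 20 := hf₄.1 20 (by simp [countLeaf])
    have y10 : s₄.var 10 = s₃.var 10 := hf₄.1 10 (by simp [countLeaf])
    have z19 : s₄.arr 19 = s₃.arr 19 := hf₄.2 19 (by simp [countLeaf])
    have z20 : s₄.arr 20 = s₃.arr 20 := hf₄.2 20 (by simp [countLeaf])
    have z21 : s₄.arr 21 = s₃.arr 21 := hf₄.2 21 (by simp [countLeaf])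
    have z22 : s₄.arr 22 = s₃.arr 22 := hf₄.2 22 (by simp [countLeaf])
    have z23 : s₄.arr 23 = s₃.arr 23 := hf₄.2 23 (by simp [countLeaf])
    have z24 : s₄.arr 24 = s₃.arr 24 := hf₄.2 24 (by simp [countLeaf])
    have hhits : ∀ w, s₃.var 20 < w →
        s₄.arr 25 w = (leafBlocks n r t (s₃.arr 20) (s₃.arr 19) w).card := by
      intro w hw
      rw [x20] at hw
      rw [hLB, y25, x25]
      by_cases hwc : s₃.var 21 = w
      · subst hwc
        rw [if_pos ⟨hdr, rfl⟩, Finset.card_insert_of_notMem (hXY _), Function.update_self,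
          hI₂.hits _ hw]
      · rw [if_neg (fun h => hwc h.2), Function.update_of_ne (Ne.symm hwc), hI₂.hits _ hw]
    refine WideInv.congr_loop (s := s₄) (C := blockLines u v a b (k + 1)) ?_ (by simp) (by simp) ?_
    swap
    · rw [y20, y10, z19, z20, z21]; exact hblock
    constructor
    · rw [y20, y10, z22, z23, z24]; exact hT'
    · rw [y20, y10, z19, z20, z21]; exact hblock
    · rw [y20, z19, z20]; exact hhits
    · by_cases h25 : s₃.arr 25 (s₃.var 21) + 1 = r
      · rw [(yy h25).1]
      · rw [(yn h25).1, x9]; exact hI₂.found_le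
    · intro hf w hw
      rw [y20] at hw
      by_cases h25 : s₃.arr 25 (s₃.var 21) + 1 = r
      · rw [(yy h25).1] at hf; omega
      · rw [(yn h25).1, x9] at hf
        rw [y25]
        by_cases hwc : w = s₃.var 21
        · subst hwc
          rw [Function.update_self]
          have := hI₂.few hf (s₃.var 21) (by rwa [← x20])
          rw [x25] at h25 ⊢
          omega
        · rw [Function.update_of_ne hwc, x25]
          exact hI₂.few hf w (by rwa [← x20])
    · intro hf
      rw [y20, y10, z19, z20]
      -- A leaf that reaches `r` hits later replaces the one found before. If there is none, the
      -- earlier leaf remains valid, because sets of blocks at leaves only grow.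
      by_cases h25 : s₃.arr 25 (s₃.var 21) + 1 = r
      · obtain ⟨e₁, e₂, e₃⟩ := yy h25
        rw [e₂, e₃]
        refine ⟨hwρ, hwq, by rw [y25, Function.update_self]; omega, Y, ?_⟩
        rw [hLB, if_pos ⟨hdr, rfl⟩]
        exact Finset.mem_insert_self _ _
      · obtain ⟨e₁, e₂, e₃⟩ := yn h25
        rw [e₁, x9] at hf
        obtain ⟨m₁, m₂, m₃, Y', m₄⟩ := hI₂.many hf
        rw [e₂, e₃, x22, x23]
        refine ⟨by rwa [x20], m₂.trans hq', ?_, Y', ?_⟩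
        · rw [hhits _ (by rwa [x20]), hLB]
          rw [hI₂.hits _ m₁] at m₃
          split_ifs
          · exact m₃.trans (Finset.card_le_card (Finset.subset_insert _ _))
          · exact m₃
        · rw [hLB]
          split_ifs
          · exact Finset.mem_insert_of_mem m₄
          · exact m₄
    · rw [z19]; exact c19
    · rw [z20]; exact c20
    · rw [z21]; exact c21
  · have := k₁ (by rw [hd']; exact hdr)
    subst this
    have hLB' : ∀ w, leafBlocks n r t (s₄.arr 20) (s₄.arr 19) w =
        leafBlocks n r t (s₂.arr 20) (s₂.arr 19) w := by
      intro w; rw [hLB, if_neg (fun h => hdr h.1)]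
    refine WideInv.congr_loop (s := s₄) (C := blockLines u v a b (k + 1)) ?_ (by simp) (by simp)
      hblock
    refine ⟨hT', hblock, ?_, by rw [x9]; exact hI₂.found_le, ?_, ?_, c19, c20, c21⟩
    · intro w hw
      rw [x20] at hw
      rw [hLB', x25, hI₂.hits w hw]
    · rw [x9, x20, x25]; exact hI₂.few
    · rw [x9, x20, x25, x22, x23]
      intro hf
      obtain ⟨m₁, m₂, m₃, Y', m₄⟩ := hI₂.many hf
      exact ⟨m₁, m₂.trans hq', m₃, Y', by rw [hLB']; exact m₄⟩

/-- The node `vLeaf` of the trie stands for `r` lines, and at least `r` blocks in the block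
column `vLeafX` contain cells in all of these lines. -/
def LeafInfo (n r t : ℕ) (C : ℕ → ℕ → Finset ℕ) (s : Store) : Prop :=
  ∃ ρ q key, Trie n ρ q (s.arr aChild) (s.arr aKey) (s.arr aParent) key ∧ ρ < s.var vLeaf ∧
    s.var vLeaf ≤ q ∧ (key (s.var vLeaf)).card = r ∧
    (∃ W : Finset ℕ, r ≤ W.card ∧ ∀ Y ∈ W, Y ≤ n ∧
      s.arr aNode (cellAddr n t (s.var vLeafX) Y) = s.var vLeaf) ∧
    ∀ Y, Y ≤ n → s.arr aNode (cellAddr n t (s.var vLeafX) Y) = s.var vLeaf →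
      key (s.var vLeaf) ⊆ C (s.var vLeafX) Y

/-- Above the node `q`, the tables of the trie are zero. -/
def FreshTrie (n q : ℕ) (ch hits : ℕ → ℕ) : Prop :=
  (∀ w x, q < w → x ≤ n → ch (w * (n + 1) + x) = 0) ∧ ∀ w, q < w → hits w = 0

theorem WideInv.depth_eq {n r t : ℕ} {C : ℕ → ℕ → Finset ℕ} {key : ℕ → Finset ℕ}
    {s : Store} (h : WideInv n r t C key s) (hr : 1 ≤ r) {X Y : ℕ} (hX : X ≤ n) (hY : Y ≤ n)
    (hd : s.arr aDepth (cellAddr n t X Y) = r) :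
    s.var vRoot < s.arr aNode (cellAddr n t X Y) ∧
      s.arr aNode (cellAddr n t X Y) ≤ s.var vNodes ∧
      key (s.arr aNode (cellAddr n t X Y)) ⊆ C X Y ∧
      (key (s.arr aNode (cellAddr n t X Y))).card = r := by
  have hb := h.block X Y hX hY
  rw [hd] at hb
  unfold BlockOk at hb
  rw [if_neg (by omega)] at hb
  obtain ⟨-, -, h₃, h₄, h₅, h₆, -⟩ := hb
  refine ⟨lt_of_le_of_ne h₃ fun he => ?_, h₄, h₅, h₆⟩
  rw [← he, h.trie.root] at h₆
  simp at h₆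
  omega

/-- Pigeonhole. A wide block has a complete path, whose leaf stands for an `r`-subset of the at most
`r ^ 2` lines of its block column. Distinct leaves stand for distinct subsets, and without success
each leaf has been hit fewer than `r` times. -/
theorem WideInv.card_wide_le {n r t N M K : ℕ} {u v a b : ℕ → ℕ} {key : ℕ → Finset ℕ}
    {s : Store} (h : WideInv n r t (blockLines u v a b N) key s) (hr : 1 ≤ r)
    (hf : s.var vFound = 0) (hu : ∀ j, 1 ≤ j → j ≤ N → 1 ≤ u j ∧ u j ≤ M)
    (han : ∀ j, 1 ≤ j → j ≤ N → a (u j) ≤ n)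
    (hcol : ∀ X, ((Finset.Icc 1 M).filter fun x => a x = X).card ≤ r ^ 2) (hK : K ≤ n) (X : ℕ) :
    ((Finset.Icc 1 K).filter fun Y => r ≤ (blockLines u v a b N X Y).card).card ≤
      (r - 1) * (r ^ 2).choose r := by
  by_cases hX : X ≤ n
  · set W := (Finset.Icc 1 K).filter fun Y => r ≤ (blockLines u v a b N X Y).card with hW
    have hd : ∀ Y ∈ W, Y ≤ n ∧ s.arr aDepth (cellAddr n t X Y) = r := by
      intro Y hY
      simp only [hW, Finset.mem_filter, Finset.mem_Icc] at hY
      refine ⟨by omega, ?_⟩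
      obtain ⟨h₁, -, -, -, -, h₆, h₇⟩ := h.block X Y hX (by omega)
      -- The key of an incomplete path consists of all lines of the block, of which there are at
      -- least `r`, although the path is shorter than `r`.
      by_contra hne
      rw [(h₇ (by omega)).1] at h₆
      omega
    have hf₁ : W.card ≤ (r - 1) * (W.image fun Y => s.arr aNode (cellAddr n t X Y)).card := by
      refine Finset.card_le_mul_card_image _ _ fun w hw => ?_
      obtain ⟨Y, hY, rfl⟩ := Finset.mem_image.mp hw
      have hρ := (h.depth_eq hr hX (hd Y hY).1 (hd Y hY).2).1
      have hlt := h.few hf _ hρ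
      rw [h.hits _ hρ] at hlt
      refine (Finset.card_le_card_of_injOn (fun Z => (X, Z)) ?_ ?_).trans (Nat.le_sub_one_of_lt hlt)
      · intro Z hZ
        simp only [Finset.coe_filter, Set.mem_ofPred_eq] at hZ
        exact mem_leafBlocks.mpr ⟨⟨hX, (hd Z hZ.1).1⟩, (hd Z hZ.1).2, hZ.2⟩
      · intro Z _ Z' _ he
        exact (Prod.mk.inj he).2
    refine hf₁.trans (Nat.mul_le_mul_left _ ?_)
    have hf₂ : (W.image fun Y => s.arr aNode (cellAddr n t X Y)).card ≤
        (((Finset.Icc 1 M).filter fun x => a x = X).powersetCard r).card := by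
      refine Finset.card_le_card_of_injOn key ?_ ?_
      · intro w hw
        obtain ⟨Y, hY, rfl⟩ := Finset.mem_image.mp hw
        obtain ⟨-, -, h₃, h₄⟩ := h.depth_eq hr hX (hd Y hY).1 (hd Y hY).2
        refine Finset.mem_powersetCard.mpr ⟨fun z hz => ?_, h₄⟩
        obtain ⟨j, hj₁, hj₂, hj₃, -, rfl⟩ := mem_blockLines.mp (h₃ hz)
        simp only [Finset.mem_filter, Finset.mem_Icc]
        exact ⟨hu j hj₁ hj₂, hj₃⟩
      · intro w hw w' hw' he
        obtain ⟨Y, hY, rfl⟩ := Finset.mem_image.mp hw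
        obtain ⟨Y', hY', rfl⟩ := Finset.mem_image.mp hw'
        obtain ⟨h₁, h₂, -, -⟩ := h.depth_eq hr hX (hd Y hY).1 (hd Y hY).2
        obtain ⟨h₁', h₂', -, -⟩ := h.depth_eq hr hX (hd Y' hY').1 (hd Y' hY').2
        exact h.trie.inj _ _ h₁.le h₂ h₁'.le h₂' he
    rw [Finset.card_powersetCard] at hf₂
    exact hf₂.trans (Nat.choose_le_choose r (hcol X))
  · have : ((Finset.Icc 1 K).filter fun Y => r ≤ (blockLines u v a b N X Y).card) = ∅ := by
      refine Finset.filter_eq_empty_iff.mpr fun Y _ hc => ?_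
      have hne : (blockLines u v a b N X Y).Nonempty := Finset.card_pos.mp (by omega)
      obtain ⟨z, hz⟩ := hne
      obtain ⟨j, h₁, h₂, h₃, -⟩ := mem_blockLines.mp hz
      have := han j h₁ h₂
      omega
    rw [this]
    simp

/-- All block columns share one trie, but a line `z` of the key lies in the block column `a z` only.
As `r ≥ 1`, there is such a line, so all blocks at the leaf belong to one block column. -/
theorem WideInv.leafInfo {n r t N : ℕ} {u v a b : ℕ → ℕ} {key : ℕ → Finset ℕ}
    {s : Store} (h : WideInv n r t (blockLines u v a b N) key s) (hr : 1 ≤ r)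
    (hf : s.var vFound = 1) : LeafInfo n r t (blockLines u v a b N) s := by
  obtain ⟨m₁, m₂, m₃, Y₀, m₄⟩ := h.many hf
  rw [h.hits _ m₁] at m₃
  rw [mem_leafBlocks] at m₄
  obtain ⟨⟨hX, hY₀⟩, hd₀, hn₀⟩ := m₄
  have h₀ := h.depth_eq hr hX hY₀ hd₀
  rw [hn₀] at h₀
  obtain ⟨-, -, hk₀, hcard⟩ := h₀
  obtain ⟨z, hz⟩ : (key (s.var vLeaf)).Nonempty := Finset.card_pos.mp (by omega)
  obtain ⟨j₀, -, -, hj₀, -, hj₀'⟩ := mem_blockLines.mp (hk₀ hz)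
  have hρ : s.var vLeaf ≠ 0 := by omega
  refine ⟨_, _, key, h.trie, m₁, m₂, hcard, ⟨(leafBlocks n r t (s.arr aDepth) (s.arr aNode)
    (s.var vLeaf)).image Prod.snd, ?_, ?_⟩, ?_⟩
  · rw [Finset.card_image_of_injOn]
    · exact m₃
    · have key' : ∀ p ∈ leafBlocks n r t (s.arr aDepth) (s.arr aNode) (s.var vLeaf),
          p.1 = a z := by
        intro p hp
        rw [mem_leafBlocks] at hp
        have h₁ := (h.depth_eq hr hp.1.1 hp.1.2 hp.2.1).2.2.1
        rw [hp.2.2] at h₁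
        obtain ⟨j, -, -, hj, -, hj'⟩ := mem_blockLines.mp (h₁ hz)
        rw [← hj, hj']
      intro p hp p' hp' he
      exact Prod.ext ((key' p hp).trans (key' p' hp').symm) he
  · intro Y hY
    obtain ⟨p, hp, rfl⟩ := Finset.mem_image.mp hY
    rw [mem_leafBlocks] at hp
    have h₁ := (h.depth_eq hr hp.1.1 hp.1.2 hp.2.1).2.2.1
    rw [hp.2.2] at h₁
    obtain ⟨j, -, -, hj, -, hj'⟩ := mem_blockLines.mp (h₁ hz)
    simp only at hX hY₀
    have : s.var vLeafX = p.1 := by rw [← hj, hj', ← hj₀', hj₀]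
    rw [this]
    exact ⟨hp.1.2, hp.2.2⟩
  · intro Y hY hnY
    obtain ⟨h₁, h₂, h₃, h₄, h₅, h₆, h₇⟩ := h.block (s.var vLeafX) Y hX hY
    -- The node entry of a block of depth 0 is 0, which is not the leaf. Hence it suffices to
    -- compare entries of `aNode`, without regard to depths.
    have hd : s.arr aDepth (cellAddr n t (s.var vLeafX) Y) ≠ 0 := fun hd => by
      have := h₂ hd; omega
    rw [if_neg hd, hnY] at h₅
    exact h₅

/-- The root lies above all nodes used so far and the stamp is later than `t₀`, so the tables of the
trie and of the blocks are still zero where this search uses them. -/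
theorem wide_ends {s : Store} {U V LU LV n r t N M Mv K : ℕ} {u v a b : ℕ → ℕ} (hr1 : 1 ≤ r)
    (hn : s.var vLen = n) (ht : s.var vStamp = t) (hr : s.var vGrid = r) (hN : s.var vCells = N)
    (hf : s.var vFound = 0) (hU : U ∉ [19, 20, 21, 22, 23, 24, 25])
    (hV : V ∉ [19, 20, 21, 22, 23, 24, 25]) (hLU : LU ∉ [19, 20, 21, 22, 23, 24, 25])
    (hLV : LV ∉ [19, 20, 21, 22, 23, 24, 25]) (eU : s.arr U = u) (eV : s.arr V = v)
    (eLU : s.arr LU = a) (eLV : s.arr LV = b)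
    (hu : ∀ j, 1 ≤ j → j ≤ N → 1 ≤ u j ∧ u j ≤ M) (hv : ∀ j, 1 ≤ j → j ≤ N → 1 ≤ v j ∧ v j ≤ Mv)
    (hM : M ≤ n) (hMv : Mv ≤ n) {M' : ℕ} (ha : Coarsening M M' a) (hb : Coarsening Mv K b)
    (hs : ∀ i j, 1 ≤ i → i ≤ j → j ≤ N → u i ≤ u j)
    (hcol : ∀ X, ((Finset.Icc 1 M).filter fun x => a x = X).card ≤ r ^ 2)
    (hfresh : FreshTrie n (s.var vNodes) (s.arr aChild) (s.arr aHits))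
    {t₀ : ℕ} (htt : t₀ < t) (c19 : Clean n t₀ (s.arr aNode)) (c20 : Clean n t₀ (s.arr aDepth))
    (c21 : Clean n t₀ (s.arr aLastU)) :
    (wide U V LU LV).Ends s (500 * N + 500) fun s' =>
      FreshTrie n (s'.var vNodes) (s'.arr aChild) (s'.arr aHits) ∧
      (Clean n t (s'.arr aNode) ∧ Clean n t (s'.arr aDepth) ∧ Clean n t (s'.arr aLastU)) ∧
      (s'.var vFound = 0 ∧ (∀ X, ((Finset.Icc 1 K).filter fun Y => r ≤
          (blockLines u v a b N X Y).card).card ≤ (r - 1) * (r ^ 2).choose r) ∨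
        s'.var vFound = 1 ∧ LeafInfo n r t (blockLines u v a b N) s') := by
  have hX : ∀ j, 1 ≤ j → j ≤ N → a (u j) ≤ n := fun j h₁ h₂ =>
    (ha.le_self (hu j h₁ h₂).1 (hu j h₁ h₂).2).trans ((hu j h₁ h₂).2.trans hM)
  have hY : ∀ j, 1 ≤ j → j ≤ N → b (v j) ≤ n := fun j h₁ h₂ =>
    (hb.le_self (hv j h₁ h₂).1 (hv j h₁ h₂).2).trans ((hv j h₁ h₂).2.trans hMv)
  have hKn : K ≤ n := by
    rw [← hb.last]; exact (hb.le_self hb.pos le_rfl).trans hMv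
  refine Cmd.Ends.mono (T := 10 + (10 + (N * (400 + 10) + 10))) ?_ (by omega) (fun _ _ h => h)
  refine Cmd.Ends.then (P := fun s' => s' = s.setVar 10 (s.var 10 + 1))
    (Cmd.Straight.ends (by simp) (by simp [Cmd.time, Expr.cost]) (by simp)) ?_
  rintro s₁ - rfl
  refine Cmd.Ends.then (P := fun s' => s' =
    (s.setVar 10 (s.var 10 + 1)).setVar 20 (s.var 10 + 1))
    (Cmd.Straight.ends (by simp) (by simp [Cmd.time, Expr.cost]) (by simp)) ?_
  rintro s₂ - hs₂
  have hwv : ∀ y, y ∉ [9, 10, 11, 16, 17, 21, 22, 23] →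
      y ∉ (Cmd.forUp vLoop vCells (wideBody U V LU LV)).wv := by
    intro y hy
    simp only [List.mem_cons, List.not_mem_nil, or_false, not_or] at hy
    simp [wideBody, descend, countLeaf, hy]
  have hwa : ∀ y, y ∉ [19, 20, 21, 22, 23, 24, 25] →
      y ∉ (Cmd.forUp vLoop vCells (wideBody U V LU LV)).wa := by
    intro y hy
    simp only [List.mem_cons, List.not_mem_nil, or_false, not_or] at hy
    simp [wideBody, descend, countLeaf, hy]
  refine Cmd.Ends.mono (Cmd.Ends.forUp (n := N) (T := 400)
    (fun k s' => ∃ key, WideInv n r t (blockLines u v a b k) key s') (by simp [hs₂, hN])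
    (by simp) (by simp [wideBody, descend, countLeaf]) (by simp [wideBody, descend, countLeaf])
    ?_ ?_) le_rfl ?_
  · refine ⟨fun _ => ∅, ⟨⟨rfl, by simp [hs₂], ?_, ?_, ?_, ?_⟩, ?_, ?_, by simp [hs₂, hf], ?_, ?_,
      ?_, ?_, ?_⟩⟩
    · intro w x h₁ h₂ h₃ h₄
      simp [hs₂] at h₁ h₂ h₄
      exact absurd (hfresh.1 w x (by omega) h₃) h₄
    · intro w h₁ h₂
      simp [hs₂] at h₁ h₂
      omega
    · intro w w' h₁ h₂ h₃ h₄ _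
      simp [hs₂] at h₁ h₂ h₃ h₄
      omega
    · intro w x h₁ h₂
      simp [hs₂] at h₁ ⊢
      exact hfresh.1 w x (by omega) h₂
    · intro X Y h₁ h₂
      have z19 := c19 t X Y htt h₁ h₂
      have z20 := c20 t X Y htt h₁ h₂
      have z21 := c21 t X Y htt h₁ h₂
      simp [BlockOk, hs₂, z19, z20, z21, blockLines]
    · intro w hw
      simp [hs₂] at hw ⊢
      rw [hfresh.2 w (by omega)]
      symm
      rw [Finset.card_eq_zero, Finset.eq_empty_iff_forall_notMem]
      intro p hp
      rw [mem_leafBlocks] at hp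
      have := c20 t p.1 p.2 htt hp.1.1 hp.1.2
      omega
    · intro _ w hw
      simp [hs₂] at hw ⊢
      rw [hfresh.2 w (by omega)]
      exact hr1
    · intro h
      simp [hs₂, hf] at h
    · simpa [hs₂] using c19.mono htt.le
    · simpa [hs₂] using c20.mono htt.le
    · simpa [hs₂] using c21.mono htt.le
  · rintro k hk s' hf' hj ⟨key, hI⟩
    refine wideBody_ends (by rw [hf'.1 0 (hwv 0 (by simp))]; simp [hs₂, hn])
      (by rw [hf'.1 8 (hwv 8 (by simp))]; simp [hs₂, ht])
      (by rw [hf'.1 1 (hwv 1 (by simp))]; simp [hs₂, hr]) hU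
      (by rw [hf'.2 U (hwa U hU)]; simp [hs₂, eU]) (by rw [hf'.2 V (hwa V hV)]; simp [hs₂, eV])
      (by rw [hf'.2 LU (hwa LU hLU)]; simp [hs₂, eLU])
      (by rw [hf'.2 LV (hwa LV hLV)]; simp [hs₂, eLV]) hj (hu (k + 1) (by omega) hk).1
      ((hu (k + 1) (by omega) hk).2.trans hM) (hX (k + 1) (by omega) hk)
      (hY (k + 1) (by omega) hk) (fun i h₁ h₂ => hs i (k + 1) h₁ (by omega) hk) hI
  · rintro s' - ⟨key, hI⟩
    refine ⟨⟨hI.trie.fresh, fun w hw => ?_⟩, ⟨hI.cleanNode, hI.cleanDepth, hI.cleanLast⟩, ?_⟩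
    · rw [hI.hits w (by have := hI.trie.le; omega), Finset.card_eq_zero,
        Finset.eq_empty_iff_forall_notMem]
      intro p hp
      rw [mem_leafBlocks] at hp
      have := (hI.depth_eq hr1 hp.1.1 hp.1.2 hp.2.1).2.1
      omega
    · have := hI.found_le
      by_cases h0 : s'.var 9 = 0
      · exact .inl ⟨h0, hI.card_wide_le hr1 h0 hu hX hcol hKn⟩
      · have h1 : s'.var 9 = 1 := by omega
        exact .inr ⟨h1, hI.leafInfo hr1 h1⟩

/-! ### Breakpoints of a grid -/

/-- The arrays `x`, `y` hold the breakpoints of an `r × r`-grid in the set `S` of cells. -/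
structure GridBreaks (r m₀ m₁ : ℕ) (S : Finset (ℕ × ℕ)) (x y : ℕ → ℕ) : Prop where
  one_x : 1 ≤ x 1
  one_y : 1 ≤ y 1
  lt_x : ∀ i, 1 ≤ i → i ≤ r → x i < x (i + 1)
  lt_y : ∀ i, 1 ≤ i → i ≤ r → y i < y (i + 1)
  last_x : x (r + 1) = m₀ + 1
  last_y : y (r + 1) = m₁ + 1
  cell : ∀ i j, 1 ≤ i → i ≤ r → 1 ≤ j → j ≤ r → ∃ p ∈ S, (x i ≤ p.1 ∧ p.1 < x (i + 1)) ∧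
    y j ≤ p.2 ∧ p.2 < y (j + 1)

theorem GridBreaks.swap {r m₀ m₁ : ℕ} {S : Finset (ℕ × ℕ)} {x y : ℕ → ℕ}
    (h : GridBreaks r m₀ m₁ (S.image Prod.swap) x y) : GridBreaks r m₁ m₀ S y x where
  one_x := h.one_y
  one_y := h.one_x
  lt_x := h.lt_y
  lt_y := h.lt_x
  last_x := h.last_y
  last_y := h.last_x
  cell i j h₁ h₂ h₃ h₄ := by
    obtain ⟨p, hp, h₅, h₆⟩ := h.cell j i h₃ h₄ h₁ h₂
    obtain ⟨q, hq, rfl⟩ := Finset.mem_image.mp hp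
    exact ⟨q, hq, h₆, h₅⟩

theorem Coarsening.exists_start {m m' : ℕ} {φ : ℕ → ℕ} (h : Coarsening m m' φ) {X : ℕ}
    (hX : 1 ≤ X) (hXm : X ≤ m') : ∃ x, 1 ≤ x ∧ x ≤ m ∧ φ x = X ∧ φ (x - 1) < φ x := by
  have hex : ∃ x, 1 ≤ x ∧ x ≤ m ∧ φ x = X := h.surj hX hXm
  classical
  obtain ⟨h₁, h₂, h₃⟩ := Nat.find_spec hex
  refine ⟨Nat.find hex, h₁, h₂, h₃, ?_⟩
  rcases Nat.eq_or_lt_of_le h₁ with he | hlt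
  · rw [← he]; simp [h.zero, h.one]
  · have hmin := Nat.find_min hex (m := Nat.find hex - 1) (by omega)
    have hs := h.step (Nat.find hex - 1) (by omega) (by omega)
    rw [Nat.sub_add_cancel h₁] at hs
    have : φ (Nat.find hex - 1) ≠ X := fun he => hmin ⟨by omega, by omega, he⟩
    omega

/-- In one direction the breakpoints are the lines of the key, in the other the first lines of `r`
blocks at the leaf. The strip that starts at a key line contains this line, the strip that starts
with a block contains the whole block, and each such block has a cell in each line of the key. -/
theorem extract_ends {s : Store} {BU BV LV mu mv n r t N M Mv K : ℕ} {u v a b : ℕ → ℕ}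
    {S : Finset (ℕ × ℕ)} (hr1 : 1 ≤ r)
    (hn : s.var vLen = n) (ht : s.var vStamp = t) (hr : s.var vGrid = r) (hM : s.var mu = M)
    (hMv : s.var mv = Mv) (hmu : mu ∉ [11, 15, 21]) (hmv : mv ∉ [11, 15, 21])
    (hBU : BU ∉ [19, 23, 24, LV]) (hBV : BV ∉ [19, 23, 24, LV, BU]) (eLV : s.arr LV = b)
    (hl : IsList N u v S) (hS : ∀ p ∈ S, (1 ≤ p.1 ∧ p.1 ≤ M) ∧ 1 ≤ p.2 ∧ p.2 ≤ Mv)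
    (hMvn : Mv ≤ n) (hb : Coarsening Mv K b) (hI : LeafInfo n r t (blockLines u v a b N) s) :
    (extract BU BV LV mu mv).Ends s (200 * (r + Mv) + 200) fun s' =>
      GridBreaks r M Mv S (s'.arr BU) (s'.arr BV) := by
  simp only [List.mem_cons, List.not_mem_nil, or_false, not_or] at hBU hBV hmu hmv
  obtain ⟨ρ, q, key, hT, hρ, hq, hcard, ⟨W, hW, hWm⟩, hsub⟩ := hI
  obtain ⟨leaf, hleaf⟩ : ∃ l, l = s.var vLeaf := ⟨_, rfl⟩
  obtain ⟨X, hX⟩ : ∃ l, l = s.var vLeafX := ⟨_, rfl⟩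
  rw [← hleaf] at hρ hq hcard hWm hsub
  rw [← hX] at hWm hsub
  have hmem : ∀ j, 1 ≤ j → j ≤ N → (1 ≤ u j ∧ u j ≤ M) ∧ 1 ≤ v j ∧ v j ≤ Mv := fun j h₁ h₂ =>
    hS (u j, v j) ((hl.mem _).mpr ⟨j, h₁, h₂, rfl, rfl⟩)
  have hkeyM : ∀ z ∈ key leaf, 1 ≤ z ∧ z ≤ M := by
    intro z hz
    obtain ⟨Y, hY⟩ : W.Nonempty := Finset.card_pos.mp (by omega)
    obtain ⟨j, h₁, h₂, -, -, rfl⟩ := mem_blockLines.mp (hsub Y (hWm Y hY).1 (hWm Y hY).2 hz)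
    exact (hmem j h₁ h₂).1
  refine Cmd.Ends.mono
    (T := 5 + ((r * (30 + 10) + 10) + (20 + (5 + ((Mv * (100 + 10) + 10) + 20))))) ?_
    (by omega) (fun _ _ h => h)
  refine Cmd.Ends.then (P := fun s' => s' = s.setVar 21 leaf)
    (Cmd.Straight.ends (by simp) (by simp [Cmd.time, Expr.cost]) (by simp [hleaf])) ?_
  rintro s₁ - hs₁
  refine Cmd.Ends.then (P := fun s' => (∀ i, 1 ≤ i → i ≤ r → s'.arr BU i ∈ key leaf) ∧
    ∀ i, 1 ≤ i → i < r → s'.arr BU i < s'.arr BU (i + 1)) ?_ ?_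
  · refine Cmd.Ends.mono (Cmd.Ends.forUp (n := r) (T := 30) (fun k s' =>
      (ρ ≤ s'.var 21 ∧ s'.var 21 ≤ q ∧ (key (s'.var 21)).card = r - k ∧
        key (s'.var 21) ⊆ key leaf) ∧
      (∀ i, r - k < i → i ≤ r → s'.arr BU i ∈ key leaf ∧ ∀ z ∈ key (s'.var 21), z < s'.arr BU i) ∧
      ∀ i, r - k < i → i < r → s'.arr BU i < s'.arr BU (i + 1)) (by simp [hs₁, hr]) (by simp)
      (by simp [extractBody]) (by simp [extractBody]) ?_ ?_) le_rfl ?_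
    · simp only [hs₁, Store.setVar, Nat.sub_zero]
      simp only [ne_eq, Nat.reduceEqDiff, not_false_eq_true,
        Function.update_of_ne, Function.update_self]
      exact ⟨⟨hρ.le, hq, hcard, subset_rfl⟩, fun i h₁ h₂ => by omega, fun i h₁ h₂ => by omega⟩
    · intro k hk s' hf hj ⟨⟨i₁, i₂, i₃, i₄⟩, i₅, i₆⟩
      have e23 : s'.arr 23 = s.arr 23 := by
        rw [hf.2 23 (by simp [extractBody, Ne.symm hBU.2.1])]; simp [hs₁]
      have e24 : s'.arr 24 = s.arr 24 := by
        rw [hf.2 24 (by simp [extractBody, Ne.symm hBU.2.2.1])]; simp [hs₁]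
      have e1 : s'.var 1 = r := by
        rw [hf.1 1 (by simp [extractBody])]; simp [hs₁, hr]
      obtain ⟨w, hw⟩ : ∃ w, w = s'.var 21 := ⟨_, rfl⟩
      rw [← hw] at i₁ i₂ i₃ i₄ i₅
      have hwρ : ρ < w := by
        refine lt_of_le_of_ne i₁ fun he => ?_
        rw [← he, hT.root] at i₃
        simp at i₃
        omega
      obtain ⟨n₁, n₂, -, -, -, n₆, n₇⟩ := hT.node w hwρ i₂
      have hnm : s.arr 23 w ∉ key (s.arr 24 w) := fun h => lt_irrefl _ (n₇ _ h)
      refine Cmd.Straight.ends (by simp [extractBody])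
        (by simp [Cmd.time, Expr.cost, extractBody]) ?_
      obtain ⟨s'', hs''⟩ : ∃ s'', s'' = ((extractBody BU).exec s').setVar vLoop (k + 2) := ⟨_, rfl⟩
      rw [← hs'']
      have hpos : r + 1 - (k + 1) = r - k := by omega
      obtain ⟨v21, aB⟩ : s''.var 21 = s.arr 24 w ∧
          s''.arr BU = Function.update (s'.arr BU) (r - k) (s.arr 23 w) := by
        simp [hs'', extractBody, hj, e1, e23, e24, ← hw, Ne.symm hBU.2.2.1]
      rw [v21, aB]
      refine ⟨⟨n₁, n₂, ?_, ?_⟩, ?_, ?_⟩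
      · rw [n₆, Finset.card_insert_of_notMem hnm] at i₃
        omega
      · rw [n₆] at i₄
        exact (Finset.subset_insert _ _).trans i₄
      · intro i h₁ h₂
        rcases Nat.eq_or_lt_of_le (show r - k ≤ i by omega) with rfl | h
        · rw [Function.update_self]
          exact ⟨i₄ (by rw [n₆]; exact Finset.mem_insert_self _ _), n₇⟩
        · rw [Function.update_of_ne (by omega)]
          refine ⟨(i₅ i h h₂).1, fun z hz => (i₅ i h h₂).2 z ?_⟩
          rw [n₆]; exact Finset.mem_insert_of_mem hz
      · intro i h₁ h₂
        rcases Nat.eq_or_lt_of_le (show r - k ≤ i by omega) with rfl | h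
        · rw [Function.update_self, Function.update_of_ne (by omega)]
          refine (i₅ _ (by omega) (by omega)).2 _ ?_
          rw [n₆]; exact Finset.mem_insert_self _ _
        · rw [Function.update_of_ne (by omega), Function.update_of_ne (by omega)]
          exact i₆ i h h₂
    · rintro s' - ⟨-, i₅, i₆⟩
      exact ⟨fun i h₁ h₂ => (i₅ i (by omega) h₂).1, fun i h₁ h₂ => i₆ i (by omega) h₂⟩
  rintro s₂ hf₂ ⟨k₁, k₂⟩
  have q1 : s₂.var 1 = r := by rw [hf₂.1 1 (by simp [extractBody])]; simp [hs₁, hr]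
  have q0 : s₂.var 0 = n := by rw [hf₂.1 0 (by simp [extractBody])]; simp [hs₁, hn]
  have q8 : s₂.var 8 = t := by rw [hf₂.1 8 (by simp [extractBody])]; simp [hs₁, ht]
  have q22 : s₂.var 22 = leaf := by rw [hf₂.1 22 (by simp [extractBody])]; simp [hs₁, hleaf]
  have q23 : s₂.var 23 = X := by rw [hf₂.1 23 (by simp [extractBody])]; simp [hs₁, hX]
  have qmu : s₂.var mu = M := by
    rw [hf₂.1 mu (by simp [extractBody, hmu])]; simp [hs₁, hM, hmu]
  have qmv : s₂.var mv = Mv := by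
    rw [hf₂.1 mv (by simp [extractBody, hmv])]; simp [hs₁, hMv, hmv]
  have q19 : s₂.arr 19 = s.arr 19 := by
    rw [hf₂.2 19 (by simp [extractBody, Ne.symm hBU.1])]; simp [hs₁]
  have qLV : s₂.arr LV = b := by
    rw [hf₂.2 LV (by simp [extractBody, Ne.symm hBU.2.2.2])]; simp [hs₁, eLV]
  clear hf₂ hs₁
  refine Cmd.Ends.then (P := fun s' => s' = s₂.setArr BU (r + 1) (M + 1))
    (Cmd.Straight.ends (by simp) (by simp [Cmd.time, Expr.cost]) (by simp [q1, qmu])) ?_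
  rintro s₃ - hs₃
  refine Cmd.Ends.then (P := fun s' => s' = s₃.setVar 15 0)
    (Cmd.Straight.ends (by simp) (by simp [Cmd.time, Expr.cost]) (by simp)) ?_
  rintro s₄ - hs₄
  have p1 : s₄.var 1 = r := by simp [hs₄, hs₃, q1]
  have p0 : s₄.var 0 = n := by simp [hs₄, hs₃, q0]
  have p8 : s₄.var 8 = t := by simp [hs₄, hs₃, q8]
  have p22 : s₄.var 22 = leaf := by simp [hs₄, hs₃, q22]
  have p23 : s₄.var 23 = X := by simp [hs₄, hs₃, q23]
  have p15 : s₄.var 15 = 0 := by simp [hs₄]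
  have pmv : s₄.var mv = Mv := by simp [hs₄, hs₃, qmv, hmv]
  have p19 : s₄.arr 19 = s.arr 19 := by simp [hs₄, hs₃, q19, Ne.symm hBU.1]
  have pLV : s₄.arr LV = b := by simp [hs₄, hs₃, qLV, Ne.symm hBU.2.2.2]
  have pBU : s₄.arr BU = Function.update (s₂.arr BU) (r + 1) (M + 1) := by simp [hs₄, hs₃]
  clear hs₄ hs₃
  -- a line where a block of the leaf starts
  let good : ℕ → Prop := fun y => b (y - 1) < b y ∧ s.arr 19 (cellAddr n t X (b y)) = leaf
  refine Cmd.Ends.then (P := fun s' => s'.arr BU = s₄.arr BU ∧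
    (∀ i, 1 ≤ i → i ≤ r → 1 ≤ s'.arr BV i ∧ s'.arr BV i ≤ Mv ∧ good (s'.arr BV i)) ∧
    ∀ i, 1 ≤ i → i < r → s'.arr BV i < s'.arr BV (i + 1)) ?_ ?_
  · refine Cmd.Ends.mono (Cmd.Ends.forUp (n := Mv) (T := 100) (fun k s' =>
      s'.var 15 ≤ r ∧
      (∀ i, 1 ≤ i → i ≤ s'.var 15 → 1 ≤ s'.arr BV i ∧ s'.arr BV i ≤ k ∧ good (s'.arr BV i)) ∧
      (∀ i, 1 ≤ i → i < s'.var 15 → s'.arr BV i < s'.arr BV (i + 1)) ∧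
      (s'.var 15 < r → ∀ y, 1 ≤ y → y ≤ k → good y →
        ∃ i, 1 ≤ i ∧ i ≤ s'.var 15 ∧ s'.arr BV i = y)) pmv hmv.1 (by simp [selectBody])
      (by simp [selectBody, hmv]) ?_ ?_) le_rfl ?_
    · simp [p15]
      refine ⟨?_, ?_⟩
      · intro i _ _; omega
      · intro _ y _ _; omega
    · intro k hk s' hf hj ⟨i₁, i₂, i₃, i₄⟩
      have e1 : s'.var 1 = r := by rw [hf.1 1 (by simp [selectBody]), p1]
      have e0 : s'.var 0 = n := by rw [hf.1 0 (by simp [selectBody]), p0]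
      have e8 : s'.var 8 = t := by rw [hf.1 8 (by simp [selectBody]), p8]
      have e22 : s'.var 22 = leaf := by rw [hf.1 22 (by simp [selectBody]), p22]
      have e23 : s'.var 23 = X := by rw [hf.1 23 (by simp [selectBody]), p23]
      have e19 : s'.arr 19 = s.arr 19 := by
        rw [hf.2 19 (by simp [selectBody, Ne.symm hBV.1]), p19]
      have eLV' : s'.arr LV = b := by
        rw [hf.2 LV (by simp [selectBody, Ne.symm hBV.2.2.2.1]), pLV]
      refine Cmd.Straight.ends (by simp [selectBody])
        (by simp [Cmd.time, Expr.cost, selectBody]) ?_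
      obtain ⟨s'', hs''⟩ : ∃ s'', s'' = ((selectBody BV LV).exec s').setVar vLoop (k + 2) :=
        ⟨_, rfl⟩
      rw [← hs'']
      obtain ⟨c, hc⟩ : ∃ c, c = s'.var 15 := ⟨_, rfl⟩
      rw [← hc] at i₁ i₂ i₃ i₄
      by_cases hg : good (k + 1) ∧ c < r
      · obtain ⟨v15, aB⟩ : s''.var 15 = c + 1 ∧
            s''.arr BV = Function.update (s'.arr BV) (c + 1) (k + 1) := by
          have g₁ : b k < b (k + 1) := hg.1.1
          simp [hs'', selectBody, hj, e0, e1, e8, e22, e23, e19, eLV', cellAddr_fold, hg.1.2,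
            g₁, ← hc, hg.2]
        rw [v15, aB]
        refine ⟨hg.2, ?_, ?_, ?_⟩
        · intro i h₁ h₂
          rcases Nat.le_or_eq_of_le_succ h₂ with h | rfl
          · rw [Function.update_of_ne (by omega)]
            have := i₂ i h₁ h
            exact ⟨this.1, by omega, this.2.2⟩
          · simp only [Nat.succ_eq_add_one, Function.update_self]
            exact ⟨by omega, le_rfl, hg.1⟩
        · intro i h₁ h₂
          rcases Nat.lt_succ_iff_lt_or_eq.mp h₂ with h | rfl
          · rw [Function.update_of_ne (by omega), Function.update_of_ne (by omega)]
            exact i₃ i h₁ h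
          · rw [Function.update_self, Function.update_of_ne (by omega)]
            have := (i₂ i h₁ le_rfl).2.1
            omega
        · intro _ y h₁ h₂ h₃
          rcases Nat.le_or_eq_of_le_succ h₂ with h | rfl
          · obtain ⟨i, j₁, j₂, j₃⟩ := i₄ hg.2 y h₁ h h₃
            exact ⟨i, j₁, by omega, by rw [Function.update_of_ne (by omega)]; exact j₃⟩
          · exact ⟨c + 1, by omega, le_rfl, by simp⟩
      · obtain ⟨v15, aB⟩ : s''.var 15 = c ∧ s''.arr BV = s'.arr BV := by
          by_cases g₁ : b k < b (k + 1)
          · by_cases g₂ : s.arr 19 (cellAddr n t X (b (k + 1))) = leaf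
            · have g₃ : ¬ c < r := fun h => hg ⟨⟨g₁, g₂⟩, h⟩
              simp [hs'', selectBody, hj, e0, e1, e8, e22, e23, e19, eLV', cellAddr_fold, g₁, g₂,
                ← hc, g₃]
            · simp [hs'', selectBody, hj, e0, e8, e22, e23, e19, eLV', cellAddr_fold, g₁, g₂,
                ← hc]
          · simp [hs'', selectBody, hj, eLV', g₁, ← hc]
        rw [v15, aB]
        refine ⟨i₁, ?_, i₃, ?_⟩
        · intro i h₁ h₂
          have := i₂ i h₁ h₂
          exact ⟨this.1, by omega, this.2.2⟩
        · intro hcr y h₁ h₂ h₃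
          rcases Nat.le_or_eq_of_le_succ h₂ with h | rfl
          · exact i₄ hcr y h₁ h h₃
          · exact absurd ⟨h₃, hcr⟩ hg
    · intro s' hf ⟨i₁, i₂, i₃, i₄⟩
      have eBU : s'.arr BU = s₄.arr BU := hf.2 BU (by simp [selectBody, Ne.symm hBV.2.2.2.2])
      -- If fewer than `r` starts had been chosen, none would have been discarded, and the at least
      -- `r` blocks in `W` would all start at a chosen line.
      have hall : s'.var 15 = r := by
        by_contra hne
        have hlt : s'.var 15 < r := by omega
        have hi : ∀ Y ∈ W, ∃ i, i ∈ Finset.Icc 1 (s'.var 15) ∧ b (s'.arr BV i) = Y := by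
          intro Y hY
          obtain ⟨hYn, hYl⟩ := hWm Y hY
          obtain ⟨z, hz⟩ : (key leaf).Nonempty := Finset.card_pos.mp (by omega)
          obtain ⟨j, j₁, j₂, -, j₄, -⟩ := mem_blockLines.mp (hsub Y hYn hYl hz)
          have hv := (hmem j j₁ j₂).2
          have hY1 : 1 ≤ Y := j₄ ▸ hb.one_le hv.1 hv.2
          have hYK : Y ≤ K := j₄ ▸ hb.le hv.1 hv.2
          obtain ⟨y, y₁, y₂, rfl, y₄⟩ := hb.exists_start hY1 hYK
          obtain ⟨i, l₁, l₂, rfl⟩ := i₄ hlt y y₁ y₂ ⟨y₄, hYl⟩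
          exact ⟨i, Finset.mem_Icc.mpr ⟨l₁, l₂⟩, rfl⟩
        have : W ⊆ (Finset.Icc 1 (s'.var 15)).image fun i => b (s'.arr BV i) := by
          intro Y hY
          obtain ⟨i, h₁, h₂⟩ := hi Y hY
          exact Finset.mem_image.mpr ⟨i, h₁, h₂⟩
        have := (Finset.card_le_card this).trans Finset.card_image_le
        rw [Nat.card_Icc] at this
        omega
      rw [hall] at i₂ i₃
      exact ⟨eBU, i₂, i₃⟩
  rintro s₅ hf₅ ⟨g₁, g₂, g₃⟩
  have t1 : s₅.var 1 = r := by rw [hf₅.1 1 (by simp [selectBody]), p1]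
  have tmv : s₅.var mv = Mv := by rw [hf₅.1 mv (by simp [selectBody, hmv]), pmv]
  refine Cmd.Straight.ends (by simp) (by simp [Cmd.time, Expr.cost]) ?_
  obtain ⟨x, hx⟩ : ∃ x, x = Function.update (s₂.arr BU) (r + 1) (M + 1) := ⟨_, rfl⟩
  obtain ⟨y, hy⟩ : ∃ y, y = Function.update (s₅.arr BV) (r + 1) (Mv + 1) := ⟨_, rfl⟩
  have ex : ((Cmd.put BV (!ₑvGrid +ₑ #ₑ1) (!ₑmv +ₑ #ₑ1)).exec s₅).arr BU = x := by
    simp [t1, tmv, Ne.symm hBV.2.2.2.2, g₁, pBU, hx]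
  have ey : ((Cmd.put BV (!ₑvGrid +ₑ #ₑ1) (!ₑmv +ₑ #ₑ1)).exec s₅).arr BV = y := by
    simp [t1, tmv, hy]
  rw [ex, ey]
  have xi : ∀ i, i ≤ r → x i = s₂.arr BU i := fun i hi => by
    rw [hx, Function.update_of_ne (by omega)]
  have yi : ∀ i, i ≤ r → y i = s₅.arr BV i := fun i hi => by
    rw [hy, Function.update_of_ne (by omega)]
  have xl : x (r + 1) = M + 1 := by rw [hx, Function.update_self]
  have yl : y (r + 1) = Mv + 1 := by rw [hy, Function.update_self]
  have ltx : ∀ i, 1 ≤ i → i ≤ r → x i < x (i + 1) := by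
    intro i h₁ h₂
    rcases Nat.eq_or_lt_of_le h₂ with rfl | h
    · rw [xl, xi i le_rfl]
      have := (hkeyM _ (k₁ i h₁ le_rfl)).2
      omega
    · rw [xi i h₂, xi (i + 1) h]; exact k₂ i h₁ h
  have lty : ∀ i, 1 ≤ i → i ≤ r → y i < y (i + 1) := by
    intro i h₁ h₂
    rcases Nat.eq_or_lt_of_le h₂ with rfl | h
    · rw [yl, yi i le_rfl]
      have := (g₂ i h₁ le_rfl).2.1
      omega
    · rw [yi i h₂, yi (i + 1) h]; exact g₃ i h₁ h
  refine ⟨?_, ?_, ltx, lty, xl, yl, ?_⟩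
  · rw [xi 1 hr1]; exact (hkeyM _ (k₁ 1 le_rfl hr1)).1
  · rw [yi 1 hr1]; exact (g₂ 1 le_rfl hr1).1
  · intro i j h₁ h₂ h₃ h₄
    obtain ⟨y₁, y₂, y₃, y₄⟩ := g₂ j h₃ h₄
    have hbn : b (s₅.arr BV j) ≤ n := (hb.le_self y₁ y₂).trans (y₂.trans hMvn)
    obtain ⟨l, l₁, l₂, -, l₄, l₅⟩ := mem_blockLines.mp (hsub _ hbn y₄ (k₁ i h₁ h₂))
    obtain ⟨-, hv1, hvM⟩ := hmem l l₁ l₂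
    refine ⟨(u l, v l), (hl.mem _).mpr ⟨l, l₁, l₂, rfl, rfl⟩, ?_, ?_⟩
    · simp only
      have := ltx i h₁ h₂
      rw [l₅, xi i h₂] at *
      omega
    · simp only
      constructor
      · rw [yi j h₄]
        by_contra hc
        have := hb.mono hv1 (show v l ≤ s₅.arr BV j - 1 by omega) (by omega)
        omega
      · rcases Nat.eq_or_lt_of_le h₄ with rfl | h
        · rw [yl]; omega
        · rw [yi (j + 1) h]
          by_contra hc
          obtain ⟨y₁', y₂', y₃', y₄'⟩ := g₂ (j + 1) (by omega) h
          have e₁ := hb.mono y₁' (show s₅.arr BV (j + 1) ≤ v l by omega) hvM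
          have e₂ := hb.mono y₁ (show s₅.arr BV j ≤ s₅.arr BV (j + 1) - 1 by
            have := g₃ j h₃ h; omega) (by omega)
          omega

/-! ### The set of cells -/

theorem IsList.card_filter {N : ℕ} {x y : ℕ → ℕ} {S : Finset (ℕ × ℕ)} (h : IsList N x y S)
    (P : ℕ × ℕ → Prop) [DecidablePred P] :
    ((Finset.Icc 1 N).filter fun j => P (x j, y j)).card = (S.filter P).card := by
  refine Finset.card_bij (fun j _ => (x j, y j)) ?_ ?_ ?_
  · intro j hj
    simp only [Finset.mem_filter, Finset.mem_Icc] at hj ⊢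
    exact ⟨(h.mem _).mpr ⟨j, hj.1.1, hj.1.2, rfl, rfl⟩, hj.2⟩
  · intro i hi j hj he
    simp only [Finset.mem_filter, Finset.mem_Icc] at hi hj
    exact h.inj i j hi.1.1 hi.1.2 hj.1.1 hj.1.2 (Prod.mk.inj he).1 (Prod.mk.inj he).2
  · rintro ⟨a, b⟩ hp
    simp only [Finset.mem_filter] at hp
    obtain ⟨j, h₁, h₂, rfl, rfl⟩ := (h.mem _).mp hp.1
    exact ⟨j, by simp only [Finset.mem_filter, Finset.mem_Icc]; exact ⟨⟨h₁, h₂⟩, hp.2⟩, rfl⟩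

theorem card_filter_image_swap (S : Finset (ℕ × ℕ)) (P : ℕ × ℕ → Prop) [DecidablePred P] :
    ((S.image Prod.swap).filter P).card = (S.filter fun p => P p.swap).card := by
  rw [Finset.filter_image, Finset.card_image_of_injective _ Prod.swap_injective]

theorem IsList.blockLines_eq {N : ℕ} {u v : ℕ → ℕ} {S : Finset (ℕ × ℕ)} (h : IsList N u v S)
    (a b : ℕ → ℕ) (X Y : ℕ) : blockLines u v a b N X Y =
      (S.filter fun p => a p.1 = X ∧ b p.2 = Y).image Prod.fst := by
  ext z
  simp only [mem_blockLines, Finset.mem_image, Finset.mem_filter, h.mem, Prod.exists]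
  constructor
  · rintro ⟨j, h₁, h₂, h₃, h₄, rfl⟩
    exact ⟨u j, v j, ⟨⟨j, h₁, h₂, rfl, rfl⟩, h₃, h₄⟩, rfl⟩
  · rintro ⟨x, y, ⟨⟨j, h₁, h₂, rfl, rfl⟩, h₃, h₄⟩, rfl⟩
    exact ⟨j, h₁, h₂, h₃, h₄, rfl⟩

theorem IsList.blockLines_swap_eq {N : ℕ} {u v : ℕ → ℕ} {S : Finset (ℕ × ℕ)}
    (h : IsList N u v (S.image Prod.swap)) (a b : ℕ → ℕ) (X Y : ℕ) :
    blockLines u v a b N X Y =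
      (S.filter fun p => b p.1 = Y ∧ a p.2 = X).image Prod.snd := by
  rw [h.blockLines_eq]
  ext z
  simp only [Finset.mem_image, Finset.mem_filter, Prod.exists]
  constructor
  · rintro ⟨x, y, ⟨⟨c, d, hm, he⟩, h₃, h₄⟩, rfl⟩
    obtain ⟨rfl, rfl⟩ := Prod.mk.inj he
    exact ⟨c, d, ⟨hm, h₄, h₃⟩, rfl⟩
  · rintro ⟨x, y, ⟨hm, h₃, h₄⟩, rfl⟩
    exact ⟨y, x, ⟨⟨x, y, hm, rfl⟩, h₄, h₃⟩, rfl⟩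

theorem card_div_fiber_le {M K : ℕ} (hK : 1 ≤ K) {φ : ℕ → ℕ}
    (hφ : ∀ x, 1 ≤ x → x ≤ M → φ x = (x - 1) / K + 1) (X : ℕ) :
    ((Finset.Icc 1 M).filter fun x => φ x = X).card ≤ K := by
  refine (Finset.card_le_card (t := Finset.Icc ((X - 1) * K + 1) ((X - 1) * K + K)) ?_).trans
    (by simp)
  intro x hx
  simp only [Finset.mem_filter, Finset.mem_Icc] at hx ⊢
  have h := hφ x hx.1.1 hx.1.2
  have hX : X - 1 = (x - 1) / K := by rw [← hx.2, h, Nat.add_sub_cancel]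
  rw [hX]
  have h₁ := Nat.div_mul_le_self (x - 1) K
  have h₂ := Nat.lt_div_mul_add (a := x - 1) (show 0 < K by omega)
  omega

/-! ### Passing to a coarser gridding -/

theorem Tracks.card_le {π : Permutation} {d N : ℕ} {m : Fin 2 → ℕ} {L : Fin 2 → ℕ → ℕ}
    {o₂ o₃ o₄ : ℕ → ℕ} {cnt last : ℕ} {id gx gy : ℕ → ℕ}
    (h : Tracks π d m L o₂ o₃ o₄ cnt last (fun p => 1 ≤ p ∧ p ≤ N) id gx gy) (X : ℕ) :
    ((Finset.Icc 1 N).filter fun j => gx j = X).card ≤ d ∧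
      ((Finset.Icc 1 N).filter fun j => gy j = X).card ≤ d := by
  obtain ⟨F, σ, lab, -, hl, -, -, -, -, hS, hi, hg⟩ := h
  constructor
  · refine (Finset.card_le_card_of_injOn id ?_ ?_).trans (hl.count 0 X)
    · intro j hj
      simp only [Finset.coe_filter, Finset.mem_Icc, Set.mem_ofPred_eq] at hj ⊢
      exact ⟨(hS _).mpr ⟨j, hj.1, rfl⟩, (hg j hj.1).1.trans hj.2⟩
    · intro i hi' j hj he
      simp only [Finset.coe_filter, Finset.mem_Icc, Set.mem_ofPred_eq] at hi' hj
      exact hi i j hi'.1 hj.1 he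
  · refine (Finset.card_le_card_of_injOn id ?_ ?_).trans (hl.count 1 X)
    · intro j hj
      simp only [Finset.coe_filter, Finset.mem_Icc, Set.mem_ofPred_eq] at hj ⊢
      exact ⟨(hS _).mpr ⟨j, hj.1, rfl⟩, (hg j hj.1).2.trans hj.2⟩
    · intro i hi' j hj he
      simp only [Finset.coe_filter, Finset.mem_Icc, Set.mem_ofPred_eq] at hi' hj
      exact hi i j hi'.1 hj.1 he

/-- The family and the merges do not change; its rectangles are merely assigned to larger cells.
Rectangles correspond to positions of the list, so the bound for the new lines can be checked on
positions. -/
theorem Tracks.coarsen {π : Permutation} {d N m₀ m₁ m₀' m₁' : ℕ} {L₀ L₁ L₀' L₁' φ ψ : ℕ → ℕ}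
    {o₂ o₃ o₄ : ℕ → ℕ} {cnt last : ℕ} {id gx gy : ℕ → ℕ}
    (h : Tracks π d ![m₀, m₁] ![L₀, L₁] o₂ o₃ o₄ cnt last (fun p => 1 ≤ p ∧ p ≤ N) id gx gy)
    (hφ : Coarsening m₀ m₀' φ) (hψ : Coarsening m₁ m₁' ψ)
    (hL₀ : CoarseLeft π.length m₀ m₀' φ L₀ L₀') (hL₁ : CoarseLeft π.length m₁ m₁' ψ L₁ L₁')
    (hx : ∀ X, ((Finset.Icc 1 N).filter fun j => φ (gx j) = X).card ≤ d)
    (hy : ∀ X, ((Finset.Icc 1 N).filter fun j => ψ (gy j) = X).card ≤ d) :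
    Tracks π d ![m₀', m₁'] ![L₀', L₁'] o₂ o₃ o₄ cnt last (fun p => 1 ≤ p ∧ p ≤ N) id
      (fun p => φ (gx p)) (fun p => ψ (gy p)) := by
  obtain ⟨F, σ, lab, hr, hl, h₁, h₂, h₃, h₄, hS, hi, hg⟩ := h
  have lay₀ := hl.layout 0
  have lay₁ := hl.layout 1
  simp only [Matrix.cons_val_zero, Matrix.cons_val_one] at lay₀ lay₁
  refine ⟨F, σ, ![fun i => φ (lab 0 i), fun i => ψ (lab 1 i)], hr, ⟨?_, ?_, ?_, ?_⟩, h₁, h₂, h₃,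
    h₄, hS, hi, ?_⟩
  · intro α
    fin_cases α
    · exact hL₀.layout hφ lay₀
    · exact hL₁.layout hψ lay₁
  · intro i hiF α
    fin_cases α
    · obtain ⟨r₁, r₂⟩ := hl.range i hiF 0
      exact ⟨hφ.one_le r₁ r₂, hφ.le r₁ r₂⟩
    · obtain ⟨r₁, r₂⟩ := hl.range i hiF 1
      exact ⟨hψ.one_le r₁ r₂, hψ.le r₁ r₂⟩
  · intro i hiF α
    fin_cases α
    · obtain ⟨r₁, r₂⟩ := hl.range i hiF 0
      obtain ⟨b₁, b₂⟩ := hl.box i hiF 0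
      obtain ⟨c₁, c₂⟩ := hL₀.contains hφ lay₀ r₁ r₂
      exact ⟨c₁.trans b₁, b₂.trans_le c₂⟩
    · obtain ⟨r₁, r₂⟩ := hl.range i hiF 1
      obtain ⟨b₁, b₂⟩ := hl.box i hiF 1
      obtain ⟨c₁, c₂⟩ := hL₁.contains hψ lay₁ r₁ r₂
      exact ⟨c₁.trans b₁, b₂.trans_le c₂⟩
  · intro α x
    have key : ∀ (f : ℕ → ℕ) (g : ℕ → ℕ), (∀ p, 1 ≤ p ∧ p ≤ N → f (id p) = g p) →
        (F.S.filter fun i => f i = x).card ≤ ((Finset.Icc 1 N).filter fun j => g j = x).card := by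
      intro f g hfg
      refine (Finset.card_le_card (t := ((Finset.Icc 1 N).filter fun j => g j = x).image id)
        ?_).trans Finset.card_image_le
      intro i hiF
      simp only [Finset.mem_filter] at hiF
      obtain ⟨p, hp, rfl⟩ := (hS i).mp hiF.1
      refine Finset.mem_image.mpr ⟨p, ?_, rfl⟩
      simp only [Finset.mem_filter, Finset.mem_Icc]
      exact ⟨hp, (hfg p hp).symm.trans hiF.2⟩
    fin_cases α
    · exact (key (fun i => φ (lab 0 i)) (fun p => φ (gx p)) fun p hp =>
        congrArg φ (hg p hp).1).trans (hx x)
    · exact (key (fun i => ψ (lab 1 i)) (fun p => ψ (gy p)) fun p hp =>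
        congrArg ψ (hg p hp).2).trans (hy x)
  · intro p hp
    exact ⟨congrArg φ (hg p hp).1, congrArg ψ (hg p hp).2⟩

/-- The cells in a fiber of `φ` lie between its smallest and its largest line, and the cells in that
range occupy consecutive positions of the sorted list. -/
theorem LastPos.card_fiber_le {N m d : ℕ} {x E φ : ℕ → ℕ} (h : LastPos N m x E)
    (hx : ∀ j, 1 ≤ j → j ≤ N → 1 ≤ x j ∧ x j ≤ m)
    (hE : ∀ a b, 1 ≤ a → a ≤ b → b ≤ m → φ a = φ b → E b ≤ E (a - 1) + d) (X : ℕ) :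
    ((Finset.Icc 1 N).filter fun j => φ (x j) = X).card ≤ d := by
  set A := (Finset.Icc 1 m).filter fun l => φ l = X with hA
  by_cases hne : A.Nonempty
  · have hmin := Finset.min'_mem A hne
    have hmax := Finset.max'_mem A hne
    obtain ⟨a, ha⟩ : ∃ a, a = A.min' hne := ⟨_, rfl⟩
    obtain ⟨b, hb⟩ : ∃ b, b = A.max' hne := ⟨_, rfl⟩
    have hab : a ≤ b := ha ▸ hb ▸ Finset.min'_le _ _ hmax
    have hlow : ∀ l ∈ A, a ≤ l := fun l hl => ha ▸ Finset.min'_le _ _ hl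
    have hupp : ∀ l ∈ A, l ≤ b := fun l hl => hb ▸ Finset.le_max' _ _ hl
    rw [← ha] at hmin
    rw [← hb] at hmax
    simp only [hA, Finset.mem_filter, Finset.mem_Icc] at hmin hmax hlow hupp
    have hc := h.card_filter hmin.1.1 hab hmax.1.2
    have := hE a b hmin.1.1 hab hmax.1.2 (hmin.2.trans hmax.2.symm)
    refine (Finset.card_le_card ?_).trans (hc.le.trans (by omega))
    intro j hj
    simp only [Finset.mem_filter, Finset.mem_Icc] at hj ⊢
    have hm := hx j hj.1.1 hj.1.2
    exact ⟨hj.1, hlow _ ⟨hm, hj.2⟩, hupp _ ⟨hm, hj.2⟩⟩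
  · rw [Finset.filter_eq_empty_iff.mpr]
    · simp
    · intro j hj he
      simp only [Finset.mem_Icc] at hj
      exact hne ⟨x j, by
        simp only [hA, Finset.mem_filter, Finset.mem_Icc]; exact ⟨hx j hj.1 hj.2, he⟩⟩

/-! ### One round of the algorithm -/

/-- The store holds a gridding of `π` with `m₀` columns and `m₁` rows and two lists of a set `S` of
`N` nonempty cells. If `N` is small, then `S` is the set of all nonempty cells, and a sequence of
merges has been recorded that leads to one rectangle for each cell. -/
structure Cells (π : Permutation) (r m₀ m₁ N t : ℕ) (S : Finset (ℕ × ℕ)) (s : Store) : Prop where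
  len : s.var vLen = π.length
  grid : s.var vGrid = r
  bound : s.var vBound = min (gridBound r) π.length
  cols : s.var vCols = m₀
  rows : s.var vRows = m₁
  size : s.var vMax = max m₀ m₁
  cells : s.var vCells = N
  cols_pos : 1 ≤ m₀
  cols_le : m₀ ≤ π.length
  rows_pos : 1 ≤ m₁
  rows_le : m₁ ≤ π.length
  cells_le : N ≤ min (gridBound r) π.length * max m₀ m₁ + 1
  cells_le_length : N ≤ π.length
  list₁ : IsList N (s.arr aX1) (s.arr aY1) S
  list₂ : IsList N (s.arr aY2) (s.arr aX2) (S.image Prod.swap)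
  range : ∀ p ∈ S, (1 ≤ p.1 ∧ p.1 ≤ m₀) ∧ 1 ≤ p.2 ∧ p.2 ≤ m₁
  layoutX : Layout π.length m₀ (s.arr aLeftX)
  layoutY : Layout π.length m₁ (s.arr aLeftY)
  point : ∀ p ∈ S, ∃ i ∈ π.S,
    (s.arr aLeftX p.1 ≤ π.P i 0 ∧ π.P i 0 < s.arr aLeftX (p.1 + 1)) ∧
      s.arr aLeftY p.2 ≤ π.P i 1 ∧ π.P i 1 < s.arr aLeftY (p.2 + 1)
  cleanIndex : Clean π.length t (s.arr aIndex)
  cleanMark : Clean π.length t (s.arr aMark)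
  tracks : N ≤ min (gridBound r) π.length * max m₀ m₁ →
    ((∀ x, 1 ≤ x → x ≤ m₀ → ∃ p ∈ S, p.1 = x) ∧ ∀ y, 1 ≤ y → y ≤ m₁ → ∃ p ∈ S, p.2 = y) ∧
    Tracks π (4 * min (gridBound r) π.length) ![m₀, m₁] ![s.arr aLeftX, s.arr aLeftY] (s.arr 2)
      (s.arr 3) (s.arr 4) (s.var vMerges) (s.var vLast) (fun p => 1 ≤ p ∧ p ≤ N) (s.arr aId)
      (s.arr aX1) (s.arr aY1)

theorem Cells.congr {π : Permutation} {r m₀ m₁ N t : ℕ} {S : Finset (ℕ × ℕ)} {s s' : Store}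
    (h : Cells π r m₀ m₁ N t S s) (hv : ∀ y ∈ [0, 1, 2, 3, 4, 5, 6, 7, 24], s'.var y = s.var y)
    (ha : ∀ a ∈ [2, 3, 4, 6, 7, 8, 9, 10, 15, 16, 17, 18], s'.arr a = s.arr a) :
    Cells π r m₀ m₁ N t S s' := by
  simp only [List.mem_cons, List.not_mem_nil, or_false, forall_eq_or_imp, forall_eq] at hv ha
  obtain ⟨v0, v1, v2, v3, v4, v5, v6, v7, v24⟩ := hv
  obtain ⟨a2, a3, a4, a6, a7, a8, a9, a10, a15, a16, a17, a18⟩ := ha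
  obtain ⟨h₁, h₂, h₃, h₄, h₅, h₆, h₇, h₈, h₉, k₁, k₂, k₃, k₄, k₅, k₆, k₇, k₈, k₉, l₁, l₂, l₃,
    l₄⟩ := h
  constructor <;> try simp only [v0, v1, v2, v3, v4, v5, v6, v7, v24, a2, a3, a4, a6, a7, a8, a9,
    a10, a15, a16, a17, a18]
  all_goals assumption

theorem Cells.one_le_bound {π : Permutation} {r m₀ m₁ N t : ℕ} {S : Finset (ℕ × ℕ)} {s : Store}
    (h : Cells π r m₀ m₁ N t S s) (hr : 1 ≤ r) : 1 ≤ min (gridBound r) π.length := by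
  refine le_min ?_ (h.cols_pos.trans h.cols_le)
  exact Nat.mul_pos (pow_pos hr 4) (Nat.choose_pos (Nat.le_self_pow two_ne_zero r))

theorem Cells.pos {π : Permutation} {r m₀ m₁ N t : ℕ} {S : Finset (ℕ × ℕ)} {s : Store}
    (h : Cells π r m₀ m₁ N t S s) : 1 ≤ N := by
  by_cases hN : N ≤ min (gridBound r) π.length * max m₀ m₁
  · obtain ⟨p, hp, -⟩ := (h.tracks hN).1.1 1 le_rfl h.cols_pos
    rw [← h.list₁.card]
    exact Finset.card_pos.mpr ⟨p, hp⟩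
  · omega

/-- The labels of the lines of the gridding describe a coarser gridding. -/
structure Labels (m₀ m₁ m₀' m₁' : ℕ) (s : Store) : Prop where
  cols : s.var vNewCols = m₀'
  rows : s.var vNewRows = m₁'
  coarseX : Coarsening m₀ m₀' (s.arr aLabX)
  coarseY : Coarsening m₁ m₁' (s.arr aLabY)

/-- `hmode` covers the two kinds of rounds. After a dense round the coarser set of cells is dense,
and it stays so after the cut, so there is nothing to show for the record of merges. After a sparse
round the record was valid before, and every new line has at most `4 * F` cells. -/
theorem contract_ends {π : Permutation} {r m₀ m₁ m₀' m₁' N t : ℕ} {S : Finset (ℕ × ℕ)} {s : Store}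
    (h : Cells π r m₀ m₁ N t S s) (ht : t < s.var vStamp) (hl : Labels m₀ m₁ m₀' m₁' s)
    (hmode : min (gridBound r) π.length * max m₀' m₁' <
        (S.image fun p => (s.arr aLabX p.1, s.arr aLabY p.2)).card ∨
      N ≤ min (gridBound r) π.length * max m₀ m₁ ∧
        (∀ X, (S.filter fun p => s.arr aLabX p.1 = X).card ≤ 4 * min (gridBound r) π.length) ∧
        ∀ Y, (S.filter fun p => s.arr aLabY p.2 = Y).card ≤ 4 * min (gridBound r) π.length) :
    contract.Ends s (500 * N + 50 * (m₀ + m₁) + 300) fun s' =>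
      ∃ N' S', Cells π r m₀' m₁' N' (s.var vStamp) S' s' := by
  obtain ⟨F, hF⟩ : ∃ F, F = min (gridBound r) π.length := ⟨_, rfl⟩
  obtain ⟨n, hn⟩ : ∃ n, n = π.length := ⟨_, rfl⟩
  obtain ⟨τ, hτ⟩ : ∃ τ, τ = s.var vStamp := ⟨_, rfl⟩
  rw [← hF] at hmode
  rw [← hτ] at ht ⊢
  have hz : ∀ {a : ℕ → ℕ}, Clean π.length t a → ∀ X Y, X ≤ n → Y ≤ n →
      a (cellAddr n τ X Y) = 0 := fun hc X Y hX hY => by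
    rw [hn] at *; exact hc τ X Y ht hX hY
  refine Cmd.Ends.mono (T := (50 * m₀ + 50) + ((50 * m₁ + 50) + (5 + ((N * (200 + 10) + 10) +
    (60 + (5 + ((N * (200 + 10) + 10) + 5))))))) ?_ (by omega) (fun _ _ h => h)
  refine Cmd.Ends.then (left_ends h.cols hl.cols h.len (by decide) (by decide) (by decide)
    hl.coarseX) ?_
  intro s₁ f₁ hL₀
  have e14 : s₁.arr aLabY = s.arr aLabY := f₁.2 14 (by decide)
  refine Cmd.Ends.then (left_ends (n := π.length) (M := m₁) (M' := m₁')
    ((f₁.1 4 (by decide)).trans h.rows) ((f₁.1 13 (by decide)).trans hl.rows)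
    ((f₁.1 0 (by decide)).trans h.len) (by decide) (by decide) (by decide)
    (by rw [e14]; exact hl.coarseY)) ?_
  intro s₂ f₂ hL₁
  rw [e14, show s₁.arr aLeftY = s.arr aLeftY from f₁.2 16 (by decide)] at hL₁
  have e15 : s₂.arr aLeftX = s₁.arr aLeftX := f₂.2 15 (by decide)
  rw [← e15] at hL₀
  have fv : ∀ y, y ≠ 11 → s₂.var y = s.var y := fun y hy =>
    (f₂.1 y (by simp [left, leftBody, hy])).trans (f₁.1 y (by simp [left, leftBody, hy]))
  have fa : ∀ a, a ≠ 15 → a ≠ 16 → s₂.arr a = s.arr a := fun a h₁ h₂ =>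
    (f₂.2 a (by simp [left, leftBody, h₂])).trans (f₁.2 a (by simp [left, leftBody, h₁]))
  clear f₁ f₂ e14 e15
  refine Cmd.Ends.then (P := fun s' => s' = s₂.setVar vNew 0)
    (Cmd.Straight.ends (by simp) (by simp [Cmd.time, Expr.cost]) (by simp)) ?_
  rintro s₃ - hs₃
  have gv : ∀ y, y ≠ 11 → y ≠ 14 → s₃.var y = s.var y := fun y h₁ h₂ => by
    rw [← fv y h₁]; simp [hs₃, h₂]
  have ga : ∀ a, a ≠ 15 → a ≠ 16 → s₃.arr a = s.arr a := fun a h₁ h₂ => by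
    rw [← fa a h₁ h₂]; simp [hs₃]
  have g14 : s₃.var vNew = 0 := by simp [hs₃]
  rw [show s₂.arr = s₃.arr by simp [hs₃]] at hL₀ hL₁
  clear fv fa hs₃
  have a13 : s₃.arr aLabX = s.arr aLabX := ga 13 (by decide) (by decide)
  have a14 : s₃.arr aLabY = s.arr aLabY := ga 14 (by decide) (by decide)
  have a6 : s₃.arr aX1 = s.arr aX1 := ga 6 (by decide) (by decide)
  have a7 : s₃.arr aY1 = s.arr aY1 := ga 7 (by decide) (by decide)
  obtain ⟨φ, hφ⟩ : ∃ φ, φ = s.arr aLabX := ⟨_, rfl⟩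
  obtain ⟨ψ, hψ⟩ : ∃ ψ, ψ = s.arr aLabY := ⟨_, rfl⟩
  have cφ := hl.coarseX
  have cψ := hl.coarseY
  rw [← hφ] at hmode hL₀ a13 cφ
  rw [← hψ] at hmode hL₁ a14 cψ
  refine Cmd.Ends.then (mergeLoop_ends (n := n) (t := τ) (S := S) (m₀ := m₀) (m₁ := m₁)
    (m₀' := m₀') (m₁' := m₁') (π := π) (d := 4 * F) (m := ![m₀', m₁'])
    (T := N ≤ F * max m₀ m₁ ∧
        (∀ X, (S.filter fun p => φ p.1 = X).card ≤ 4 * F) ∧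
        ∀ Y, (S.filter fun p => ψ p.2 = Y).card ≤ 4 * F)
    ((gv 5 (by decide) (by decide)).trans h.cells)
    (((gv 0 (by decide) (by decide)).trans h.len).trans hn.symm)
    ((gv 8 (by decide) (by decide)).trans hτ.symm) g14
    (by rw [a6, a7]; exact h.list₁) h.range (by rw [hn]; exact h.cols_le)
    (by rw [hn]; exact h.rows_le)
    (by rw [a13]; exact cφ) (by rw [a14]; exact cψ)
    (by rw [ga 17 (by decide) (by decide), hn]; exact h.cleanIndex.mono ht.le)
    (by rw [ga 17 (by decide) (by decide)]; exact hz h.cleanIndex) ?_) ?_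
  · rintro ⟨hT, hcx, hcy⟩
    rw [a6, a7, a13, a14, ga 2 (by decide) (by decide), ga 3 (by decide) (by decide),
      ga 4 (by decide) (by decide), ga 8 (by decide) (by decide), gv 6 (by decide) (by decide),
      gv 7 (by decide) (by decide)]
    rw [hF] at hT
    have := (h.tracks hT).2
    rw [← hF] at this
    refine this.coarsen cφ cψ hL₀ hL₁ (fun X => ?_) (fun Y => ?_)
    · exact (h.list₁.card_filter fun p => φ p.1 = X).trans_le (hcx X)
    · exact (h.list₁.card_filter fun p => ψ p.2 = Y).trans_le (hcy Y)
  rintro s₄ f₄ ⟨j₁, j₂, j₃, j₄, j₅, j₆⟩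
  rw [a13, a14] at j₂ j₄
  have kv : ∀ y, y ∉ [6, 7, 11, 14, 16, 17] → s₄.var y = s.var y := fun y hy => by
    simp only [List.mem_cons, List.not_mem_nil, or_false, not_or] at hy
    rw [← gv y hy.2.2.1 hy.2.2.2.1]
    exact f₄.1 y (by simp [mergeBody, hy])
  have ka : ∀ a, a ∉ [2, 3, 4, 6, 7, 8, 15, 16, 17] → s₄.arr a = s.arr a := fun a ha => by
    simp only [List.mem_cons, List.not_mem_nil, or_false, not_or] at ha
    rw [← ga a ha.2.2.2.2.2.2.1 ha.2.2.2.2.2.2.2.1]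
    exact f₄.2 a (by simp [mergeBody, ha])
  have k15 : s₄.arr aLeftX = s₃.arr aLeftX := f₄.2 15 (by decide)
  have k16 : s₄.arr aLeftY = s₃.arr aLeftY := f₄.2 16 (by decide)
  rw [← k15] at hL₀ j₆
  rw [← k16] at hL₁ j₆
  clear f₄ gv ga g14 a6 a7 a13 a14 k15 k16
  obtain ⟨c, hc⟩ : ∃ c, c = min (s₄.var vNew) (F * max m₀' m₁' + 1) := ⟨_, rfl⟩
  have k2 : s₄.var vBound = F := ((kv 2 (by decide)).trans h.bound).trans hF.symm
  have k12 : s₄.var vNewCols = m₀' := (kv 12 (by decide)).trans hl.cols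
  have k13 : s₄.var vNewRows = m₁' := (kv 13 (by decide)).trans hl.rows
  refine Cmd.Ends.then (P := fun s' => (s'.var vNew = c ∧ s'.var vCols = m₀' ∧ s'.var vRows = m₁' ∧
      s'.var vMax = max m₀' m₁') ∧ s'.arr = s₄.arr)
    (Cmd.Straight.ends (by simp [resize]) (by simp [resize, Cmd.time, Expr.cost]) ?_) ?_
  · by_cases hlt : m₀' < m₁'
    · simp [resize, k2, k12, k13, hlt, hlt.le, hc, Nat.sub_sub_eq_min]
    · have := le_of_not_gt hlt
      simp [resize, k2, k12, k13, hlt, this, hc, Nat.sub_sub_eq_min]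
  rintro s₅ f₅ ⟨⟨q14, q3, q4, q24⟩, qa⟩
  refine Cmd.Ends.then (P := fun s' => s' = s₅.setVar vPos 0)
    (Cmd.Straight.ends (by simp) (by simp [Cmd.time, Expr.cost]) (by simp)) ?_
  rintro s₆ - hs₆
  have lv : ∀ y, y ∉ [3, 4, 14, 15, 24] → s₆.var y = s₄.var y := fun y hy => by
    simp only [List.mem_cons, List.not_mem_nil, or_false, not_or] at hy
    rw [← f₅.1 y (by simp [resize, hy])]
    simp [hs₆, hy]
  have l14 : s₆.var vNew = c := by simp [hs₆, q14]
  have l3 : s₆.var vCols = m₀' := by simp [hs₆, q3]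
  have l4 : s₆.var vRows = m₁' := by simp [hs₆, q4]
  have l24 : s₆.var vMax = max m₀' m₁' := by simp [hs₆, q24]
  have l15 : s₆.var vPos = 0 := by simp [hs₆]
  have la : s₆.arr = s₄.arr := by simp [hs₆, qa]
  clear f₅ hs₆ q14 q3 q4 q24 qa k2 k12 k13
  refine Cmd.Ends.then (moveLoop_ends (n := n) (t := τ) (N := N) (S := S) (m₀ := m₀) (m₁ := m₁)
    (m₀' := m₀') (m₁' := m₁') (φ := φ) (ψ := ψ)
    (((lv 5 (by decide)).trans (kv 5 (by decide))).trans h.cells)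
    ((((lv 0 (by decide)).trans (kv 0 (by decide))).trans h.len).trans hn.symm)
    (((lv 8 (by decide)).trans (kv 8 (by decide))).trans hτ.symm) l15
    (by rw [la, ka 9 (by decide), ka 10 (by decide)]; exact h.list₂) h.range
    (by rw [hn]; exact h.cols_le) (by rw [hn]; exact h.rows_le)
    (by rw [la, ka 13 (by decide), hφ]) (by rw [la, ka 14 (by decide), hψ]) cφ cψ
    (by rw [la, ka 18 (by decide), hn]; exact h.cleanMark.mono ht.le)
    (by rw [la, ka 18 (by decide)]; exact hz h.cleanMark)) ?_
  rw [la, l14]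
  rintro s₇ f₇ ⟨i₁, i₂⟩
  obtain ⟨S', hS'⟩ : ∃ S', S' = (S.image fun p => (φ p.1, ψ p.2)).filter fun p =>
    s₄.arr aIndex (cellAddr n τ p.1 p.2) ≤ c := ⟨_, rfl⟩
  rw [← hS'] at i₁
  have hcle : c ≤ s₄.var vNew := hc ▸ min_le_left _ _
  have hlist : IsList c (s₄.arr aX1) (s₄.arr aY1) S' := by
    rw [hS']
    exact j₂.take hcle (fun p => s₄.arr aIndex (cellAddr n τ p.1 p.2)) j₅
  -- Both lists enumerate `S'`, so they have the same length although they were shortened in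
  -- different ways.
  have hpos : s₇.var vPos = c := by
    rw [← i₁.card, Finset.card_image_of_injective _ Prod.swap_injective, hlist.card]
  rw [hpos] at i₁
  have ov : ∀ y, y ∉ [11, 15, 16, 17] → s₇.var y = s₆.var y := fun y hy => by
    simp only [List.mem_cons, List.not_mem_nil, or_false, not_or] at hy
    exact f₇.1 y (by simp [moveBody, hy])
  have oa : ∀ a, a ∉ [9, 10, 18] → s₇.arr a = s₄.arr a := fun a ha => by
    simp only [List.mem_cons, List.not_mem_nil, or_false, not_or] at ha
    rw [← la]
    exact f₇.2 a (by simp [moveBody, ha])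
  refine Cmd.Straight.ends (by simp) (by simp [Cmd.time, Expr.cost]) ⟨c, S', ?_⟩
  obtain ⟨s₈, hs₈⟩ : ∃ s₈, s₈ = (Cmd.assign vCells !ₑvNew).exec s₇ := ⟨_, rfl⟩
  rw [← hs₈]
  have z5 : s₈.var vCells = c := by
    simp only [hs₈, Cmd.exec, Store.setVar, Expr.eval, Function.update_self]
    rw [ov 14 (by decide), l14]
  have zv : ∀ y, y ≠ 5 → s₈.var y = s₇.var y := fun y hy => by simp [hs₈, hy]
  have za : s₈.arr = s₇.arr := by simp [hs₈]
  clear hs₈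
  have hmem : ∀ p ∈ S', ∃ q ∈ S, φ q.1 = p.1 ∧ ψ q.2 = p.2 := by
    intro p hp
    rw [hS', Finset.mem_filter] at hp
    obtain ⟨q, hq, rfl⟩ := Finset.mem_image.mp hp.1
    exact ⟨q, hq, rfl, rfl⟩
  refine
    { len := ?_, grid := ?_, bound := ?_, cols := ?_, rows := ?_, size := ?_, cells := z5,
      cols_pos := cφ.pos', cols_le := ?_, rows_pos := cψ.pos', rows_le := ?_, cells_le := ?_,
      cells_le_length := ?_, list₁ := ?_, list₂ := ?_, range := ?_, layoutX := ?_, layoutY := ?_,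
      point := ?_, cleanIndex := ?_, cleanMark := ?_, tracks := ?_ }
  · rw [zv 0 (by decide), ov 0 (by decide), lv 0 (by decide), kv 0 (by decide), h.len]
  · rw [zv 1 (by decide), ov 1 (by decide), lv 1 (by decide), kv 1 (by decide), h.grid]
  · rw [zv 2 (by decide), ov 2 (by decide), lv 2 (by decide), kv 2 (by decide), h.bound]
  · rw [zv 3 (by decide), ov 3 (by decide), l3]
  · rw [zv 4 (by decide), ov 4 (by decide), l4]
  · rw [zv 24 (by decide), ov 24 (by decide), l24]
  · exact (cφ.last ▸ cφ.le_self cφ.pos le_rfl).trans h.cols_le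
  · exact (cψ.last ▸ cψ.le_self cψ.pos le_rfl).trans h.rows_le
  · rw [← hF, hc]; exact min_le_right _ _
  · exact (hcle.trans j₁).trans h.cells_le_length
  · rw [za, oa 6 (by decide), oa 7 (by decide)]; exact hlist
  · rw [za]; exact i₁
  · intro p hp
    obtain ⟨q, hq, h₁, h₂⟩ := hmem p hp
    obtain ⟨⟨r₁, r₂⟩, r₃, r₄⟩ := h.range q hq
    rw [← h₁, ← h₂]
    exact ⟨⟨cφ.one_le r₁ r₂, cφ.le r₁ r₂⟩, cψ.one_le r₃ r₄, cψ.le r₃ r₄⟩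
  · rw [za, oa 15 (by decide)]; exact hL₀.layout cφ h.layoutX
  · rw [za, oa 16 (by decide)]; exact hL₁.layout cψ h.layoutY
  · intro p hp
    obtain ⟨q, hq, h₁, h₂⟩ := hmem p hp
    obtain ⟨⟨r₁, r₂⟩, r₃, r₄⟩ := h.range q hq
    obtain ⟨i, hi, ⟨p₁, p₂⟩, p₃, p₄⟩ := h.point q hq
    rw [za, oa 15 (by decide), oa 16 (by decide), ← h₁, ← h₂]
    obtain ⟨c₁, c₂⟩ := hL₀.contains cφ h.layoutX r₁ r₂
    obtain ⟨c₃, c₄⟩ := hL₁.contains cψ h.layoutY r₃ r₄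
    exact ⟨i, hi, ⟨c₁.trans p₁, p₂.trans_le c₂⟩, c₃.trans p₃, p₄.trans_le c₄⟩
  · rw [za, oa 17 (by decide), ← hn]; exact j₃
  · rw [za, ← hn]; exact i₂
  · intro hN
    rw [← hF] at hN ⊢
    -- A list that was cut has `F * max m₀' m₁' + 1` entries, which `hN` excludes. So no cell was
    -- lost.
    have hcN : c = s₄.var vNew := by omega
    have hmain : N ≤ F * max m₀ m₁ ∧ (∀ X, (S.filter fun p => φ p.1 = X).card ≤ 4 * F) ∧
        ∀ Y, (S.filter fun p => ψ p.2 = Y).card ≤ 4 * F := by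
      rcases hmode with hd | hd
      · rw [j₂.card] at hd; omega
      · exact hd
    have hall : ∀ q ∈ S, (φ q.1, ψ q.2) ∈ S' := by
      intro q hq
      have hi : (φ q.1, ψ q.2) ∈ S.image fun p => (φ p.1, ψ p.2) :=
        Finset.mem_image_of_mem (fun p => (φ p.1, ψ p.2)) hq
      rw [hS', Finset.mem_filter]
      exact ⟨hi, hcN ▸ (j₄ _ hi).2.1⟩
    have htr := h.tracks (hF ▸ hmain.1)
    refine ⟨⟨fun X h₁ h₂ => ?_, fun Y h₁ h₂ => ?_⟩, ?_⟩
    · obtain ⟨x, x₁, x₂, rfl⟩ := cφ.surj h₁ h₂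
      obtain ⟨p, hp, rfl⟩ := htr.1.1 x x₁ x₂
      exact ⟨_, hall p hp, rfl⟩
    · obtain ⟨y, y₁, y₂, rfl⟩ := cψ.surj h₁ h₂
      obtain ⟨p, hp, rfl⟩ := htr.1.2 y y₁ y₂
      exact ⟨_, hall p hp, rfl⟩
    · rw [za, zv 6 (by decide), ov 6 (by decide), lv 6 (by decide), zv 7 (by decide),
        ov 7 (by decide), lv 7 (by decide), oa 2 (by decide), oa 3 (by decide), oa 4 (by decide),
        oa 6 (by decide), oa 7 (by decide), oa 8 (by decide), oa 15 (by decide), oa 16 (by decide),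
        hcN]
      exact j₆ hmain

/-- The auxiliary tables are ready for the next round. -/
structure Tables (n t : ℕ) (s : Store) : Prop where
  labX : s.arr aLabX 0 = 0
  labY : s.arr aLabY 0 = 0
  endX : s.arr aEndX 0 = 0
  endY : s.arr aEndY 0 = 0
  cleanNode : Clean n t (s.arr aNode)
  cleanDepth : Clean n t (s.arr aDepth)
  cleanLast : Clean n t (s.arr aLastU)
  fresh : FreshTrie n (s.var vNodes) (s.arr aChild) (s.arr aHits)

theorem Cells.mem₁ {π : Permutation} {r m₀ m₁ N t : ℕ} {S : Finset (ℕ × ℕ)} {s : Store}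
    (h : Cells π r m₀ m₁ N t S s) (j : ℕ) (h₁ : 1 ≤ j) (h₂ : j ≤ N) :
    (s.arr aX1 j, s.arr aY1 j) ∈ S :=
  (h.list₁.mem _).mpr ⟨j, h₁, h₂, rfl, rfl⟩

theorem Cells.mem₂ {π : Permutation} {r m₀ m₁ N t : ℕ} {S : Finset (ℕ × ℕ)} {s : Store}
    (h : Cells π r m₀ m₁ N t S s) (j : ℕ) (h₁ : 1 ≤ j) (h₂ : j ≤ N) :
    (s.arr aX2 j, s.arr aY2 j) ∈ S := by
  have : (s.arr aY2 j, s.arr aX2 j) ∈ S.image Prod.swap :=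
    (h.list₂.mem _).mpr ⟨j, h₁, h₂, rfl, rfl⟩
  obtain ⟨⟨a, b⟩, hp, he⟩ := Finset.mem_image.mp this
  obtain ⟨rfl, rfl⟩ := Prod.mk.inj he
  exact hp

theorem greedyLabels_ends {π : Permutation} {r m₀ m₁ N t t' : ℕ} {S : Finset (ℕ × ℕ)} {s : Store}
    (h : Cells π r m₀ m₁ N t S s) (hT : Tables π.length t' s)
    (hN : N ≤ min (gridBound r) π.length * max m₀ m₁) :
    greedyLabels.Ends s (30 * N + 50 * (m₀ + m₁) + 110) fun s' =>
      ∃ m₀' m₁', Labels m₀ m₁ m₀' m₁' s' ∧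
        (2 * min (gridBound r) π.length * (m₀' - 1) < N ∧
          2 * min (gridBound r) π.length * (m₁' - 1) < N) ∧
        (∀ X, (S.filter fun p => s'.arr aLabX p.1 = X).card ≤ 4 * min (gridBound r) π.length) ∧
        (∀ Y, (S.filter fun p => s'.arr aLabY p.2 = Y).card ≤ 4 * min (gridBound r) π.length) ∧
        s'.arr aEndX 0 = 0 ∧ s'.arr aEndY 0 = 0 := by
  obtain ⟨F, hF⟩ : ∃ F, F = min (gridBound r) π.length := ⟨_, rfl⟩
  obtain ⟨⟨nx, ny⟩, htr⟩ := h.tracks hN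
  rw [← hF] at htr ⊢
  have l₁ := h.list₁
  have l₂ := h.list₂
  have hx : ∀ j, 1 ≤ j → j ≤ N → 1 ≤ s.arr aX1 j ∧ s.arr aX1 j ≤ m₀ := fun j h₁ h₂ =>
    (h.range _ (h.mem₁ j h₁ h₂)).1
  have hy : ∀ j, 1 ≤ j → j ≤ N → 1 ≤ s.arr aY2 j ∧ s.arr aY2 j ≤ m₁ := fun j h₁ h₂ =>
    (h.range _ (h.mem₂ j h₁ h₂)).2
  have cx : ∀ P : ℕ → Prop, ∀ _ : DecidablePred P,
      ((Finset.Icc 1 N).filter fun j => P (s.arr aX1 j)).card = (S.filter fun p => P p.1).card :=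
    fun P _ => l₁.card_filter fun p => P p.1
  have cy₁ : ∀ P : ℕ → Prop, ∀ _ : DecidablePred P,
      ((Finset.Icc 1 N).filter fun j => P (s.arr aY1 j)).card = (S.filter fun p => P p.2).card :=
    fun P _ => l₁.card_filter fun p => P p.2
  have cy : ∀ P : ℕ → Prop, ∀ _ : DecidablePred P,
      ((Finset.Icc 1 N).filter fun j => P (s.arr aY2 j)).card = (S.filter fun p => P p.2).card :=
    fun P _ => (l₂.card_filter fun p => P p.1).trans (card_filter_image_swap S _)
  refine Cmd.Ends.mono (T := (N * (20 + 10) + 10) + ((50 * m₀ + 50) + (50 * m₁ + 50))) ?_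
    (by omega) (fun _ _ h => h)
  refine Cmd.Ends.then (endLoop_ends (m₀ := m₀) (m₁ := m₁) h.cells h.pos hT.endX hT.endY hx hy
    l₁.sorted l₂.sorted ?_ ?_) ?_
  · intro x x₁ x₂
    obtain ⟨p, hp, rfl⟩ := nx x x₁ x₂
    obtain ⟨j, j₁, j₂, j₃, -⟩ := (l₁.mem p).mp hp
    exact ⟨j, j₁, j₂, j₃⟩
  · intro y y₁ y₂
    obtain ⟨p, hp, rfl⟩ := ny y y₁ y₂
    obtain ⟨j, j₁, j₂, j₃, -⟩ := (l₂.mem p.swap).mp (Finset.mem_image_of_mem _ hp)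
    exact ⟨j, j₁, j₂, j₃⟩
  rintro s₁ f₁ ⟨eX, eY⟩
  obtain ⟨E₀, hE₀⟩ : ∃ E, E = s₁.arr aEndX := ⟨_, rfl⟩
  obtain ⟨E₁, hE₁⟩ : ∃ E, E = s₁.arr aEndY := ⟨_, rfl⟩
  rw [← hE₀] at eX
  rw [← hE₁] at eY
  -- A single line has at most `4 * F` cells, because they carry distinct rectangles of the current
  -- family.
  have four₀ : ∀ l, l < m₀ → E₀ (l + 1) ≤ E₀ l + 4 * F := by
    intro l hl
    have h₁ := eX.card_filter (a := l + 1) (b := l + 1) (by omega) le_rfl hl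
    have h₂ := (htr.card_le (l + 1)).1
    have h₃ : ((Finset.Icc 1 N).filter fun j => l + 1 ≤ s.arr aX1 j ∧ s.arr aX1 j ≤ l + 1) =
      (Finset.Icc 1 N).filter fun j => s.arr aX1 j = l + 1 :=
        Finset.filter_congr fun j _ => by omega
    rw [h₃] at h₁
    simp only [Nat.add_sub_cancel] at h₁
    omega
  have four₁ : ∀ l, l < m₁ → E₁ (l + 1) ≤ E₁ l + 4 * F := by
    intro l hl
    have h₁ := eY.card_filter (a := l + 1) (b := l + 1) (by omega) le_rfl hl
    have h₂ := (htr.card_le (l + 1)).2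
    have h₃ : ((Finset.Icc 1 N).filter fun j => l + 1 ≤ s.arr aY2 j ∧ s.arr aY2 j ≤ l + 1) =
      (Finset.Icc 1 N).filter fun j => s.arr aY2 j = l + 1 :=
        Finset.filter_congr fun j _ => by omega
    -- `E₁` comes from the second list, the bound from the first one; both count the cells of `S` in
    -- row `l + 1`.
    rw [h₃, cy (fun y => y = l + 1) inferInstance] at h₁
    rw [cy₁ (fun y => y = l + 1) inferInstance] at h₂
    simp only [Nat.add_sub_cancel] at h₁
    omega
  refine Cmd.Ends.then (greedy_ends (M := m₀) (F := F) ((f₁.1 3 (by decide)).trans h.cols)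
    (((f₁.1 2 (by decide)).trans h.bound).trans hF.symm) h.cols_pos (by decide) (by decide)
    (by decide) (by rw [f₁.2 13 (by decide)]; exact hT.labX) (by rw [← hE₀]; exact eX.1)
    (by rw [← hE₀]; exact eX.2.2.1) (by rw [← hE₀]; exact four₀)) ?_
  rw [← hE₀]
  rintro s₂ f₂ ⟨g₁, g₂, g₃⟩
  have a12 : s₂.arr aEndY = E₁ := (f₂.2 12 (by decide)).trans hE₁.symm
  refine Cmd.Ends.mono (greedy_ends (M := m₁) (F := F)
    ((f₂.1 4 (by decide)).trans ((f₁.1 4 (by decide)).trans h.rows))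
    (((f₂.1 2 (by decide)).trans ((f₁.1 2 (by decide)).trans h.bound)).trans hF.symm) h.rows_pos
    (by decide) (by decide) (by decide)
    (by rw [f₂.2 14 (by decide), f₁.2 14 (by decide)]; exact hT.labY) (by rw [a12]; exact eY.1)
    (by rw [a12]; exact eY.2.2.1) (by rw [a12]; exact four₁)) le_rfl ?_
  rw [a12]
  rintro s₃ f₃ ⟨k₁, k₂, k₃⟩
  have e12 : s₃.var vNewCols = s₂.var vNewCols := f₃.1 12 (by decide)
  have e13 : s₃.arr aLabX = s₂.arr aLabX := f₃.2 13 (by decide)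
  refine ⟨s₂.var vNewCols, s₃.var vNewRows, ⟨e12, rfl, by rw [e13]; exact g₁, k₁⟩,
    ⟨by rw [eX.2.1] at g₂; exact g₂, by rw [eY.2.1] at k₂; exact k₂⟩, fun X => ?_,
    fun Y => ?_, ?_, ?_⟩
  · rw [e13, ← cx (fun x => s₂.arr aLabX x = X) inferInstance]
    exact eX.card_fiber_le hx g₃ X
  · rw [← cy (fun y => s₃.arr aLabY y = Y) inferInstance]
    exact eY.card_fiber_le hy k₃ Y
  · rw [f₃.2 11 (by decide), f₂.2 11 (by decide), ← hE₀, eX.1]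
  · rw [f₃.2 12 (by decide), a12, eY.1]

/-- If the minimum were `n`, density would mean more than `n` nonempty cells. The cap at `n` thus
never affects a dense round. -/
theorem Cells.bound_eq {π : Permutation} {r m₀ m₁ N t : ℕ} {S : Finset (ℕ × ℕ)} {s : Store}
    (h : Cells π r m₀ m₁ N t S s) (hN : min (gridBound r) π.length * max m₀ m₁ < N) :
    min (gridBound r) π.length = gridBound r := by
  refine min_eq_left (le_of_not_gt fun hlt => ?_)
  rw [min_eq_right hlt.le] at hN
  have h₁ := Nat.le_mul_of_pos_right π.length (show 0 < max m₀ m₁ from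
    lt_of_lt_of_le h.cols_pos (le_max_left _ _))
  have h₂ := h.cells_le_length
  omega

theorem Cells.dense {π : Permutation} {r m₀ m₁ N t : ℕ} {S : Finset (ℕ × ℕ)} {s : Store}
    (h : Cells π r m₀ m₁ N t S s) (hr : 1 ≤ r) {a b : ℕ → ℕ}
    (hN : min (gridBound r) π.length * max m₀ m₁ < N)
    (ha : Coarsening m₀ ((m₀ - 1) / (r * r) + 1) a) (hb : Coarsening m₁ ((m₁ - 1) / (r * r) + 1) b)
    (ha' : ∀ x, 1 ≤ x → x ≤ m₀ → a x = (x - 1) / (r * r) + 1)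
    (hb' : ∀ y, 1 ≤ y → y ≤ m₁ → b y = (y - 1) / (r * r) + 1)
    (hwide : ∀ X, ((Finset.Icc 1 ((m₁ - 1) / (r * r) + 1)).filter fun Y => r ≤
      (blockLines (s.arr aX1) (s.arr aY1) a b N X Y).card).card ≤ (r - 1) * (r ^ 2).choose r)
    (htall : ∀ Y, ((Finset.Icc 1 ((m₀ - 1) / (r * r) + 1)).filter fun X => r ≤
      (blockLines (s.arr aY2) (s.arr aX2) b a N Y X).card).card ≤ (r - 1) * (r ^ 2).choose r) :
    2 ≤ r ∧ min (gridBound r) π.length *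
      max ((m₀ - 1) / (r * r) + 1) ((m₁ - 1) / (r * r) + 1) <
        (S.image fun p => (a p.1, b p.2)).card := by
  have hK : 1 ≤ r * r := Nat.mul_pos hr hr
  have hF := h.bound_eq hN
  have hcount := card_le_of_few_wide_blocks (r := r) (w := (r - 1) * (r ^ 2).choose r)
    (a := (m₀ - 1) / (r * r) + 1) (b := (m₁ - 1) / (r * r) + 1) S a b
    (fun p hp => ⟨ha.one_le (h.range p hp).1.1 (h.range p hp).1.2,
      ha.le (h.range p hp).1.1 (h.range p hp).1.2⟩)
    (fun p hp => ⟨hb.one_le (h.range p hp).2.1 (h.range p hp).2.2,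
      hb.le (h.range p hp).2.1 (h.range p hp).2.2⟩)
    (fun X => by
      rw [sq]
      refine (Finset.card_le_card ?_).trans (card_div_fiber_le hK ha' X)
      refine Finset.filter_subset_filter _ fun x hx => ?_
      obtain ⟨p, hp, rfl⟩ := Finset.mem_image.mp hx
      exact Finset.mem_Icc.mpr (h.range p hp).1)
    (fun Y => by
      rw [sq]
      refine (Finset.card_le_card ?_).trans (card_div_fiber_le hK hb' Y)
      refine Finset.filter_subset_filter _ fun y hy => ?_
      obtain ⟨p, hp, rfl⟩ := Finset.mem_image.mp hy
      exact Finset.mem_Icc.mpr (h.range p hp).2)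
    (fun X => by
      have := hwide X
      simp only [h.list₁.blockLines_eq] at this
      exact this)
    (fun Y => by
      have := htall Y
      simp only [h.list₂.blockLines_swap_eq] at this
      exact this)
  rw [h.list₁.card] at hcount
  constructor
  -- For `r = 1` no wide block is allowed and `(r - 1) ^ 2 = 0`, so the count would give `N = 0`. A
  -- dense round without a grid therefore has `r ≥ 2`, and its blocks of `r * r` lines do shrink the
  -- gridding.
  · by_contra hr2
    obtain rfl : r = 1 := by omega
    simp at hcount
    have := h.pos
    omega
  · have hmm : N ≤ max m₀ m₁ * max m₀ m₁ := by
      rw [← h.list₁.card]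
      refine (Finset.card_le_card (t := Finset.Icc 1 m₀ ×ˢ Finset.Icc 1 m₁) fun p hp => ?_).trans ?_
      · have := h.range p hp
        simp only [Finset.mem_product, Finset.mem_Icc]
        exact this
      · rw [Finset.card_product, Nat.card_Icc, Nat.card_Icc]
        exact Nat.mul_le_mul (le_max_left _ _) (le_max_right _ _)
    have hd : ∀ {c}, c ≤ max m₀ m₁ → (c - 1) / (r * r) + 1 ≤ (max m₀ m₁ - 1) / r ^ 2 + 1 := by
      intro c hc
      rw [sq]
      exact Nat.add_le_add_right (Nat.div_le_div_right (by omega)) 1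
    rw [hF] at hN ⊢
    refine lt_of_le_of_lt (Nat.mul_le_mul_left _ (max_le (hd (le_max_left _ _))
      (hd (le_max_right _ _)))) (dense_blocks hr hN hmm (hd (le_max_left _ _))
        (hd (le_max_right _ _)) hcount)

theorem searchGrid_ends {π : Permutation} {r m₀ m₁ N t t' : ℕ} {S : Finset (ℕ × ℕ)} {s : Store}
    (hr : 1 ≤ r) (h : Cells π r m₀ m₁ N t S s) (hT : Tables π.length t' s)
    (ht : t' < s.var vStamp) (hf : s.var vFound = 0)
    (hN : min (gridBound r) π.length * max m₀ m₁ < N) :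
    searchGrid.Ends s (1000 * N + 250 * (m₀ + m₁) + 200 * r + 2000) fun s' =>
      s'.var vFound = 1 ∧ GridBreaks r m₀ m₁ S (s'.arr aBreakX) (s'.arr aBreakY) ∨
      s'.var vFound = 0 ∧ 2 ≤ r ∧ s.var vStamp ≤ s'.var vStamp ∧
        Labels m₀ m₁ ((m₀ - 1) / (r * r) + 1) ((m₁ - 1) / (r * r) + 1) s' ∧
        min (gridBound r) π.length * max ((m₀ - 1) / (r * r) + 1) ((m₁ - 1) / (r * r) + 1) <
          (S.image fun p => (s'.arr aLabX p.1, s'.arr aLabY p.2)).card ∧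
        Tables π.length (s'.var vStamp) s' := by
  have hK : 1 ≤ r * r := Nat.mul_pos hr hr
  refine Cmd.Ends.mono (T := (50 * m₀ + 50) + ((50 * m₁ + 50) + ((500 * N + 500) + (1 + 1 +
    (5 + ((500 * N + 500) + (1 + 1 + (200 * (r + (m₀ + m₁)) + 200)))))))) ?_ (by omega)
    (fun _ _ h => h)
  refine Cmd.Ends.then (blocks_ends h.cols h.grid (by decide) h.cols_pos hT.labX) ?_
  rintro s₁ f₁ ⟨b₁, b₂, b₃⟩
  refine Cmd.Ends.then (blocks_ends (M := m₁) (r := r) ((f₁.1 4 (by decide)).trans h.rows)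
    ((f₁.1 1 (by decide)).trans h.grid) (by decide) h.rows_pos
    (by rw [f₁.2 14 (by decide)]; exact hT.labY)) ?_
  rintro s₂ f₂ ⟨c₁, c₂, c₃⟩
  have e13 : s₂.arr aLabX = s₁.arr aLabX := f₂.2 13 (by decide)
  have e12 : s₂.var vNewCols = (m₀ - 1) / (r * r) + 1 := (f₂.1 12 (by decide)).trans b₁
  rw [← e13] at b₂ b₃
  have fv : ∀ y, y ∉ [11, 12, 13] → s₂.var y = s.var y := fun y hy => by
    simp only [List.mem_cons, List.not_mem_nil, or_false, not_or] at hy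
    rw [f₂.1 y (by simp [blocks, blockBody, hy]), f₁.1 y (by simp [blocks, blockBody, hy])]
  have fa : ∀ a, a ∉ [13, 14] → s₂.arr a = s.arr a := fun a ha => by
    simp only [List.mem_cons, List.not_mem_nil, or_false, not_or] at ha
    rw [f₂.2 a (by simp [blocks, blockBody, ha]), f₁.2 a (by simp [blocks, blockBody, ha])]
  clear f₁ f₂ b₁ e13
  have h₂ : Cells π r m₀ m₁ N t S s₂ := h.congr (fun y hy => fv y fun hm => by
    simp only [List.mem_cons, List.not_mem_nil, or_false] at hy hm; omega) (fun a ha => fa a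
      fun hm => by simp only [List.mem_cons, List.not_mem_nil, or_false] at ha hm; omega)
  obtain ⟨a, ha⟩ : ∃ a, a = s₂.arr aLabX := ⟨_, rfl⟩
  obtain ⟨b, hb⟩ : ∃ b, b = s₂.arr aLabY := ⟨_, rfl⟩
  obtain ⟨u, hu⟩ : ∃ u, u = s₂.arr aX1 := ⟨_, rfl⟩
  obtain ⟨v, hv⟩ : ∃ v, v = s₂.arr aY1 := ⟨_, rfl⟩
  have d₀ := card_div_fiber_le hK b₃
  have d₁ := card_div_fiber_le hK c₃
  refine Cmd.Ends.then (wide_ends (N := N) (M := m₀) (Mv := m₁) hr h₂.len rfl h₂.grid h₂.cells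
    ((fv 9 (by decide)).trans hf) (by decide) (by decide) (by decide) (by decide) hu.symm hv.symm
    ha.symm hb.symm
    (fun j j₁ j₂ => hu ▸ (h₂.range _ (h₂.mem₁ j j₁ j₂)).1)
    (fun j j₁ j₂ => hv ▸ (h₂.range _ (h₂.mem₁ j j₁ j₂)).2) h₂.cols_le h₂.rows_le
    (by rw [ha]; exact b₂) (by rw [hb]; exact c₂) (by rw [hu]; exact h₂.list₁.sorted)
    (fun X => by rw [sq, ha]; exact d₀ X)
    (by rw [fv 10 (by decide), fa 22 (by decide), fa 25 (by decide)]; exact hT.fresh)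
    (t₀ := t') (by rw [fv 8 (by decide)]; exact ht)
    (by rw [fa 19 (by decide)]; exact hT.cleanNode)
    (by rw [fa 20 (by decide)]; exact hT.cleanDepth)
    (by rw [fa 21 (by decide)]; exact hT.cleanLast)) ?_
  rintro s₃ f₃ ⟨w₁, ⟨w₂, w₃, w₄⟩, w₅⟩
  have gv : ∀ y, y ∉ [9, 10, 11, 16, 17, 20, 21, 22, 23] → s₃.var y = s₂.var y := fun y hy => by
    simp only [List.mem_cons, List.not_mem_nil, or_false, not_or] at hy
    exact f₃.1 y (by simp [wide, wideBody, descend, countLeaf, hy])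
  have ga : ∀ a, a ∉ [19, 20, 21, 22, 23, 24, 25] → s₃.arr a = s₂.arr a := fun a ha => by
    simp only [List.mem_cons, List.not_mem_nil, or_false, not_or] at ha
    exact f₃.2 a (by simp [wide, wideBody, descend, countLeaf, ha])
  clear f₃
  have h₃ : Cells π r m₀ m₁ N t S s₃ := h₂.congr (fun y hy => gv y fun hm => by
    simp only [List.mem_cons, List.not_mem_nil, or_false] at hy hm; omega) (fun a ha => ga a
      fun hm => by simp only [List.mem_cons, List.not_mem_nil, or_false] at ha hm; omega)
  have g8 : s₃.var vStamp = s₂.var vStamp := gv 8 (by decide)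
  refine Cmd.Ends.ite (fun hne => ?_) (fun heq => ?_)
  · simp only [Expr.eval] at hne
    obtain ⟨k₁, k₂⟩ : s₃.var vFound = 1 ∧
        LeafInfo π.length r (s₂.var vStamp) (blockLines u v a b N) s₃ := by
      rcases w₅ with w | w
      · exact absurd w.1 hne
      · exact w
    refine Cmd.Ends.mono (extract_ends (M := m₀) (Mv := m₁) (S := S) hr h₃.len g8 h₃.grid h₃.cols
      h₃.rows (by decide) (by decide) (by decide) (by decide)
      (by rw [ga 14 (by decide)]; exact hb.symm) (by rw [hu, hv]; exact h₂.list₁) h₃.range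
      h₃.rows_le (by rw [hb]; exact c₂) k₂) (by omega) ?_
    intro s₄ f₄ k₃
    exact Or.inl ⟨(f₄.1 9 (by decide)).trans k₁, k₃⟩
  · simp only [Expr.eval] at heq
    have hwide := (w₅.resolve_right fun w => by omega).2
    refine Cmd.Ends.then (P := fun s' => s' = s₃.setVar vStamp (s₂.var vStamp + 1))
      (Cmd.Straight.ends (by simp) (by simp [Cmd.time, Expr.cost]) (by simp [g8])) ?_
    rintro s₄ - hs₄
    have iv : ∀ y, y ≠ 8 → s₄.var y = s₃.var y := fun y hy => by simp [hs₄, hy]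
    have i8 : s₄.var vStamp = s₂.var vStamp + 1 := by simp [hs₄]
    have ia : s₄.arr = s₃.arr := by simp [hs₄]
    clear hs₄
    have h₄ : Cells π r m₀ m₁ N t S s₄ := h₃.congr (fun y hy => iv y fun hm => by
      simp only [List.mem_cons, List.not_mem_nil, or_false] at hy; omega) (fun a _ => by rw [ia])
    obtain ⟨x, hx⟩ : ∃ x, x = s₄.arr aX2 := ⟨_, rfl⟩
    obtain ⟨y, hy⟩ : ∃ y, y = s₄.arr aY2 := ⟨_, rfl⟩
    have ea : s₄.arr aLabX = a := by rw [ia, ga 13 (by decide), ha]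
    have eb : s₄.arr aLabY = b := by rw [ia, ga 14 (by decide), hb]
    refine Cmd.Ends.then (wide_ends (N := N) (M := m₁) (Mv := m₀) hr h₄.len i8 h₄.grid h₄.cells
      ((iv 9 (by decide)).trans heq) (by decide) (by decide) (by decide) (by decide) hy.symm hx.symm
      eb ea
      (fun j j₁ j₂ => hy ▸ (h₄.range _ (h₄.mem₂ j j₁ j₂)).2)
      (fun j j₁ j₂ => hx ▸ (h₄.range _ (h₄.mem₂ j j₁ j₂)).1) h₄.rows_le h₄.cols_le
      (by rw [hb]; exact c₂) (by rw [ha]; exact b₂) (by rw [hy]; exact h₄.list₂.sorted)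
      (fun X => by rw [sq, hb]; exact d₁ X)
      (by rw [iv 10 (by decide), ia]; exact w₁)
      (t₀ := s₂.var vStamp) (by omega)
      (by rw [ia]; exact w₂) (by rw [ia]; exact w₃) (by rw [ia]; exact w₄)) ?_
    rintro s₅ f₅ ⟨y₁, ⟨y₂, y₃, y₄⟩, y₅⟩
    have jv : ∀ y, y ∉ [9, 10, 11, 16, 17, 20, 21, 22, 23] → s₅.var y = s₄.var y := fun y hy => by
      simp only [List.mem_cons, List.not_mem_nil, or_false, not_or] at hy
      exact f₅.1 y (by simp [wide, wideBody, descend, countLeaf, hy])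
    have ja : ∀ a, a ∉ [19, 20, 21, 22, 23, 24, 25] → s₅.arr a = s₄.arr a := fun a ha => by
      simp only [List.mem_cons, List.not_mem_nil, or_false, not_or] at ha
      exact f₅.2 a (by simp [wide, wideBody, descend, countLeaf, ha])
    clear f₅
    have h₅ : Cells π r m₀ m₁ N t S s₅ := h₄.congr (fun y hy => jv y fun hm => by
      simp only [List.mem_cons, List.not_mem_nil, or_false] at hy hm; omega) (fun a ha => ja a
        fun hm => by simp only [List.mem_cons, List.not_mem_nil, or_false] at ha hm; omega)
    refine Cmd.Ends.ite (fun hne => ?_) (fun heq' => ?_)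
    · simp only [Expr.eval] at hne
      obtain ⟨k₁, k₂⟩ : s₅.var vFound = 1 ∧
          LeafInfo π.length r (s₂.var vStamp + 1) (blockLines y x b a N) s₅ := by
        rcases y₅ with w | w
        · exact absurd w.1 hne
        · exact w
      refine Cmd.Ends.mono (extract_ends (M := m₁) (Mv := m₀) (S := S.image Prod.swap) hr h₅.len
        ((jv 8 (by decide)).trans i8) h₅.grid h₅.rows
        h₅.cols (by decide) (by decide) (by decide) (by decide)
        ((ja 13 (by decide)).trans ea) (by rw [hx, hy]; exact h₄.list₂) ?_
        h₅.cols_le (by rw [ha]; exact b₂) k₂) (by omega) ?_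
      · intro p hp
        obtain ⟨q, hq, rfl⟩ := Finset.mem_image.mp hp
        exact (h₅.range q hq).symm
      · intro s₆ f₆ k₃
        exact Or.inl ⟨(f₆.1 9 (by decide)).trans k₁, k₃.swap⟩
    · simp only [Expr.eval] at heq'
      have htall := (y₅.resolve_right fun w => by omega).2
      refine Cmd.Straight.ends (by simp) (by simp [Cmd.time]) (Or.inr ?_)
      simp only [Cmd.exec]
      have e8 : s₅.var vStamp = s₂.var vStamp + 1 := (jv 8 (by decide)).trans i8
      have z13 : s₅.arr aLabX = a := (ja 13 (by decide)).trans ea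
      have z14 : s₅.arr aLabY = b := (ja 14 (by decide)).trans eb
      rw [← ha] at b₂ b₃
      rw [← hb] at c₂ c₃
      have hd := h₂.dense hr hN b₂ c₂ b₃ c₃ (by rw [← hu, ← hv]; exact hwide) (by
        rw [show s₂.arr aY2 = y by rw [hy, ia, ga 10 (by decide)],
          show s₂.arr aX2 = x by rw [hx, ia, ga 9 (by decide)]]
        exact htall)
      refine ⟨heq', hd.1, by rw [e8, fv 8 (by decide)]; omega, ⟨?_, ?_, ?_, ?_⟩, ?_, ?_⟩
      · rw [jv 12 (by decide), iv 12 (by decide), gv 12 (by decide), e12]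
      · rw [jv 13 (by decide), iv 13 (by decide), gv 13 (by decide), c₁]
      · rw [z13]; exact b₂
      · rw [z14]; exact c₂
      · rw [z13, z14]; exact hd.2
      · exact ⟨by rw [z13]; exact b₂.zero, by rw [z14]; exact c₂.zero,
          by rw [ja 11 (by decide), ia, ga 11 (by decide), fa 11 (by decide)]; exact hT.endX,
          by rw [ja 12 (by decide), ia, ga 12 (by decide), fa 12 (by decide)]; exact hT.endY,
          e8 ▸ y₂, e8 ▸ y₃, e8 ▸ y₄, y₁⟩

/-- The invariant of the main loop. -/
def LoopInv (π : Permutation) (r : ℕ) (s : Store) : Prop :=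
  (s.var vFound = 0 ∧ ∃ m₀ m₁ N S, Cells π r m₀ m₁ N (s.var vStamp) S s ∧
    Tables π.length (s.var vStamp) s) ∨
  s.var vFound = 1 ∧ ∃ m₀ m₁ N t S, Cells π r m₀ m₁ N t S s ∧
    GridBreaks r m₀ m₁ S (s.arr aBreakX) (s.arr aBreakY)

/-- A bound for the time that the main loop still takes. -/
def loopPot (s : Store) : ℕ :=
  if s.var vFound = 0 then
    18000 * min (s.var vCells) (s.var vBound * (s.var vMax - 1)) + 12000 * (s.var vMax - 1)
  else 0

theorem le_gridBound (r : ℕ) : r ≤ gridBound r :=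
  (Nat.le_self_pow four_ne_zero r).trans
    (Nat.le_mul_of_pos_right _ (Nat.choose_pos (Nat.le_self_pow two_ne_zero r)))

theorem shrink_of_dense {F N m₀ m₁ K : ℕ} (hK : 2 ≤ K) (hN : F * max m₀ m₁ < N) :
    2 * (max ((m₀ - 1) / K + 1) ((m₁ - 1) / K + 1) - 1) ≤ max m₀ m₁ - 1 ∧
      2 * (F * (max ((m₀ - 1) / K + 1) ((m₁ - 1) / K + 1) - 1)) ≤ N := by
  have hd : ∀ c, 2 * (c / K) ≤ c := fun c =>
    (Nat.mul_le_mul_right _ hK).trans (Nat.mul_div_le c K)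
  have h₀ := hd (m₀ - 1)
  have h₁ := hd (m₁ - 1)
  have h : 2 * (max ((m₀ - 1) / K + 1) ((m₁ - 1) / K + 1) - 1) ≤ max m₀ m₁ - 1 := by omega
  refine ⟨h, ?_⟩
  calc 2 * (F * (max ((m₀ - 1) / K + 1) ((m₁ - 1) / K + 1) - 1))
      = F * (2 * (max ((m₀ - 1) / K + 1) ((m₁ - 1) / K + 1) - 1)) := by ring
    _ ≤ F * max m₀ m₁ := Nat.mul_le_mul_left _ (h.trans (Nat.sub_le _ _))
    _ ≤ N := hN.le

/-- Subtracting 1 from the number of lines makes the halving exact. The second inequality is needed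
because the potential contains a minimum with `N`. -/
theorem shrink_of_sparse {F N m m₀' m₁' : ℕ} (hN : N ≤ F * m) (h₀ : 2 * F * (m₀' - 1) < N)
    (h₁ : 2 * F * (m₁' - 1) < N) :
    2 * (max m₀' m₁' - 1) ≤ m - 1 ∧ 2 * (F * (max m₀' m₁' - 1)) ≤ N := by
  have h : 2 * (F * (max m₀' m₁' - 1)) < N := by
    rw [← mul_assoc]
    rcases max_choice m₀' m₁' with h | h <;> rw [h] <;> assumption
  refine ⟨?_, h.le⟩
  have h' : F * (2 * (max m₀' m₁' - 1)) < F * m := by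
    refine lt_of_le_of_lt (le_of_eq (by ring)) (h.trans_le hN)
  have := lt_of_mul_lt_mul_left h' (Nat.zero_le F)
  omega

/-- Both terms of the potential at least halve. The amount released pays for the round: `m ≤ 2 * (m
- 1)`, and `N ≤ F * m + 1 ≤ 2 * F * (m - 1) + 1` gives `N ≤ 3 * min N (F * (m - 1))`. The minimum is
indispensable: at the start `F * (m - 1)` can be quadratic in `n`, and later `N` itself need not
halve. -/
theorem round_ends {π : Permutation} {r : ℕ} (hr : 1 ≤ r) {s : Store} (hs : LoopInv π r s)
    (hc : roundCond.eval s ≠ 0) :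
    ∃ T, round.Ends s T fun s' => LoopInv π r s' ∧
      loopPot s' + T + roundCond.cost + 1 ≤ loopPot s := by
  have hf : s.var vFound = 0 := by
    rcases hs with h | h
    · exact h.1
    · simp [roundCond, h.1] at hc
  obtain ⟨-, m₀, m₁, N, S, h, hT⟩ := hs.resolve_right fun h => by omega
  obtain ⟨F, hF⟩ : ∃ F, F = min (gridBound r) π.length := ⟨_, rfl⟩
  obtain ⟨m, hm⟩ : ∃ m, m = max m₀ m₁ := ⟨_, rfl⟩
  have hm2 : 2 ≤ m := by
    by_contra hlt
    simp [roundCond, hf, h.size, ← hm] at hc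
    omega
  have hpot : loopPot s = 18000 * min N (F * (m - 1)) + 12000 * (m - 1) := by
    rw [loopPot, if_pos hf, h.cells, h.bound, h.size, ← hF, ← hm]
  have hF1 : 1 ≤ F := hF ▸ h.one_le_bound hr
  have hN1 := h.pos
  have hcells := h.cells_le
  rw [← hF, ← hm] at hcells
  have hFm : F * m = F * (m - 1) + F := by
    rw [← Nat.mul_succ]; congr 1; omega
  have hFm1 : F ≤ F * (m - 1) := Nat.le_mul_of_pos_right _ (by omega)
  refine ⟨5 + ((5 + 1 + (1200 * N + 500 * m + 2000)) + (1 + 1 + (500 * N + 100 * m + 300))), ?_⟩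
  refine Cmd.Ends.then (P := fun s' => s' = s.setVar vStamp (s.var vStamp + 1))
    (Cmd.Straight.ends (by simp) (by simp [Cmd.time, Expr.cost]) (by simp)) ?_
  rintro s₁ - hs₁
  have iv : ∀ y, y ≠ 8 → s₁.var y = s.var y := fun y hy => by simp [hs₁, hy]
  have i8 : s₁.var vStamp = s.var vStamp + 1 := by simp [hs₁]
  have ia : s₁.arr = s.arr := by simp [hs₁]
  clear hs₁
  obtain ⟨t, ht⟩ : ∃ t, t = s.var vStamp := ⟨_, rfl⟩
  rw [← ht] at i8 h hT
  have h₁ : Cells π r m₀ m₁ N t S s₁ := h.congr (fun y hy => iv y fun hm => by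
      simp only [List.mem_cons, List.not_mem_nil, or_false] at hy; omega) (fun a _ => by rw [ia])
  have hT₁ : Tables π.length t s₁ := by
    obtain ⟨a₁, a₂, a₃, a₄, a₅, a₆, a₇, a₈⟩ := hT
    rw [← ia] at a₁ a₂ a₃ a₄ a₅ a₆ a₇ a₈
    rw [← iv 10 (by decide)] at a₈
    exact ⟨a₁, a₂, a₃, a₄, a₅, a₆, a₇, a₈⟩
  have f₁ : s₁.var vFound = 0 := (iv 9 (by decide)).trans hf
  refine Cmd.Ends.then (P := fun s' => Cells π r m₀ m₁ N t S s' ∧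
    (s'.var vFound = 1 ∧ GridBreaks r m₀ m₁ S (s'.arr aBreakX) (s'.arr aBreakY) ∨
      s'.var vFound = 0 ∧ t < s'.var vStamp ∧ ∃ m₀' m₁', Labels m₀ m₁ m₀' m₁' s' ∧
        Tables π.length (s'.var vStamp) s' ∧
        (2 * (max m₀' m₁' - 1) ≤ m - 1 ∧ 2 * (F * (max m₀' m₁' - 1)) ≤ N) ∧
        (F * max m₀' m₁' < (S.image fun p => (s'.arr aLabX p.1, s'.arr aLabY p.2)).card ∨
          N ≤ F * m ∧ (∀ X, (S.filter fun p => s'.arr aLabX p.1 = X).card ≤ 4 * F) ∧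
            ∀ Y, (S.filter fun p => s'.arr aLabY p.2 = Y).card ≤ 4 * F)))
    (Cmd.Ends.ite (fun hne => ?_) (fun heq => ?_)) ?_
  · have hN : F * m < N := by
      by_contra hlt
      simp only [Expr.eval, BinOp.eval, h₁.bound, h₁.size, h₁.cells, ← hF, ← hm, if_neg hlt] at hne
      exact hne rfl
    -- The search takes time proportional to `r` as well; since `r ≤ gridBound r = F ≤ F * m < N`,
    -- the time bound does not depend on `r`.
    have hrN : r ≤ N := by
      have h₁ := le_gridBound r
      rw [← h.bound_eq (hF ▸ hm ▸ hN), ← hF] at h₁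
      omega
    refine Cmd.Ends.mono (searchGrid_ends hr h₁ hT₁ (by omega) f₁ (hF ▸ hm ▸ hN)) (by omega) ?_
    intro s₂ f₂ k
    have h₂ : Cells π r m₀ m₁ N t S s₂ := h₁.congr
      (fun y hy => f₂.1 y
        ((by decide : ∀ y ∈ [0, 1, 2, 3, 4, 5, 6, 7, 24], y ∉ searchGrid.wv) y hy))
      (fun a ha => f₂.2 a ((by decide : ∀ a ∈ [2, 3, 4, 6, 7, 8, 9, 10, 15, 16, 17, 18],
        a ∉ searchGrid.wa) a ha))
    rcases k with ⟨k₁, k₂⟩ | ⟨k₁, k₂, k₃, k₄, k₅, k₆⟩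
    · exact ⟨h₂, Or.inl ⟨k₁, k₂⟩⟩
    · refine ⟨h₂, Or.inr ⟨k₁, by omega, _, _, k₄, k₆, ?_, Or.inl (hF ▸ k₅)⟩⟩
      have := shrink_of_dense (F := F) (m₀ := m₀) (m₁ := m₁) (N := N) (K := r * r) (by nlinarith)
        (hm ▸ hN)
      rw [hm]
      exact this
  · have hN : N ≤ F * m := by
      by_contra hlt
      simp [h₁.bound, h₁.size, h₁.cells, ← hF, ← hm] at heq
      omega
    refine Cmd.Ends.mono (greedyLabels_ends h₁ hT₁ (hF ▸ hm ▸ hN)) (by omega) ?_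
    rintro s₂ f₂ ⟨m₀', m₁', k₁, k₂, k₃, k₄, k₅, k₆⟩
    have h₂ : Cells π r m₀ m₁ N t S s₂ := h₁.congr
      (fun y hy => f₂.1 y
        ((by decide : ∀ y ∈ [0, 1, 2, 3, 4, 5, 6, 7, 24], y ∉ greedyLabels.wv) y hy))
      (fun a ha => f₂.2 a ((by decide : ∀ a ∈ [2, 3, 4, 6, 7, 8, 9, 10, 15, 16, 17, 18],
        a ∉ greedyLabels.wa) a ha))
    have e8 : s₂.var vStamp = t + 1 := (f₂.1 8 (by decide)).trans i8
    rw [← hF] at k₂ k₃ k₄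
    refine ⟨h₂, Or.inr ⟨(f₂.1 9 (by decide)).trans f₁, by omega, m₀', m₁', k₁, ?_,
      shrink_of_sparse hN k₂.1 k₂.2, Or.inr ⟨hN, k₃, k₄⟩⟩⟩
    exact ⟨k₁.coarseX.zero, k₁.coarseY.zero, k₅, k₆,
      by rw [f₂.2 19 (by decide), e8]; exact hT₁.cleanNode.mono (by omega),
      by rw [f₂.2 20 (by decide), e8]; exact hT₁.cleanDepth.mono (by omega),
      by rw [f₂.2 21 (by decide), e8]; exact hT₁.cleanLast.mono (by omega),
      by rw [f₂.2 22 (by decide), f₂.2 25 (by decide), f₂.1 10 (by decide)]; exact hT₁.fresh⟩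
  · rintro s₂ - ⟨h₂, k⟩
    refine Cmd.Ends.ite (fun hne => ?_) (fun heq => ?_)
    · simp only [Expr.eval] at hne
      obtain ⟨k₁, k₂⟩ := k.resolve_right fun k => hne k.1
      refine Cmd.Straight.ends (by simp) (by simp only [Cmd.time]; omega) ?_
      simp only [Cmd.exec]
      refine ⟨Or.inr ⟨k₁, m₀, m₁, N, t, S, h₂, k₂⟩, ?_⟩
      rw [hpot, loopPot, if_neg (by omega), show roundCond.cost = 7 from rfl]
      omega
    · simp only [Expr.eval] at heq
      obtain ⟨-, h8, m₀', m₁', k₁, k₂, ⟨k₃, k₄⟩, k₅⟩ := k.resolve_left fun k => by omega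
      clear k
      refine Cmd.Ends.mono (contract_ends h₂ h8 k₁ (by rw [← hF, ← hm]; exact k₅)) (by omega) ?_
      rintro s₃ f₃ ⟨N', S', h₃⟩
      have g9 : s₃.var vFound = 0 := (f₃.1 9 (by decide)).trans heq
      have g8 : s₃.var vStamp = s₂.var vStamp := f₃.1 8 (by decide)
      refine ⟨Or.inl ⟨g9, m₀', m₁', N', S', by rw [g8]; exact h₃, ?_⟩, ?_⟩
      · obtain ⟨a₁, a₂, a₃, a₄, a₅, a₆, a₇, a₈⟩ := k₂
        rw [g8]
        exact ⟨by rw [f₃.2 13 (by decide)]; exact a₁, by rw [f₃.2 14 (by decide)]; exact a₂,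
          by rw [f₃.2 11 (by decide)]; exact a₃, by rw [f₃.2 12 (by decide)]; exact a₄,
          by rw [f₃.2 19 (by decide)]; exact a₅, by rw [f₃.2 20 (by decide)]; exact a₆,
          by rw [f₃.2 21 (by decide)]; exact a₇,
          by rw [f₃.2 22 (by decide), f₃.2 25 (by decide), f₃.1 10 (by decide)]; exact a₈⟩
      · rw [hpot, loopPot, if_pos g9, h₃.cells, h₃.bound, h₃.size, ← hF,
          show roundCond.cost = 7 from rfl]
        have k₆ : 2 * (F * (max m₀' m₁' - 1)) ≤ F * (m - 1) := by
          rw [mul_left_comm]; exact Nat.mul_le_mul_left _ k₃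
        omega

/-! ### The beginning and the end of the algorithm -/

theorem Permutation.eq_of_coord {π : Permutation} {i j : ℕ} (hi : i ∈ π.S) (hj : j ∈ π.S)
    (α : Fin 2) (h : π.P i α = π.P j α) : i = j := by
  by_contra hne
  exact π.general i hi j hj hne α h

theorem init_ends {π : Permutation} {r : ℕ} (hr : 1 ≤ r) (hπ : π.Reduced) (hn : 1 ≤ π.length) :
    (computeBound ;; initLists).Ends (inputStore π r) (300 * π.length + 300) fun s =>
      LoopInv π r s ∧ loopPot s ≤ 30000 * π.length := by
  obtain ⟨hS, hP⟩ := hπ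
  have hmem : ∀ i, i ∈ π.S ↔ 1 ≤ i ∧ i ≤ π.length := fun i => by
    conv_lhs => rw [hS]
    exact Finset.mem_Icc
  have z : ∀ a, 2 ≤ a → ∀ i, (inputStore π r).arr a i = 0 := fun a ha i => by
    simp only [inputStore, if_neg (show a ≠ 0 by omega), if_neg (show a ≠ 1 by omega), ite_self]
  have zv : ∀ y, 2 ≤ y → (inputStore π r).var y = 0 := fun y hy => by
    simp only [inputStore, if_neg (show y ≠ 0 by omega), if_neg (show y ≠ 1 by omega)]
  have p0 : ∀ i, 1 ≤ i → i ≤ π.length → (inputStore π r).arr 0 i = π.P i 0 := fun i h₁ h₂ => by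
    simp [inputStore, (hmem i).mpr ⟨h₁, h₂⟩]
  have p1 : ∀ i, 1 ≤ i → i ≤ π.length → (inputStore π r).arr 1 i = π.P i 1 := fun i h₁ h₂ => by
    simp [inputStore, (hmem i).mpr ⟨h₁, h₂⟩]
  refine Cmd.Ends.mono (T := (100 * π.length + 100) + (200 * π.length + 200)) ?_ (by omega)
    (fun _ _ h => h)
  refine Cmd.Ends.then (computeBound_ends (n := π.length) (r := r) rfl rfl hn hr) ?_
  intro s₁ f₁ hb
  have fa : s₁.arr = (inputStore π r).arr := funext fun a => f₁.2 a
    (by rw [show computeBound.wa = [] from rfl]; simp)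
  have q0 : ∀ i, 1 ≤ i → i ≤ π.length → s₁.arr 0 i = π.P i 0 := by rw [fa]; exact p0
  have q1 : ∀ i, 1 ≤ i → i ≤ π.length → s₁.arr 1 i = π.P i 1 := by rw [fa]; exact p1
  refine Cmd.Ends.mono (initLists_ends (n := π.length) ((f₁.1 0 (by decide)).trans rfl) ?_ ?_ ?_ ?_)
    le_rfl ?_
  · intro i h₁ h₂; rw [q0 i h₁ h₂]; exact hP i ((hmem i).mpr ⟨h₁, h₂⟩) 0
  · intro i h₁ h₂; rw [q1 i h₁ h₂]; exact hP i ((hmem i).mpr ⟨h₁, h₂⟩) 1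
  · intro i hi j hj he
    simp only [Finset.coe_Icc, Set.mem_Icc] at hi hj
    rw [q0 i hi.1 hi.2, q0 j hj.1 hj.2] at he
    exact Permutation.eq_of_coord ((hmem i).mpr hi) ((hmem j).mpr hj) 0 he
  · intro i hi j hj he
    simp only [Finset.coe_Icc, Set.mem_Icc] at hi hj
    rw [q1 i hi.1 hi.2, q1 j hj.1 hj.2] at he
    exact Permutation.eq_of_coord ((hmem i).mpr hi) ((hmem j).mpr hj) 1 he
  rintro s f₂ ⟨⟨v3, v4, v24, v5, v7⟩, l₁, l₂, l₃⟩
  have hid : ∀ x, 1 ≤ x → x ≤ π.length → s.arr aId x ∈ π.S ∧ π.P (s.arr aId x) 0 = x ∧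
      s.arr aX1 x = x ∧ s.arr aY1 x = π.P (s.arr aId x) 1 := by
    intro x h₁ h₂
    obtain ⟨k₁, k₂, k₃, k₄, k₅⟩ := l₁ x h₁ h₂
    rw [q0 _ k₄ k₅] at k₃
    rw [q1 _ k₄ k₅] at k₂
    exact ⟨(hmem _).mpr ⟨k₄, k₅⟩, k₃, k₁, k₂⟩
  have hidP : ∀ i ∈ π.S, s.arr aId (π.P i 0) = i := by
    intro i hi
    obtain ⟨h₁, h₂⟩ := hP i hi 0
    obtain ⟨k₁, k₂, -⟩ := hid _ h₁ h₂
    exact Permutation.eq_of_coord k₁ hi 0 k₂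
  have hx2 : ∀ i ∈ π.S, s.arr aY2 (π.P i 1) = π.P i 1 ∧ s.arr aX2 (π.P i 1) = π.P i 0 := by
    intro i hi
    obtain ⟨h₁, h₂⟩ := hP i hi 1
    obtain ⟨k₁, j, j₁, j₂, j₃, j₄⟩ := l₂ _ h₁ h₂
    rw [q1 _ j₁ j₂] at j₃
    obtain rfl := Permutation.eq_of_coord ((hmem j).mpr ⟨j₁, j₂⟩) hi 1 j₃
    rw [q0 _ j₁ j₂] at j₄
    exact ⟨k₁, j₄⟩
  have hy2 : ∀ y, 1 ≤ y → y ≤ π.length → ∃ i ∈ π.S, π.P i 1 = y := by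
    intro y h₁ h₂
    obtain ⟨-, j, j₁, j₂, j₃, -⟩ := l₂ y h₁ h₂
    rw [q1 _ j₁ j₂] at j₃
    exact ⟨j, (hmem j).mpr ⟨j₁, j₂⟩, j₃⟩
  have vv : ∀ y, y ∉ [2, 3, 4, 5, 7, 11, 19, 24] → s.var y = (inputStore π r).var y :=
    fun y hy => by
    simp only [List.mem_cons, List.not_mem_nil, or_false, not_or] at hy
    rw [f₂.1 y (by simp [initLists, invertBody, listBody, initTail, hy]),
      f₁.1 y (by simp [computeBound, binomBody, hy])]
  have az : ∀ a, a ∉ [0, 1, 6, 7, 8, 9, 10, 15, 16, 28, 29] → ∀ i, s.arr a i = 0 :=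
    fun a ha i => by
    simp only [List.mem_cons, List.not_mem_nil, or_false, not_or] at ha
    rw [f₂.2 a (by simp [initLists, invertBody, listBody, initTail, ha]), fa, z a (by omega)]
  have v9 : s.var vFound = 0 := (vv 9 (by decide)).trans (zv 9 (by decide))
  have v8 : s.var vStamp = 0 := (vv 8 (by decide)).trans (zv 8 (by decide))
  have v2 : s.var vBound = min (gridBound r) π.length := (f₂.1 2 (by decide)).trans hb
  have hF : 1 ≤ min (gridBound r) π.length := le_min (hr.trans (le_gridBound r)) hn
  have hclean : ∀ a, a ∉ [0, 1, 6, 7, 8, 9, 10, 15, 16, 28, 29] → Clean π.length 0 (s.arr a) :=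
    fun a ha _ _ _ _ _ _ => az a ha _
  have hlay : ∀ {L : ℕ → ℕ}, (∀ x, 1 ≤ x → x ≤ π.length + 1 → L x = x) →
      Layout π.length π.length L := fun hL =>
    ⟨hL 1 le_rfl (by omega), hL _ (by omega) le_rfl, fun x h₁ h₂ => by
      rw [hL x h₁ (by omega), hL (x + 1) (by omega) (by omega)]; omega⟩
  have lx := fun x h₁ h₂ => (l₃ x h₁ h₂).1
  have ly := fun x h₁ h₂ => (l₃ x h₁ h₂).2
  have memS : ∀ p : ℕ × ℕ, p ∈ (π.S.image fun i => (π.P i 0, π.P i 1)) ↔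
      ∃ i ∈ π.S, π.P i 0 = p.1 ∧ π.P i 1 = p.2 := fun p => by
    simp only [Finset.mem_image, Prod.ext_iff]
  refine ⟨Or.inl ⟨v9, π.length, π.length, π.length, π.S.image fun i => (π.P i 0, π.P i 1), ?_, ?_⟩,
    ?_⟩
  · rw [v8]
    refine
      { len := (vv 0 (by decide)).trans rfl, grid := (vv 1 (by decide)).trans rfl, bound := v2,
        cols := v3, rows := v4, size := by rw [v24, max_self], cells := v5,
        cols_pos := hn, cols_le := le_rfl, rows_pos := hn, rows_le := le_rfl, cells_le := ?_,
        cells_le_length := le_rfl, list₁ := ?_, list₂ := ?_, range := ?_, layoutX := hlay lx,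
        layoutY := hlay ly, point := ?_, cleanIndex := hclean 17 (by decide),
        cleanMark := hclean 18 (by decide), tracks := ?_ }
    · rw [max_self]
      exact (Nat.le_mul_of_pos_left _ hF).trans (Nat.le_succ _)
    · refine ⟨?_, ?_, ?_⟩
      · intro i j i₁ i₂ j₁ j₂ he _
        rwa [(hid i i₁ i₂).2.2.1, (hid j j₁ j₂).2.2.1] at he
      · intro p
        rw [memS]
        constructor
        · rintro ⟨i, hi, h₁, h₂⟩
          obtain ⟨r₁, r₂⟩ := hP i hi 0
          obtain ⟨-, -, k₃, k₄⟩ := hid _ r₁ r₂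
          rw [hidP i hi] at k₄
          exact ⟨π.P i 0, r₁, r₂, k₃.trans h₁, k₄.trans h₂⟩
        · rintro ⟨j, j₁, j₂, j₃, j₄⟩
          obtain ⟨k₁, k₂, k₃, k₄⟩ := hid j j₁ j₂
          exact ⟨s.arr aId j, k₁, by omega, by omega⟩
      · intro i j i₁ i₂ j₂
        rw [(hid i i₁ (by omega)).2.2.1, (hid j (by omega) j₂).2.2.1]
        exact i₂
    · refine ⟨?_, ?_, ?_⟩
      · intro i j i₁ i₂ j₁ j₂ he _
        rwa [(l₂ i i₁ i₂).1, (l₂ j j₁ j₂).1] at he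
      · rintro ⟨y, x⟩
        have : (y, x) ∈ (π.S.image fun i => (π.P i 0, π.P i 1)).image Prod.swap ↔
            (x, y) ∈ π.S.image fun i => (π.P i 0, π.P i 1) := by
          simp only [Finset.mem_image, Prod.exists, Prod.swap_prod_mk]
          constructor
          · rintro ⟨a, b, h, he⟩
            obtain ⟨rfl, rfl⟩ := Prod.mk.inj he
            exact h
          · intro h
            exact ⟨x, y, h, rfl⟩
        rw [this, memS]
        constructor
        · rintro ⟨i, hi, h₁, h₂⟩
          obtain ⟨r₁, r₂⟩ := hP i hi 1
          obtain ⟨k₁, k₂⟩ := hx2 i hi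
          exact ⟨π.P i 1, r₁, r₂, k₁.trans h₂, k₂.trans h₁⟩
        · rintro ⟨j, j₁, j₂, j₃, j₄⟩
          obtain ⟨i, hi, rfl⟩ := hy2 j j₁ j₂
          obtain ⟨k₁, k₂⟩ := hx2 i hi
          exact ⟨i, hi, k₂.symm.trans j₄, k₁.symm.trans j₃⟩
      · intro i j i₁ i₂ j₂
        rw [(l₂ i i₁ (by omega)).1, (l₂ j (by omega) j₂).1]
        exact i₂
    · intro p hp
      obtain ⟨i, hi, h₁, h₂⟩ := (memS p).mp hp
      rw [← h₁, ← h₂]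
      exact ⟨hP i hi 0, hP i hi 1⟩
    · intro p hp
      obtain ⟨i, hi, h₁, h₂⟩ := (memS p).mp hp
      obtain ⟨a₁, a₂⟩ := hP i hi 0
      obtain ⟨b₁, b₂⟩ := hP i hi 1
      rw [← h₁, ← h₂]
      refine ⟨i, hi, ⟨?_, ?_⟩, ?_, ?_⟩
      · rw [lx _ a₁ (by omega)]
      · rw [lx _ (by omega) (by omega)]; omega
      · rw [ly _ b₁ (by omega)]
      · rw [ly _ (by omega) (by omega)]; omega
    · intro _
      refine ⟨⟨fun x h₁ h₂ => ?_, fun y h₁ h₂ => ?_⟩, ?_⟩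
      · obtain ⟨k₁, k₂, -⟩ := hid x h₁ h₂
        exact ⟨_, Finset.mem_image_of_mem _ k₁, k₂⟩
      · obtain ⟨i, hi, h⟩ := hy2 y h₁ h₂
        exact ⟨_, Finset.mem_image_of_mem _ hi, h⟩
      · have hlab : Labelled π.length (4 * min (gridBound r) π.length) π.toFamily
            ![π.length, π.length] ![s.arr aLeftX, s.arr aLeftY] fun α i => π.P i α := by
          refine ⟨?_, ?_, ?_, ?_⟩
          · intro α
            fin_cases α
            · exact hlay lx
            · exact hlay ly
          · intro i hi α
            fin_cases α
            · exact hP i hi 0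
            · exact hP i hi 1
          · intro i hi α
            fin_cases α
            · obtain ⟨a₁, a₂⟩ := hP i hi 0
              refine ⟨(lx _ a₁ (by omega)).le, ?_⟩
              refine lt_of_lt_of_eq (Nat.lt_succ_self (π.P i 0)) ?_
              exact (lx _ (by omega) (by omega)).symm
            · obtain ⟨a₁, a₂⟩ := hP i hi 1
              refine ⟨(ly _ a₁ (by omega)).le, ?_⟩
              refine lt_of_lt_of_eq (Nat.lt_succ_self (π.P i 1)) ?_
              exact (ly _ (by omega) (by omega)).symm
          · intro α x
            -- At the start each line contains at most one point.
            refine le_trans (Finset.card_le_one.mpr ?_) (show 1 ≤ _ by omega)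
            intro i hi j hj
            simp only [Finset.mem_filter] at hi hj
            exact Permutation.eq_of_coord hi.1 hj.1 α (hi.2.trans hj.2.symm)
        refine ⟨π.toFamily, [], _, Reach.start hlab.wide, hlab, ?_, ?_, ?_, ?_, ?_, ?_, ?_⟩
        · rw [vv 6 (by decide), zv 6 (by decide)]; rfl
        · rw [v7, vv 6 (by decide), zv 6 (by decide)]; rfl
        · intro p hp
          exact absurd hp (Nat.not_lt_zero p)
        · intro i hi
          rw [v7]
          exact ((hmem i).mp hi).2
        · intro i
          constructor
          · intro hi
            exact ⟨π.P i 0, hP i hi 0, hidP i hi⟩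
          · rintro ⟨p, ⟨h₁, h₂⟩, rfl⟩
            exact (hid p h₁ h₂).1
        · rintro p q ⟨h₁, h₂⟩ ⟨h₃, h₄⟩ he
          rw [← (hid p h₁ h₂).2.1, ← (hid q h₃ h₄).2.1, he]
        · rintro p ⟨h₁, h₂⟩
          obtain ⟨-, k₂, k₃, k₄⟩ := hid p h₁ h₂
          exact ⟨k₂.trans k₃.symm, k₄.symm⟩
  · rw [v8]
    exact ⟨az 13 (by decide) _, az 14 (by decide) _, az 11 (by decide) _, az 12 (by decide) _,
      hclean 19 (by decide), hclean 20 (by decide), hclean 21 (by decide),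
      fun _ _ _ _ => az 22 (by decide) _, fun _ _ => az 25 (by decide) _⟩
  -- The minimum is at most `N = n`, hence `18000 + 12000`.
  · rw [loopPot, if_pos v9, v5, v24]
    omega

/-! ### Reading off the result -/

theorem exists_isPartition {r : ℕ} {A : ℕ → ℕ} (hr : 1 ≤ r)
    (hA : ∀ i, 1 ≤ i → i ≤ r → A i < A (i + 1)) :
    ∃ (Q : Fin r → NonemptyInterval ℕ) (I : NonemptyInterval ℕ), IsPartition Q I ∧ I.fst = A 1 ∧
      ∀ x : Fin r, (Q x).fst = A (x + 1) ∧ (Q x).snd = A (x + 2) - 1 := by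
  have mono : ∀ i j, 1 ≤ i → i ≤ j → j ≤ r + 1 → A i ≤ A j := by
    intro i j hi hij
    induction j, hij using Nat.le_induction with
    | base => exact fun _ => le_rfl
    | succ k hk ih => exact fun h => (ih (by omega)).trans (hA k (by omega) (by omega)).le
  have step : ∀ x : Fin r, A (x + 1) < A (x + 2) := fun x => hA _ (by omega) x.isLt
  let Q : Fin r → NonemptyInterval ℕ := fun x =>
    ⟨(A (x + 1), A (x + 2) - 1), by have := step x; simp only; omega⟩
  have h1 : A 1 < A 2 := hA 1 le_rfl hr
  have h2 := mono 2 (r + 1) (by omega) (by omega) le_rfl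
  have ordered : ∀ a b : Fin r, a < b → (Q a).snd < (Q b).fst := by
    intro a b hab
    have h₁ := mono (a + 2) (b + 1) (by omega) (by have : (a : ℕ) < b := hab; omega) (by omega)
    have h₂ := step a
    simp only [Q]
    omega
  have find : ∀ k, k ≤ r → ∀ c, A 1 ≤ c → c < A (k + 1) →
      ∃ i, i < k ∧ A (i + 1) ≤ c ∧ c < A (i + 2) := by
    intro k
    induction k with
    | zero => intro _ c h₁ h₂; exact absurd h₂ (by simpa using h₁)
    | succ k ih =>
      intro hk c h₁ h₂
      by_cases hc : c < A (k + 1)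
      · obtain ⟨i, i₁, i₂⟩ := ih (by omega) c h₁ hc
        exact ⟨i, by omega, i₂⟩
      · exact ⟨k, by omega, by omega, h₂⟩
  have h3 : A 1 ≤ A (r + 1) - 1 := by omega
  refine ⟨Q, ⟨(A 1, A (r + 1) - 1), h3⟩, ⟨?_, ?_, ordered⟩, rfl,
    fun x => ⟨rfl, rfl⟩⟩
  · intro a b hab
    rw [Set.disjoint_left]
    intro c hc hc'
    rw [SetLike.mem_coe, NonemptyInterval.mem_def] at hc hc'
    rcases lt_or_gt_of_ne hab with h | h
    · have := ordered a b h; omega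
    · have := ordered b a h; omega
  · ext c
    simp only [Set.mem_iUnion, SetLike.mem_coe, NonemptyInterval.mem_def, Q]
    constructor
    · rintro ⟨x, h₁, h₂⟩
      have h₃ := mono 1 (x + 1) le_rfl (by omega) (by omega)
      have h₄ := mono (x + 2) (r + 1) (by omega) (by omega) le_rfl
      have h₅ := step x
      constructor <;> omega
    · rintro ⟨h₁, h₂⟩
      obtain ⟨i, i₁, i₂, i₃⟩ := find r le_rfl c h₁ (by omega)
      exact ⟨⟨i, i₁⟩, i₂, by simp only; omega⟩

theorem Cells.exists_grid {π : Permutation} {r m₀ m₁ N t : ℕ} {S : Finset (ℕ × ℕ)} {s : Store}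
    (hr : 1 ≤ r) (h : Cells π r m₀ m₁ N t S s) {x y : ℕ → ℕ} (hg : GridBreaks r m₀ m₁ S x y) :
    ∃ (R : Rect) (G : Gridding R r r), G.IsGridIn π.points ∧ ∀ i : Fin r,
      (G.col i).fst = s.arr aLeftX (x (i + 1)) ∧ (G.col i).snd = s.arr aLeftX (x (i + 2)) - 1 ∧
      (G.row i).fst = s.arr aLeftY (y (i + 1)) ∧ (G.row i).snd = s.arr aLeftY (y (i + 2)) - 1 := by
  have aux : ∀ {m : ℕ} {b : ℕ → ℕ}, 1 ≤ b 1 →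
      (∀ i, 1 ≤ i → i ≤ r → b i < b (i + 1)) → b (r + 1) = m + 1 →
      (∀ i, 1 ≤ i → i ≤ r + 1 → 1 ≤ b i ∧ b i ≤ m + 1) := by
    intro m b hb1 hb hbl i hi hir
    have mono : ∀ i j, 1 ≤ i → i ≤ j → j ≤ r + 1 → b i ≤ b j := by
      intro i j hi hij
      induction j, hij using Nat.le_induction with
      | base => exact fun _ => le_rfl
      | succ k hk ih => exact fun h => (ih (by omega)).trans (hb k (by omega) (by omega)).le
    exact ⟨hb1.trans (mono 1 i le_rfl hi hir), hbl ▸ mono i (r + 1) hi hir le_rfl⟩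
  have lt : ∀ {m : ℕ} {L : ℕ → ℕ}, Layout π.length m L → ∀ i j, 1 ≤ i → i < j → j ≤ m + 1 →
      L i < L j := fun hL i j h₁ h₂ h₃ =>
    (hL.lt i h₁ (by omega)).trans_le (hL.mono (by omega) h₂ h₃)
  have bx := aux hg.one_x hg.lt_x hg.last_x
  have bY := aux hg.one_y hg.lt_y hg.last_y
  obtain ⟨Q, I, hQ, hI, hq⟩ := exists_isPartition (A := fun i => s.arr aLeftX (x i)) hr
    fun i h₁ h₂ => lt h.layoutX _ _ (bx i h₁ (by omega)).1 (hg.lt_x i h₁ h₂)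
      (bx (i + 1) (by omega) (by omega)).2
  obtain ⟨Q', I', hQ', hI', hq'⟩ := exists_isPartition (A := fun i => s.arr aLeftY (y i)) hr
    fun i h₁ h₂ => lt h.layoutY _ _ (bY i h₁ (by omega)).1 (hg.lt_y i h₁ h₂)
      (bY (i + 1) (by omega) (by omega)).2
  have posX : 1 ≤ I.fst := by
    rw [hI]
    refine h.layoutX.first.ge.trans ?_
    exact h.layoutX.mono le_rfl hg.one_x (bx 1 le_rfl (by omega)).2
  have posY : 1 ≤ I'.fst := by
    rw [hI']
    refine h.layoutY.first.ge.trans ?_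
    exact h.layoutY.mono le_rfl hg.one_y (bY 1 le_rfl (by omega)).2
  refine ⟨![I, I'], ⟨Q, Q', ?_, hQ, hQ'⟩, ?_, fun i => ⟨(hq i).1, (hq i).2, (hq' i).1, (hq' i).2⟩⟩
  · intro α
    fin_cases α
    · exact posX
    · exact posY
  · intro i j
    obtain ⟨p, hp, ⟨p₁, p₂⟩, p₃, p₄⟩ := hg.cell (i + 1) (j + 1) (by omega) i.isLt (by omega) j.isLt
    obtain ⟨l, hl, ⟨l₁, l₂⟩, l₃, l₄⟩ := h.point p hp
    obtain ⟨⟨r₁, r₂⟩, r₃, r₄⟩ := h.range p hp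
    refine ⟨π.P l, ⟨l, hl, rfl⟩, fun α => ?_⟩
    fin_cases α
    · change π.P l 0 ∈ Q i
      rw [NonemptyInterval.mem_def, (hq i).1, (hq i).2]
      have h₁ := h.layoutX.mono (bx (i + 1) (by omega) (by omega)).1 p₁ (by omega)
      have h₂ := h.layoutX.mono (x := p.1 + 1) (by omega) p₂
        (bx (i + 2) (by omega) (by omega)).2
      exact ⟨h₁.trans l₁, by simp only [add_assoc, Nat.reduceAdd] at h₂; omega⟩
    · change π.P l 1 ∈ Q' j
      rw [NonemptyInterval.mem_def, (hq' j).1, (hq' j).2]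
      have h₁ := h.layoutY.mono (bY (j + 1) (by omega) (by omega)).1 p₃ (by omega)
      have h₂ := h.layoutY.mono (x := p.2 + 1) (by omega) p₄
        (bY (j + 2) (by omega) (by omega)).2
      exact ⟨h₁.trans l₃, by simp only [add_assoc, Nat.reduceAdd] at h₂; omega⟩

/-- The breakpoints increase strictly from at least 1 to `m₀ + 1`. This bounds the time for the
output of a grid by `O(n)`. -/
theorem GridBreaks.le {r m₀ m₁ : ℕ} {S : Finset (ℕ × ℕ)} {x y : ℕ → ℕ}
    (h : GridBreaks r m₀ m₁ S x y) : r ≤ m₀ := by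
  have : ∀ k, k ≤ r → k + 1 ≤ x (k + 1) := by
    intro k
    induction k with
    | zero => exact fun _ => h.one_x
    | succ k ih =>
      intro hk
      have h₁ := ih (by omega)
      have h₂ := h.lt_x (k + 1) (by omega) hk
      omega
  have := this r le_rfl
  rw [h.last_x] at this
  omega

/-- A gridding with one column and one row has at most one cell, which is not dense as `F ≥ 1`. So
the record of merges is valid, and the family that it leads to has one rectangle per cell. -/
theorem Cells.exists_decomposition {π : Permutation} {r N t : ℕ} {S : Finset (ℕ × ℕ)}
    {s : Store} (hr : 1 ≤ r) (hπ : π.Reduced) (h : Cells π r 1 1 N t S s) :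
    ∃ (D : Fin (s.var vMerges + 1) → RectFamily) (σ : Fin (s.var vMerges) → MergeStep),
      IsDecomposition π D ∧ (∀ p, (D p).Wide (gridWidth r)) ∧ IsMergeSequence D σ ∧
      ∀ p : Fin (s.var vMerges), s.arr 2 (p + 1) = (σ p).i ∧ s.arr 3 (p + 1) = (σ p).j ∧
        s.arr 4 (p + 1) = (σ p).k := by
  have hN : N ≤ 1 := by
    rw [← h.list₁.card]
    refine Finset.card_le_one.mpr fun p hp q hq => ?_
    have := h.range p hp
    have := h.range q hq
    exact Prod.ext (by omega) (by omega)
  have hF := h.one_le_bound hr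
  obtain rfl : N = 1 := le_antisymm hN h.pos
  obtain ⟨-, F, σ, lab, k₁, -, k₃, -, k₅, -, k₇, -, -⟩ := h.tracks (by rw [max_self]; omega)
  have hcard : F.S.card = 1 := by
    rw [Finset.card_eq_one]
    refine ⟨s.arr aId 1, Finset.ext fun i => ?_⟩
    rw [k₇, Finset.mem_singleton]
    constructor
    · rintro ⟨p, ⟨h₁, h₂⟩, rfl⟩
      rw [le_antisymm h₂ h₁]
    · rintro rfl
      exact ⟨1, ⟨le_rfl, le_rfl⟩, rfl⟩
  obtain ⟨D, d₁, d₂, d₃⟩ := k₁.exists_decomposition (fun i hi => by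
    rw [hπ.1, Finset.mem_Icc] at hi; exact hi.2) hcard
  rw [← k₃]
  refine ⟨D, fun p => σ[p], d₁, fun p i hi => (d₂ p i hi).trans_le ?_, d₃, fun p => k₅ p p.isLt⟩
  -- The width obtained is `4 * F`, which is at most `gridWidth r`.
  exact Nat.mul_le_mul_left 4 (min_le_left _ _)

/-- The output is a grid in `π` or the merge sequence of a decomposition of `π`. -/
def Correct (π : Permutation) (r : ℕ) (s : Store) : Prop :=
  (∃ (R : Rect) (G : Gridding R r r), G.IsGridIn π.points ∧ s.OutputsGrid G) ∨
    ∃ (m : ℕ) (D : Fin (m + 1) → RectFamily) (σ : Fin m → MergeStep),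
      IsDecomposition π D ∧ (∀ p, (D p).Wide (gridWidth r)) ∧
      IsMergeSequence D σ ∧ s.OutputsMergeSequence σ

theorem output_ends {π : Permutation} {r : ℕ} (hr : 1 ≤ r) (hπ : π.Reduced) {s : Store}
    (hs : LoopInv π r s) (hc : roundCond.eval s = 0) :
    output.Ends s (60 * π.length + 50) (Correct π r) := by
  refine Cmd.Ends.mono (T := 1 + 1 + (60 * π.length + 40)) ?_ (by omega) (fun _ _ h => h)
  refine Cmd.Ends.ite (fun hne => ?_) (fun heq => ?_)
  · simp only [Expr.eval] at hne
    obtain ⟨-, m₀, m₁, N, t, S, h, hg⟩ := hs.resolve_left fun h => hne h.1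
    have hrn : r ≤ π.length := hg.le.trans h.cols_le
    obtain ⟨R, G, hG, hE⟩ := h.exists_grid hr hg
    refine Cmd.Ends.mono (T := (r * (20 + 10) + 10) + ((r * (20 + 10) + 10) + 5)) ?_ (by omega)
      (fun _ _ h => h)
    refine Cmd.Ends.then (output_loop_ends h.grid (by decide) (by decide) (by decide)) ?_
    intro s₁ f₁ k₁
    refine Cmd.Ends.then (output_loop_ends (r := r) ((f₁.1 1 (by decide)).trans h.grid) (by decide)
      (by decide) (by decide)) ?_
    intro s₂ f₂ k₂
    refine Cmd.Straight.ends (by simp) (by simp [Cmd.time, Expr.cost]) (Or.inl ⟨R, G, hG, ?_⟩)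
    refine ⟨by simp, fun i => ?_⟩
    obtain ⟨e₁, e₂, e₃, e₄⟩ := hE i
    obtain ⟨o₁, o₂⟩ := k₁ (i + 1) (by omega) i.isLt
    obtain ⟨o₃, o₄⟩ := k₂ (i + 1) (by omega) i.isLt
    rw [f₁.2 16 (by decide), f₁.2 27 (by decide)] at o₃ o₄
    simp only [Cmd.exec, Store.setVar]
    rw [f₂.2 2 (by decide), f₂.2 3 (by decide), e₁, e₂, e₃, e₄]
    exact ⟨o₁, o₂, o₃, o₄⟩
  · simp only [Expr.eval] at heq
    obtain ⟨-, m₀, m₁, N, S, h, -⟩ := hs.resolve_right fun h => by omega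
    have hm : max m₀ m₁ ≤ 1 := by
      by_contra hlt
      simp [roundCond, heq, h.size] at hc
      omega
    obtain rfl : m₀ = 1 := le_antisymm ((le_max_left _ _).trans hm) h.cols_pos
    obtain rfl : m₁ = 1 := le_antisymm ((le_max_right _ _).trans hm) h.rows_pos
    obtain ⟨D, σ, d₁, d₂, d₃, d₄⟩ := h.exists_decomposition hr hπ
    refine Cmd.Straight.ends (by simp) (by simp [Cmd.time, Expr.cost]) 
      (Or.inr ⟨_, D, σ, d₁, d₂, d₃, ?_⟩)
    exact ⟨by simp, by simp, d₄⟩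

theorem Cmd.Ends.assoc {c₁ c₂ c₃ : Cmd} {s : Store} {T : ℕ} {Q : Store → Prop}
    (h : ((c₁ ;; c₂) ;; c₃).Ends s T Q) : (c₁ ;; c₂ ;; c₃).Ends s T Q := by
  obtain ⟨t, s', h, hT⟩ := h
  cases h with
  | seq h₁ h₂ =>
    cases h₁ with
    | seq h₃ h₄ => exact ⟨_, s', .seq h₃ (.seq h₄ h₂), by rwa [← add_assoc]⟩

theorem gridOrDecomposition_ends {π : Permutation} {r : ℕ} (hr : 1 ≤ r) (hπ : π.Reduced)
    (hn : 1 ≤ π.length) :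
    gridOrDecomposition.Ends (inputStore π r) (31000 * π.length) (Correct π r) := by
  refine Cmd.Ends.assoc (Cmd.Ends.mono (T := (300 * π.length + 300) +
    ((30000 * π.length + roundCond.cost + 1) + (60 * π.length + 50))) ?_
    (by rw [show roundCond.cost = 7 from rfl]; omega) (fun _ _ h => h))
  refine Cmd.Ends.then (init_ends hr hπ hn) ?_
  rintro s₁ - ⟨h₁, h₂⟩
  refine Cmd.Ends.then (Cmd.Ends.mono (Cmd.Ends.loop (I := LoopInv π r) (pot := loopPot)
    (fun s hs hc => round_ends hr hs hc) h₁) (by omega) (fun _ _ h => h)) ?_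
  rintro s₂ - ⟨h₃, h₄⟩
  exact output_ends hr hπ h₃ h₄

/-! ### The word length and the growth of the width -/

theorem inputStore_le {π : Permutation} {r : ℕ} (hπ : π.Reduced) :
    (inputStore π r).Le (π.length + r + 2) := by
  constructor
  · intro x
    simp only [inputStore]
    split_ifs <;> omega
  · intro a i
    simp only [inputStore]
    split_ifs with hi
    · have := (hπ.2 i hi 0).2; omega
    · have := (hπ.2 i hi 1).2; omega
    · omega
    · omega

/-- As `B ≥ 2`, constant factors can be moved to the exponent: `C + 1 ≤ 2 ^ (C + 1) ≤ B ^ (C + 1)`.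
-/
theorem pow_lt_word {B n t C d : ℕ} (hB : 2 ≤ B) (hn : n ≤ B) (ht : t ≤ C * n) :
    (B + t) ^ d < B ^ ((C + 2) * d + 1) := by
  have h₁ : B + t ≤ B ^ (C + 2) :=
    calc B + t ≤ B + C * B := Nat.add_le_add_left (ht.trans (Nat.mul_le_mul_left _ hn)) _
      _ = (C + 1) * B := by ring
      _ ≤ 2 ^ (C + 1) * B := Nat.mul_le_mul_right _ Nat.lt_two_pow_self.le
      _ ≤ B ^ (C + 1) * B := Nat.mul_le_mul_right _ (Nat.pow_le_pow_left hB _)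
      _ = B ^ (C + 2) := (pow_succ B (C + 1)).symm
  calc (B + t) ^ d ≤ (B ^ (C + 2)) ^ d := Nat.pow_le_pow_left h₁ d
    _ = B ^ ((C + 2) * d) := (pow_mul B _ _).symm
    _ < B ^ ((C + 2) * d + 1) := Nat.pow_lt_pow_right hB (Nat.lt_succ_self _)

theorem one_le_gridWidth {r : ℕ} (hr : 1 ≤ r) : 1 ≤ gridWidth r := by
  have := le_gridBound r
  unfold gridWidth
  omega

theorem gridWidth_le (r : ℕ) : gridWidth r ≤ 4 * (r ^ 4 * (r ^ 2) ^ r) :=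
  Nat.mul_le_mul_left _ (Nat.mul_le_mul_left _ (Nat.choose_le_pow _ _))

/-- The binomial coefficient is at most `(r ^ 2) ^ r`, so the logarithm is at most `log 4 + 4 * log
r + 2 * r * log r`; for `r ≥ 4` the first two terms are also bounded by a multiple of `r * log r`.
-/
theorem log_gridWidth_isBigO :
    (fun r : ℕ => Real.logb 2 (gridWidth r)) =O[atTop] fun r : ℕ => (r : ℝ) * Real.log r := by
  refine IsBigO.of_bound (8 / Real.log 2) ?_
  filter_upwards [eventually_ge_atTop 4] with r hr
  have hr' : (4 : ℝ) ≤ r := by exact_mod_cast hr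
  have hl4 : Real.log 4 ≤ Real.log r := Real.log_le_log (by norm_num) hr'
  have hl0 : 0 ≤ Real.log r := Real.log_nonneg (by linarith)
  have hl2 : 0 < Real.log 2 := Real.log_pos (by norm_num)
  have hg : (1 : ℝ) ≤ gridWidth r := by exact_mod_cast one_le_gridWidth (by omega)
  have hle : (gridWidth r : ℝ) ≤ 4 * ((r : ℝ) ^ 4 * ((r : ℝ) ^ 2) ^ r) := by
    exact_mod_cast gridWidth_le r
  have hlog : Real.log (gridWidth r) ≤ 8 * (r * Real.log r) := by
    calc Real.log (gridWidth r) ≤ Real.log (4 * ((r : ℝ) ^ 4 * ((r : ℝ) ^ 2) ^ r)) :=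
          Real.log_le_log (by linarith) hle
      _ = Real.log 4 + (4 * Real.log r + r * (2 * Real.log r)) := by
          rw [Real.log_mul (by norm_num) (by positivity), Real.log_mul (by positivity)
            (by positivity), Real.log_pow, Real.log_pow, Real.log_pow]
          norm_num
      _ ≤ 8 * (r * Real.log r) := by nlinarith
  rw [Real.norm_of_nonneg (Real.logb_nonneg (by norm_num) hg),
    Real.norm_of_nonneg (by positivity), Real.logb, div_mul_eq_mul_div]
  exact div_le_div_of_nonneg_right hlog hl2.le

end PermDecomp

open PermDecomp
theorem theoremt :
    (∃ h : ℕ → ℝ, h =O[atTop] (fun r : ℕ => (r : ℝ) * Real.log r) ∧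
      ∀ r : ℕ, 1 ≤ r → (gridWidth r : ℝ) = (2 : ℝ) ^ h r) ∧
    ∃ (prog : Cmd) (C c : ℕ), ∀ r : ℕ, 1 ≤ r →
      ∀ π : Permutation, π.Reduced → 1 ≤ π.length →
        ∃ (t : ℕ) (s : Store),
          prog.Runs ((π.length + r + 2) ^ c) (inputStore π r) t s ∧
          t ≤ C * π.length ∧
          ((∃ (R : Rect) (G : Gridding R r r), G.IsGridIn π.points ∧ s.OutputsGrid G) ∨
            (∃ (m : ℕ) (D : Fin (m + 1) → RectFamily) (σ : Fin m → MergeStep),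
              IsDecomposition π D ∧ (∀ p, (D p).Wide (gridWidth r)) ∧
              IsMergeSequence D σ ∧ s.OutputsMergeSequence σ)) := by
  constructor
  · refine ⟨fun r => Real.logb 2 (gridWidth r), log_gridWidth_isBigO, fun r hr => ?_⟩
    have hg : 0 < (gridWidth r : ℝ) := by exact_mod_cast one_le_gridWidth hr
    rw [Real.rpow_logb (by norm_num) (by norm_num) hg]
  -- The constant is made opaque so that the exponent of the word bound is not evaluated.
  · obtain ⟨C, hC⟩ : ∃ C, C = 31000 := ⟨_, rfl⟩
    refine ⟨gridOrDecomposition, C, (C + 2) * gridOrDecomposition.deg + 1, fun r hr π hπ hn => ?_⟩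
    obtain ⟨t, s, hs, ht, hQ⟩ := gridOrDecomposition_ends hr hπ hn
    rw [← hC] at ht
    exact ⟨t, s, (hs.runs gridOrDecomposition_tame (by omega) (inputStore_le hπ)
      (pow_lt_word (by omega) (by omega) ht)).1, ht, hQ⟩
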